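/- **Notation.** For $x\in\mathbb R^2$ write $x^\perp=(-x_2,x_1)^T$. Let $O(t)=\begin{pmatrix}\cos t&-\sin t\\ \sin t&\cos t\end{pmatrix}$, $G(x,t)=\frac{1}{4\pi t}e^{-|x|^2/4t}$, and let $$K(x,t)=G(x,t)\,\mathbb I+\int_t^\infty G(x,s)\Big(\frac{x\otimes x}{4s^2}-\frac{\mathbb I}{2s}\Big)ds$$ be the fundamental solution of the unsteady Stokes system in $\mathbb R^2$. For $a\in\mathbb R\setminus\{0\}$ and $\varepsilon>0$ set $$\Gamma_a^{(\varepsilon)}(x,y)=\int_0^\infty e^{-\varepsilon t}O(at)^TK(O(at)x-y,t)\,dt\quad(x\ne y),\qquad Q(x)=\frac{x}{2\pi|x|^2}.$$ **Proposition.** There is a constant $C>0$ such that the following holds for every $a\in\mathbb R\setminus\{0\}$, every $\varepsilon>0$ and every vector field $f\in L^1(\mathbb R^2)\cap L^\infty(\mathbb R^2)$ with $$\int_{\mathbb R^2}|x||f(x)|\,dx<\infty,\qquad f(x)=O\big(|x|^{-3}(\log|x|)^{-1}\big)\quad\text{as }|x|\to\infty$$ (for almost every $x$). The integral defining $\Gamma_a^{(\varepsilon)}(x,y)$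 converges absolutely for all $x\neq y$, and the integrals $$u_\varepsilon(x)=\int_{\mathbb R^2}\Gamma_a^{(\varepsilon)}(x,y)f(y)\,dy,\qquad p(x)=\int_{\mathbb R^2}Q(x-y)\cdot f(y)\,dy$$ converge absolutely for every $x\in\mathbb R^2$. For every $\rho\ge e$, $$\sup_{|x|\ge\rho}|x||u_\varepsilon(x)|\le C(1+|a|^{-1})\Big[\int_{\mathbb R^2}(1+|x|)|f(x)|\,dx+\sup_{|x|\ge\rho/2}|x|^3(\log|x|)|f(x)|\Big],$$ where the supremum on the right is the essential supremum; in particular $C$ is independent of $\varepsilon$, $\rho$, $a$ and $f$. Furthermore, $u_\varepsilon$ and $p$ are locally integrable, and the pair $\{u_\varepsilon,p\}$ satisfies $$\varepsilon u_\varepsilon-\Delta u_\varepsilon-a\big(x^\perp\cdot\nabla u_\varepsilon-u_\varepsilon^\perp\big)+\nabla p=f,\qquad \operatorname{div}u_\varepsilon=0\qquad\text{in }\mathbb R^2$$ in the sense of distributions. -/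

import Mathlib

open MeasureTheory Set Filter

open scoped ContDiff ENNReal

noncomputable section

namespace RotStokes

/-- The Euclidean plane. -/
abbrev Plane : Type := EuclideanSpace ℝ (Fin 2)

/-- `x^⊥ = (-x₂, x₁)`. -/
def perp (x : Plane) : Plane := !₂[-x 1, x 0]

/-- The rotation matrix `O(θ)`. -/
def rot (θ : ℝ) : Matrix (Fin 2) (Fin 2) ℝ :=
  !![Real.cos θ, -Real.sin θ; Real.sin θ, Real.cos θ]

/-- The product of a `2 × 2` matrix and a vector of the Euclidean plane. -/
def mulV (A : Matrix (Fin 2) (Fin 2) ℝ) (x : Plane) : Plane :=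
  WithLp.toLp 2 (A.mulVec x.ofLp)

/-- The heat kernel of the plane, `G(x,t) = (4πt)⁻¹ exp(-|x|²/(4t))`. -/
def heatKernel (x : Plane) (t : ℝ) : ℝ :=
  (4 * Real.pi * t)⁻¹ * Real.exp (-‖x‖ ^ 2 / (4 * t))

/-- `H(x,t) = ∫_t^∞ ∇²G(x,s) ds = ∫_t^∞ G(x,s) ((x ⊗ x)/(4s²) - 𝕀/(2s)) ds`, entry by entry. -/
def hessPart (x : Plane) (t : ℝ) : Matrix (Fin 2) (Fin 2) ℝ :=
  Matrix.of fun i j => ∫ s in Ioi t,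
    heatKernel x s * (x i * x j / (4 * s ^ 2) - (1 : Matrix (Fin 2) (Fin 2) ℝ) i j / (2 * s))

/-- The fundamental solution `K = G 𝕀 + H` of the unsteady Stokes system in the plane. -/
def stokesKernel (x : Plane) (t : ℝ) : Matrix (Fin 2) (Fin 2) ℝ :=
  heatKernel x t • (1 : Matrix (Fin 2) (Fin 2) ℝ) + hessPart x t

/-- The integrand `e^{-εt} O(at)ᵀ K(O(at)x - y, t)`. -/
def resolventIntegrand (ε a : ℝ) (x y : Plane) (t : ℝ) : Matrix (Fin 2) (Fin 2) ℝ :=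
  Real.exp (-ε * t) • ((rot (a * t)).transpose * stokesKernel (mulV (rot (a * t)) x - y) t)

/-- `Γ_a^{(ε)}(x,y) = ∫_0^∞ e^{-εt} O(at)ᵀ K(O(at)x - y, t) dt`, entry by entry. -/
def resolventKernel (ε a : ℝ) (x y : Plane) : Matrix (Fin 2) (Fin 2) ℝ :=
  Matrix.of fun i j => ∫ t in Ioi (0 : ℝ), resolventIntegrand ε a x y t i j

/-- `u_ε(x) = ∫ Γ_a^{(ε)}(x,y) f(y) dy`. -/
def resolventPotential (ε a : ℝ) (f : Plane → Plane) (x : Plane) : Plane :=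
  ∫ y, mulV (resolventKernel ε a x y) (f y)

/-- The pressure part `Q(x) = x / (2π|x|²)` of the fundamental solution. -/
def pressureKernel (x : Plane) : Plane := (2 * Real.pi * ‖x‖ ^ 2)⁻¹ • x

/-- `p(x) = ∫ Q(x - y) · f(y) dy`. -/
def pressurePotential (f : Plane → Plane) (x : Plane) : ℝ :=
  ∫ y, inner ℝ (pressureKernel (x - y)) (f y)

/-- The classical divergence of a vector field of the plane. -/
def div (φ : Plane → Plane) (x : Plane) : ℝ :=
  ∑ i : Fin 2, fderiv ℝ φ x (EuclideanSpace.single i 1) i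

/-- The operator `L_a φ = -Δφ - a (x^⊥ · ∇φ - φ^⊥)` on smooth vector fields. Its formal adjoint
is `L_{-a}`. -/
def rotOp (a : ℝ) (φ : Plane → Plane) (x : Plane) : Plane :=
  -Laplacian.laplacian φ x - a • (fderiv ℝ φ x (perp x) - perp (φ x))

/-- `{u, p}` is a solution, in the sense of distributions on the whole plane, to
`εu - Δu - a (x^⊥ · ∇u - u^⊥) + ∇p = f`, `div u = 0`. All derivatives are moved to the test
functions: `⟨u, (ε + L_{-a})φ⟩ - ⟨p, div φ⟩ = ⟨f, φ⟩` and `⟨u, ∇ψ⟩ = 0` for all smooth compactly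
supported `φ` (vector valued) and `ψ` (scalar). -/
structure IsDistribSolution (ε a : ℝ) (f u : Plane → Plane) (p : Plane → ℝ) : Prop where
  locallyIntegrable_force : LocallyIntegrable f volume
  locallyIntegrable_velocity : LocallyIntegrable u volume
  locallyIntegrable_pressure : LocallyIntegrable p volume
  momentum : ∀ φ : Plane → Plane, ContDiff ℝ ∞ φ → HasCompactSupport φ →
    (∫ x, inner ℝ (u x) (ε • φ x + rotOp (-a) φ x)) - ∫ x, p x * div φ x
      = ∫ x, inner ℝ (f x) (φ x)
  incompressible : ∀ ψ : Plane → ℝ, ContDiff ℝ ∞ ψ → HasCompactSupport ψ →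
    ∫ x, inner ℝ (u x) (gradient ψ x) = 0

end RotStokes

end

noncomputable section

namespace RotStokes

open scoped Topology

/-! ### Pointwise bounds for the heat kernel and its second derivatives -/

/-! Everything rests on parabolic scaling. The kernel satisfies |K| ≤ C(t+|x|²)^(-1), its spatial
increments are controlled by (t+|x|²)^(-3/2), and |∂ₜK| ≤ C(t+|x|²)^(-2).

Convergence: since t+|z|² ≥ √t |z|, the integrand is at most C e^(-εt) t^(-1/2) |O(at)x-y|^(-1). The
time factor is integrable, and 1/|·| convolved with L¹ ∩ L^∞ is bounded uniformly in the centre, so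
the rotation does no harm (`exists_lintegral_inv_enorm_mul_le`).

Far field, with R = |x| and constants free of ε: absolute values alone would leave a tail ∫ e^(-εt)
dt/t, which blows up as ε → 0. The remedy is oscillation: e^(-εt) O(at) has a primitive of size at
most 2/|a|, so integrating by parts against a kernel with a fixed spatial argument gives C|a|⁻¹/t₀
on (t₀, ∞) (`exists_abs_integral_osc_le`). For |y| < R/2 and t > R, replace O(at)x - y by O(at)x at
a cost of order |y|/R. The covariance O(θ)ᵀK(O(θ)x,t) = K(x,t)O(θ)ᵀ then freezes the argument. Times
t ≤ R contribute R · R⁻². For |y| ≥ R/2 and t > R², replace the argument by -y. The result is of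
order 1+|a|⁻¹, which is acceptable because 1 ≤ 2(1+|y|)/R and f has a first moment. For |y| ≥ R/2
and t ≤ R², use absolute values only: the weighted bound on f inside |O(at)x-y| < R, the first
moment outside.

Equation: by Fubini, pairing u_ε with a test field ψ equals pairing f with an adjoint potential, a
time integral over (0, ∞) of slices S_ψ(t) = e^(-εt) ∫ K(w,t) O(at)ψ(O(at)ᵀ(w+y)) dw. If ψ = (ε +
L_{-a})φ, then S_ψ = -dS_φ/dt: the three terms of ψ match the derivatives of the exponential, of the
kernel (heat equation) and of the rotation. Hence the integral is S_φ(0+), which is φ plus the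
convolution of Q with div φ, formally the Helmholtz projection of φ (`adjointPotential_adjointOp`).
The extra term is exactly the pairing of p with div φ. For ψ a gradient every slice vanishes,
because K is divergence free.

The kernel identities are proved weakly: H is minus the gradient of `truncPressure`, so second and
higher derivatives are put on the test function. -/

/-- The entries `∂ᵢ∂ⱼG(x,s)` of the Hessian of the heat kernel. -/
def gaussHess (x : Plane) (s : ℝ) (i j : Fin 2) : ℝ :=
  heatKernel x s * (x i * x j / (4 * s ^ 2) - (1 : Matrix (Fin 2) (Fin 2) ℝ) i j / (2 * s))

lemma hessPart_apply (x : Plane) (t : ℝ) (i j : Fin 2) :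
    hessPart x t i j = ∫ s in Ioi t, gaussHess x s i j := rfl

lemma stokesKernel_apply (x : Plane) (t : ℝ) (i j : Fin 2) :
    stokesKernel x t i j =
      heatKernel x t * (1 : Matrix (Fin 2) (Fin 2) ℝ) i j + hessPart x t i j := rfl

lemma abs_coord_le (x : Plane) (i : Fin 2) : |x i| ≤ ‖x‖ := by
  simpa using PiLp.norm_apply_le x i

lemma abs_one_apply_le (i j : Fin 2) : |(1 : Matrix (Fin 2) (Fin 2) ℝ) i j| ≤ 1 := by
  rw [Matrix.one_apply]; split_ifs <;> simp

/-- From uᵏ/k! ≤ eᵘ with u = (s+r)/(4s) = 1/4 + r/(4s); the 1/4 is the source of the factor e^(1/4).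
It trades Gaussian decay for a power of the parabolic distance s + r, uniformly down to s = 0. -/
lemma exists_exp_decay (k : ℕ) : ∃ C : ℝ, 0 < C ∧ ∀ s r : ℝ, 0 < s → 0 ≤ r →
    (s ^ k)⁻¹ * Real.exp (-r / (4 * s)) ≤ C * ((s + r) ^ k)⁻¹ := by
  refine ⟨k.factorial * 4 ^ k * Real.exp (1 / 4), by positivity, fun s r hs hr => ?_⟩
  have h1 := Real.pow_div_factorial_le_exp (x := (s + r) / (4 * s)) (by positivity) k
  have h2 : Real.exp ((s + r) / (4 * s)) = Real.exp (1 / 4) * Real.exp (r / (4 * s)) := by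
    rw [← Real.exp_add]; congr 1; field_simp
  have h3 : Real.exp (-r / (4 * s)) = (Real.exp (r / (4 * s)))⁻¹ := by
    rw [← Real.exp_neg]; congr 1; ring
  rw [h2, div_pow, mul_pow] at h1
  rw [h3]
  have hE := Real.exp_pos (r / (4 * s))
  have hf : (0 : ℝ) < k.factorial := by positivity
  rw [div_div, div_le_iff₀ (by positivity)] at h1
  rw [← mul_inv, inv_le_iff_one_le_mul₀ (by positivity), ← div_eq_mul_inv, mul_comm,
    mul_div_assoc', le_div_iff₀ (by positivity)]
  nlinarith [h1]

lemma rpow_neg_nat {u : ℝ} (hu : 0 < u) (k : ℕ) : (u ^ k)⁻¹ = u ^ (-(k : ℝ)) := by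
  rw [Real.rpow_neg hu.le, Real.rpow_natCast]

lemma heatKernel_nonneg (x : Plane) {t : ℝ} (ht : 0 < t) : 0 ≤ heatKernel x t := by
  unfold heatKernel; positivity

lemma heatKernel_le_exp (x : Plane) {t : ℝ} (ht : 0 < t) :
    heatKernel x t ≤ t⁻¹ * Real.exp (-‖x‖ ^ 2 / (4 * t)) := by
  unfold heatKernel
  gcongr
  nlinarith [Real.pi_gt_three]

lemma exists_heatKernel_le : ∃ C : ℝ, 0 < C ∧ ∀ (x : Plane) (t : ℝ), 0 < t →
    heatKernel x t ≤ C * (t + ‖x‖ ^ 2)⁻¹ := by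
  obtain ⟨C, hC, h⟩ := exists_exp_decay 1
  refine ⟨C, hC, fun x t ht => (heatKernel_le_exp x ht).trans ?_⟩
  simpa using h t (‖x‖ ^ 2) ht (by positivity)

/-- The Hessian consists of r s⁻³ and s⁻² times the Gaussian, r = |x|². Both have the same parabolic
degree, since r is absorbed by one power of s + r. -/
lemma exists_gaussHess_le : ∃ C : ℝ, 0 < C ∧ ∀ (x : Plane) (s : ℝ) (i j : Fin 2), 0 < s →
    |gaussHess x s i j| ≤ C * (s + ‖x‖ ^ 2) ^ (-2 : ℝ) := by
  obtain ⟨C₂, hC₂, h₂⟩ := exists_exp_decay 2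
  obtain ⟨C₃, hC₃, h₃⟩ := exists_exp_decay 3
  refine ⟨C₂ + C₃, by positivity, fun x s i j hs => ?_⟩
  have e2 := h₂ s (‖x‖ ^ 2) hs (by positivity)
  have e3 := h₃ s (‖x‖ ^ 2) hs (by positivity)
  set r := ‖x‖ ^ 2 with hr
  have hr0 : 0 ≤ r := by positivity
  have hij : |x i * x j| ≤ r := by
    rw [abs_mul, hr, sq]
    exact mul_le_mul (abs_coord_le x i) (abs_coord_le x j) (abs_nonneg _) (norm_nonneg _)
  have hb : |x i * x j / (4 * s ^ 2) - (1 : Matrix (Fin 2) (Fin 2) ℝ) i j / (2 * s)| ≤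
      r * (s ^ 2)⁻¹ + s⁻¹ := by
    refine (abs_sub _ _).trans (add_le_add ?_ ?_)
    · rw [abs_div, abs_of_pos (show (0 : ℝ) < 4 * s ^ 2 by positivity), ← div_eq_mul_inv]
      gcongr
      nlinarith [sq_nonneg s]
    · rw [abs_div, abs_of_pos (show (0 : ℝ) < 2 * s by positivity), inv_eq_one_div]
      have := abs_one_apply_le i j
      gcongr
      linarith
  have hexp := Real.exp_pos (-r / (4 * s))
  have hsr : 0 < s + r := by positivity
  have e4 : r * ((s + r) ^ 3)⁻¹ ≤ ((s + r) ^ 2)⁻¹ := by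
    rw [mul_inv_le_iff₀ (by positivity), pow_succ _ 2, ← mul_assoc,
      inv_mul_cancel₀ (by positivity)]
    linarith
  rw [show (-2 : ℝ) = -((2 : ℕ) : ℝ) by norm_num, ← rpow_neg_nat hsr]
  calc |gaussHess x s i j| ≤ (s⁻¹ * Real.exp (-r / (4 * s))) * (r * (s ^ 2)⁻¹ + s⁻¹) := by
        rw [gaussHess, abs_mul, abs_of_nonneg (heatKernel_nonneg x hs)]
        exact mul_le_mul (heatKernel_le_exp x hs) hb (abs_nonneg _) (by positivity)
    _ = r * ((s ^ 3)⁻¹ * Real.exp (-r / (4 * s))) + (s ^ 2)⁻¹ * Real.exp (-r / (4 * s)) := by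
        field_simp
    _ ≤ r * (C₃ * ((s + r) ^ 3)⁻¹) + C₂ * ((s + r) ^ 2)⁻¹ := by gcongr
    _ ≤ (C₂ + C₃) * ((s + r) ^ 2)⁻¹ := by nlinarith

lemma hasFDerivAt_heatKernel (x : Plane) {s : ℝ} (hs : 0 < s) :
    HasFDerivAt (fun z : Plane => heatKernel z s)
      ((-(heatKernel x s / (2 * s))) • innerSL ℝ x) x := by
  have h1 : HasFDerivAt (fun z : Plane => ‖z‖ ^ 2) (2 • innerSL ℝ x) x :=
    (hasStrictFDerivAt_norm_sq x).hasFDerivAt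
  have h2 := ((h1.neg.mul_const (4 * s)⁻¹).exp).const_mul (4 * Real.pi * s)⁻¹
  simp only [← div_eq_mul_inv] at h2
  convert! h2 using 1
  ext v
  simp [heatKernel]
  field_simp
  ring

lemma fderiv_heatKernel (x : Plane) {s : ℝ} (hs : 0 < s) (i : Fin 2) :
    fderiv ℝ (fun z : Plane => heatKernel z s) x (EuclideanSpace.single i 1) =
      -(x i / (2 * s)) * heatKernel x s := by
  rw [(hasFDerivAt_heatKernel x hs).fderiv]
  simp [EuclideanSpace.inner_single_right]
  ring

lemma hasFDerivAt_coord (x : Plane) (i : Fin 2) :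
    HasFDerivAt (fun z : Plane => z i) (EuclideanSpace.proj i : Plane →L[ℝ] ℝ) x :=
  (EuclideanSpace.proj i : Plane →L[ℝ] ℝ).hasFDerivAt

lemma hasFDerivAt_gaussHess (x : Plane) {s : ℝ} (hs : 0 < s) (i j : Fin 2) :
    HasFDerivAt (fun z : Plane => gaussHess z s i j)
      (heatKernel x s • ((4 * s ^ 2)⁻¹ • (x i • (EuclideanSpace.proj j : Plane →L[ℝ] ℝ) +
        x j • (EuclideanSpace.proj i : Plane →L[ℝ] ℝ))) +
      (x i * x j / (4 * s ^ 2) - (1 : Matrix (Fin 2) (Fin 2) ℝ) i j / (2 * s)) •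
        ((-(heatKernel x s / (2 * s))) • innerSL ℝ x)) x := by
  have h1 := (((hasFDerivAt_coord x i).mul (hasFDerivAt_coord x j)).mul_const
    (4 * s ^ 2)⁻¹).sub_const ((1 : Matrix (Fin 2) (Fin 2) ℝ) i j / (2 * s))
  exact (hasFDerivAt_heatKernel x hs).mul h1

/-- Because ρ ≤ √(s+ρ²). This produces the half-integer exponents of derivatives of odd order. -/
lemma norm_mul_rpow_le {s ρ : ℝ} (hs : 0 < s) (_hρ : 0 ≤ ρ) (k : ℕ) :
    ρ * ((s + ρ ^ 2) ^ k)⁻¹ ≤ (s + ρ ^ 2) ^ (1 / 2 - (k : ℝ)) := by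
  have hsr : 0 < s + ρ ^ 2 := by positivity
  rw [rpow_neg_nat hsr, sub_eq_add_neg, Real.rpow_add hsr]
  gcongr
  rw [← Real.sqrt_eq_rpow]
  exact Real.le_sqrt_of_sq_le (by linarith)

lemma exists_norm_fderiv_heatKernel_le : ∃ C : ℝ, 0 < C ∧ ∀ (x : Plane) (s : ℝ), 0 < s →
    ‖(-(heatKernel x s / (2 * s))) • innerSL ℝ x‖ ≤ C * (s + ‖x‖ ^ 2) ^ (-3 / 2 : ℝ) := by
  obtain ⟨C, hC, h⟩ := exists_exp_decay 2
  refine ⟨C, hC, fun x s hs => ?_⟩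
  have e := h s (‖x‖ ^ 2) hs (by positivity)
  have hn := norm_mul_rpow_le hs (norm_nonneg x) 2
  rw [norm_smul, innerSL_apply_norm, norm_neg, Real.norm_eq_abs, abs_div,
    abs_of_nonneg (heatKernel_nonneg x hs), abs_of_pos (by positivity : (0 : ℝ) < 2 * s)]
  calc heatKernel x s / (2 * s) * ‖x‖
      ≤ (s⁻¹ * Real.exp (-‖x‖ ^ 2 / (4 * s))) / s * ‖x‖ := by
        gcongr
        · exact heatKernel_le_exp x hs
        · linarith
    _ = ‖x‖ * ((s ^ 2)⁻¹ * Real.exp (-‖x‖ ^ 2 / (4 * s))) := by field_simp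
    _ ≤ ‖x‖ * (C * ((s + ‖x‖ ^ 2) ^ 2)⁻¹) := by gcongr
    _ = C * (‖x‖ * ((s + ‖x‖ ^ 2) ^ 2)⁻¹) := by ring
    _ ≤ C * (s + ‖x‖ ^ 2) ^ (-3 / 2 : ℝ) := by
        gcongr
        exact hn.trans_eq (by norm_num)

/-- The long expression is the derivative found in `hasFDerivAt_gaussHess`. Third derivatives of G
have parabolic degree -5, hence the exponent -5/2. -/
lemma exists_norm_fderiv_gaussHess_le : ∃ C : ℝ, 0 < C ∧
    ∀ (x : Plane) (s : ℝ) (i j : Fin 2), 0 < s →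
    ‖heatKernel x s • ((4 * s ^ 2)⁻¹ • (x i • (EuclideanSpace.proj j : Plane →L[ℝ] ℝ) +
        x j • (EuclideanSpace.proj i : Plane →L[ℝ] ℝ))) +
      (x i * x j / (4 * s ^ 2) - (1 : Matrix (Fin 2) (Fin 2) ℝ) i j / (2 * s)) •
        ((-(heatKernel x s / (2 * s))) • innerSL ℝ x)‖ ≤
      C * (s + ‖x‖ ^ 2) ^ (-5 / 2 : ℝ) := by
  obtain ⟨C₁, hC₁, h₁⟩ := exists_exp_decay 3
  obtain ⟨C₂, hC₂, h₂⟩ := exists_exp_decay 4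
  refine ⟨2 * C₁ + C₂, by positivity, fun x s i j hs => ?_⟩
  have e3 := h₁ s (‖x‖ ^ 2) hs (by positivity)
  have e4 := h₂ s (‖x‖ ^ 2) hs (by positivity)
  have hn := norm_mul_rpow_le hs (norm_nonneg x) 3
  set ρ := ‖x‖ with hρ
  have hρ0 : 0 ≤ ρ := norm_nonneg x
  have hsr : 0 < s + ρ ^ 2 := by positivity
  have hG : heatKernel x s ≤ s⁻¹ * Real.exp (-ρ ^ 2 / (4 * s)) := heatKernel_le_exp x hs
  have hG0 := heatKernel_nonneg x hs
  have hproj : ∀ k : Fin 2, ‖(EuclideanSpace.proj k : Plane →L[ℝ] ℝ)‖ ≤ 1 := fun k =>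
    ContinuousLinearMap.opNorm_le_bound _ zero_le_one fun v => by
      simpa using abs_coord_le v k
  have hA : ‖x i • (EuclideanSpace.proj j : Plane →L[ℝ] ℝ) +
      x j • (EuclideanSpace.proj i : Plane →L[ℝ] ℝ)‖ ≤ 2 * ρ := by
    refine (norm_add_le _ _).trans ?_
    rw [norm_smul, norm_smul, two_mul]
    have a1 := mul_le_mul (abs_coord_le x i) (hproj j) (norm_nonneg _) hρ0
    have a2 := mul_le_mul (abs_coord_le x j) (hproj i) (norm_nonneg _) hρ0
    simp only [mul_one] at a1 a2
    exact add_le_add a1 a2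
  have hij : |x i * x j| ≤ ρ ^ 2 := by
    rw [abs_mul, sq]
    exact mul_le_mul (abs_coord_le x i) (abs_coord_le x j) (abs_nonneg _) hρ0
  have hB : |x i * x j / (4 * s ^ 2) - (1 : Matrix (Fin 2) (Fin 2) ℝ) i j / (2 * s)| ≤
      ρ ^ 2 * (s ^ 2)⁻¹ + s⁻¹ := by
    refine (abs_sub _ _).trans (add_le_add ?_ ?_)
    · rw [abs_div, abs_of_pos (show (0 : ℝ) < 4 * s ^ 2 by positivity), ← div_eq_mul_inv]
      gcongr
      nlinarith [sq_nonneg s]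
    · rw [abs_div, abs_of_pos (show (0 : ℝ) < 2 * s by positivity), inv_eq_one_div]
      have := abs_one_apply_le i j
      gcongr
      linarith
  have hsmall : ρ ^ 2 * ((s + ρ ^ 2) ^ 4)⁻¹ ≤ ((s + ρ ^ 2) ^ 3)⁻¹ := by
    rw [mul_inv_le_iff₀ (by positivity), pow_succ _ 3, ← mul_assoc,
      inv_mul_cancel₀ (by positivity)]
    linarith
  set E := Real.exp (-ρ ^ 2 / (4 * s)) with hE
  have hE0 : 0 < E := Real.exp_pos _
  have t1 : ‖heatKernel x s • ((4 * s ^ 2)⁻¹ • (x i • (EuclideanSpace.proj j : Plane →L[ℝ] ℝ) +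
        x j • (EuclideanSpace.proj i : Plane →L[ℝ] ℝ)))‖ ≤ ρ * ((s ^ 3)⁻¹ * E) := by
    rw [norm_smul, norm_smul, Real.norm_eq_abs, Real.norm_eq_abs, abs_of_nonneg hG0,
      abs_of_pos (by positivity)]
    calc _ ≤ (s⁻¹ * E) * ((4 * s ^ 2)⁻¹ * (2 * ρ)) := by gcongr
      _ = (1 / 2) * (ρ * ((s ^ 3)⁻¹ * E)) := by field_simp; ring
      _ ≤ _ := by
        have : 0 ≤ ρ * ((s ^ 3)⁻¹ * E) := by positivity
        linarith
  have t2 : ‖(x i * x j / (4 * s ^ 2) - (1 : Matrix (Fin 2) (Fin 2) ℝ) i j / (2 * s)) •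
        ((-(heatKernel x s / (2 * s))) • innerSL ℝ x)‖ ≤
      ρ * (ρ ^ 2 * ((s ^ 4)⁻¹ * E) + (s ^ 3)⁻¹ * E) := by
    rw [norm_smul, norm_smul, innerSL_apply_norm, Real.norm_eq_abs, norm_neg, Real.norm_eq_abs,
      abs_div, abs_of_nonneg hG0, abs_of_pos (by positivity : (0 : ℝ) < 2 * s)]
    calc _ ≤ (ρ ^ 2 * (s ^ 2)⁻¹ + s⁻¹) * ((s⁻¹ * E) / s * ρ) := by
          gcongr
          linarith
      _ = _ := by field_simp
  refine (norm_add_le _ _).trans ((add_le_add t1 t2).trans ?_)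
  calc _ ≤ ρ * (C₁ * ((s + ρ ^ 2) ^ 3)⁻¹) +
        ρ * (ρ ^ 2 * (C₂ * ((s + ρ ^ 2) ^ 4)⁻¹) + C₁ * ((s + ρ ^ 2) ^ 3)⁻¹) := by gcongr
    _ = ρ * (2 * C₁ * ((s + ρ ^ 2) ^ 3)⁻¹ + C₂ * (ρ ^ 2 * ((s + ρ ^ 2) ^ 4)⁻¹)) := by ring
    _ ≤ ρ * (2 * C₁ * ((s + ρ ^ 2) ^ 3)⁻¹ + C₂ * ((s + ρ ^ 2) ^ 3)⁻¹) := by gcongr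
    _ = (2 * C₁ + C₂) * (ρ * ((s + ρ ^ 2) ^ 3)⁻¹) := by ring
    _ ≤ _ := by
      gcongr
      exact hn.trans_eq (by norm_num)

/-- Mean value estimate along a segment that stays outside the ball of radius `m`. -/
lemma abs_sub_le_of_segment {g : Plane → ℝ} {g' : Plane → Plane →L[ℝ] ℝ} {x x' : Plane}
    {C s m b : ℝ} (hC : 0 ≤ C) (hb : b ≤ 0) (hs : 0 < s) (hm : 0 ≤ m)
    (hseg : ∀ z ∈ segment ℝ x x', m ≤ ‖z‖)
    (hg : ∀ z, HasFDerivAt g (g' z) z) (hg' : ∀ z, ‖g' z‖ ≤ C * (s + ‖z‖ ^ 2) ^ b) :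
    |g x' - g x| ≤ C * (s + m ^ 2) ^ b * ‖x' - x‖ := by
  refine (convex_segment x x').norm_image_sub_le_of_norm_hasFDerivWithin_le
    (fun z _ => (hg z).hasFDerivWithinAt) (fun z hz => (hg' z).trans ?_)
    (left_mem_segment ℝ x x') (right_mem_segment ℝ x x')
  have := hseg z hz
  gcongr ?_ * ?_
  exact Real.rpow_le_rpow_of_nonpos (by positivity) (by gcongr) hb

lemma exists_heatKernel_sub_le : ∃ C : ℝ, 0 < C ∧ ∀ (x x' : Plane) (s m : ℝ), 0 < s → 0 ≤ m →
    (∀ z ∈ segment ℝ x x', m ≤ ‖z‖) →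
    |heatKernel x' s - heatKernel x s| ≤ C * (s + m ^ 2) ^ (-3 / 2 : ℝ) * ‖x' - x‖ := by
  obtain ⟨C, hC, h⟩ := exists_norm_fderiv_heatKernel_le
  exact ⟨C, hC, fun x x' s m hs hm hseg => abs_sub_le_of_segment hC.le (by norm_num) hs hm hseg
    (fun z => hasFDerivAt_heatKernel z hs) fun z => h z s hs⟩

lemma exists_gaussHess_sub_le : ∃ C : ℝ, 0 < C ∧
    ∀ (x x' : Plane) (s m : ℝ) (i j : Fin 2), 0 < s → 0 ≤ m →
    (∀ z ∈ segment ℝ x x', m ≤ ‖z‖) →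
    |gaussHess x' s i j - gaussHess x s i j| ≤
      C * (s + m ^ 2) ^ (-5 / 2 : ℝ) * ‖x' - x‖ := by
  obtain ⟨C, hC, h⟩ := exists_norm_fderiv_gaussHess_le
  exact ⟨C, hC, fun x x' s m i j hs hm hseg => abs_sub_le_of_segment hC.le (by norm_num) hs hm
    hseg (fun z => hasFDerivAt_gaussHess z hs i j) fun z => h z s i j hs⟩

/-! ### The Stokes kernel: bounds, time derivative, trace, covariance -/

lemma integral_Ioi_add_rpow {a t m : ℝ} (ha : a < -1) (h : 0 < t + m) :
    ∫ s in Ioi t, (s + m) ^ a = -(t + m) ^ (a + 1) / (a + 1) := by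
  have h1 := MeasureTheory.integral_Ioi_of_hasDerivAt_of_tendsto' (a := t) (m := 0 / (a + 1))
    (f := fun s => (s + m) ^ (a + 1) / (a + 1)) (f' := fun s => (s + m) ^ a) ?_
    (integrableOn_add_rpow_Ioi_of_lt ha (by linarith)) ?_
  · rw [h1]; ring
  · intro x hx
    have hx' : 0 < x + m := by linarith [mem_Ici.mp hx]
    convert! (((hasDerivAt_id x).add_const m).rpow_const (p := a + 1) (Or.inl hx'.ne')).div_const
      (a + 1) using 1
    have : a + 1 ≠ 0 := by linarith
    simp
    field_simp
  · rw [← neg_neg (a + 1)]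
    exact (tendsto_rpow_neg_atTop (by linarith)).comp
      (tendsto_atTop_add_const_right _ m tendsto_id) |>.div_const _

@[fun_prop]
lemma measurable_coord (i : Fin 2) : Measurable (fun x : Plane => x i) :=
  (EuclideanSpace.proj i : Plane →L[ℝ] ℝ).continuous.measurable

@[fun_prop]
lemma measurable_heatKernel : Measurable (fun p : Plane × ℝ => heatKernel p.1 p.2) := by
  unfold heatKernel; fun_prop

@[fun_prop]
lemma measurable_gaussHess (i j : Fin 2) :
    Measurable (fun p : Plane × ℝ => gaussHess p.1 p.2 i j) := by
  unfold gaussHess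
  have h0 := measurable_heatKernel
  have h1 : Measurable (fun p : Plane × ℝ => p.1 i) := (measurable_coord i).comp measurable_fst
  have h2 : Measurable (fun p : Plane × ℝ => p.1 j) := (measurable_coord j).comp measurable_fst
  fun_prop

/-- The domain of integration depends on the parameter. Writing the integral over the whole line
with the indicator of t < s makes the integrand jointly measurable. -/
lemma measurable_hessPart (i j : Fin 2) :
    Measurable (fun p : Plane × ℝ => hessPart p.1 p.2 i j) := by
  have h : StronglyMeasurable (fun q : (Plane × ℝ) × ℝ =>
      ({q : (Plane × ℝ) × ℝ | q.1.2 < q.2}.indicator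
        (fun q => gaussHess q.1.1 q.2 i j)) q) := by
    refine Measurable.stronglyMeasurable (Measurable.indicator ?_ ?_)
    · exact (measurable_gaussHess i j).comp
        ((measurable_fst.comp measurable_fst).prodMk measurable_snd)
    · exact measurableSet_lt (measurable_snd.comp measurable_fst) measurable_snd
  have h2 := (h.integral_prod_right' (ν := (volume : Measure ℝ))).measurable
  convert h2 using 2 with p
  rw [hessPart_apply, ← integral_indicator measurableSet_Ioi]
  rfl

lemma measurable_stokesKernel (i j : Fin 2) :
    Measurable (fun p : Plane × ℝ => stokesKernel p.1 p.2 i j) := by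
  simp only [stokesKernel_apply]
  exact (measurable_heatKernel.mul_const _).add (measurable_hessPart i j)

/-- The heat equation, with ΔG expressed as the trace of the Hessian so that it can be integrated in
time to give the trace of H. -/
lemma hasDerivAt_heatKernel_time (x : Plane) {t : ℝ} (ht : 0 < t) :
    HasDerivAt (fun s => heatKernel x s) (gaussHess x t 0 0 + gaussHess x t 1 1) t := by
  have h1 : HasDerivAt (fun s : ℝ => (4 * Real.pi * s)⁻¹) (-(4 * Real.pi) / (4 * Real.pi * t) ^ 2)
      t := by
    simpa only [id, mul_one] using
      ((hasDerivAt_id t).const_mul (4 * Real.pi)).fun_inv (by simp [ht.ne', Real.pi_ne_zero])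
  have h2 : HasDerivAt (fun s : ℝ => (4 * s)⁻¹) (-4 / (4 * t) ^ 2) t := by
    simpa only [id, mul_one] using ((hasDerivAt_id t).const_mul 4).fun_inv (by simp [ht.ne'])
  have h3 := h1.mul (h2.const_mul (-‖x‖ ^ 2)).exp
  have hn : ‖x‖ ^ 2 = x 0 ^ 2 + x 1 ^ 2 := by
    rw [EuclideanSpace.real_norm_sq_eq, Fin.sum_univ_two]
  simp only [← div_eq_mul_inv] at h3
  convert! h3 using 1
  simp only [gaussHess, heatKernel, Matrix.one_apply_eq, hn]
  field_simp
  ring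

lemma continuousAt_gaussHess_time (x : Plane) {t : ℝ} (ht : 0 < t) (i j : Fin 2) :
    ContinuousAt (fun s => gaussHess x s i j) t := by
  have h := (hasDerivAt_heatKernel_time x ht).continuousAt
  unfold gaussHess
  refine h.mul (ContinuousAt.sub ?_ ?_)
  · exact continuousAt_const.div (by fun_prop) (by positivity)
  · exact continuousAt_const.div (by fun_prop) (by positivity)

lemma measurable_gaussHess_time (x : Plane) (i j : Fin 2) :
    Measurable (fun s => gaussHess x s i j) :=
  (measurable_gaussHess i j).comp (measurable_const.prodMk measurable_id)

lemma integrableOn_gaussHess (x : Plane) {t : ℝ} (ht : 0 < t) (i j : Fin 2) :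
    IntegrableOn (fun s => gaussHess x s i j) (Ioi t) := by
  obtain ⟨C, hC, h⟩ := exists_gaussHess_le
  refine Integrable.mono' ((integrableOn_add_rpow_Ioi_of_lt (a := -2) (c := t) (m := ‖x‖ ^ 2)
    (by norm_num) (by nlinarith [sq_nonneg ‖x‖])).const_mul C)
    (measurable_gaussHess_time x i j).aestronglyMeasurable ?_
  filter_upwards [ae_restrict_mem measurableSet_Ioi] with s hs
  exact h x s i j (ht.trans hs)

/-- Integrating (s+|x|²)^(-2) over s > t costs one power. Only algebraic decay in space survives. -/
lemma exists_hessPart_le : ∃ C : ℝ, 0 < C ∧ ∀ (x : Plane) (t : ℝ) (i j : Fin 2), 0 < t →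
    |hessPart x t i j| ≤ C * (t + ‖x‖ ^ 2)⁻¹ := by
  obtain ⟨C, hC, h⟩ := exists_gaussHess_le
  refine ⟨C, hC, fun x t i j ht => ?_⟩
  have hp : 0 < t + ‖x‖ ^ 2 := by positivity
  have h1 := norm_integral_le_of_norm_le (μ := volume.restrict (Ioi t))
    (f := fun s => gaussHess x s i j) ((integrableOn_add_rpow_Ioi_of_lt (a := -2) (c := t)
    (m := ‖x‖ ^ 2) (by norm_num) (by linarith)).const_mul C) ?_
  · rw [integral_const_mul, integral_Ioi_add_rpow (by norm_num) hp] at h1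
    refine h1.trans_eq ?_
    norm_num [Real.rpow_neg_one]
  · filter_upwards [ae_restrict_mem measurableSet_Ioi] with s hs
    exact h x s i j (ht.trans hs)

lemma exists_stokesKernel_le : ∃ C : ℝ, 0 < C ∧ ∀ (x : Plane) (t : ℝ) (i j : Fin 2), 0 < t →
    |stokesKernel x t i j| ≤ C * (t + ‖x‖ ^ 2)⁻¹ := by
  obtain ⟨C₁, hC₁, h₁⟩ := exists_heatKernel_le
  obtain ⟨C₂, hC₂, h₂⟩ := exists_hessPart_le
  refine ⟨C₁ + C₂, by positivity, fun x t i j ht => ?_⟩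
  rw [stokesKernel_apply, add_mul]
  refine (abs_add_le _ _).trans (add_le_add ?_ (h₂ x t i j ht))
  rw [abs_mul, abs_of_nonneg (heatKernel_nonneg x ht)]
  exact (mul_le_of_le_one_right (heatKernel_nonneg x ht) (abs_one_apply_le i j)).trans (h₁ x t ht)

/-- The increment is taken under the time integral, and (s+m²)^(-5/2) integrates to (t+m²)^(-3/2).
No spatial derivative of `hessPart` is needed. -/
lemma exists_stokesKernel_sub_le : ∃ C : ℝ, 0 < C ∧
    ∀ (x x' : Plane) (t m : ℝ) (i j : Fin 2), 0 < t → 0 ≤ m →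
    (∀ z ∈ segment ℝ x x', m ≤ ‖z‖) →
    |stokesKernel x' t i j - stokesKernel x t i j| ≤
      C * (t + m ^ 2) ^ (-3 / 2 : ℝ) * ‖x' - x‖ := by
  obtain ⟨C₁, hC₁, h₁⟩ := exists_heatKernel_sub_le
  obtain ⟨C₂, hC₂, h₂⟩ := exists_gaussHess_sub_le
  refine ⟨C₁ + C₂, by positivity, fun x x' t m i j ht hm hseg => ?_⟩
  have hp : 0 < t + m ^ 2 := by positivity
  have e : stokesKernel x' t i j - stokesKernel x t i j =
      (heatKernel x' t - heatKernel x t) * (1 : Matrix (Fin 2) (Fin 2) ℝ) i j +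
        ∫ s in Ioi t, (gaussHess x' s i j - gaussHess x s i j) := by
    rw [integral_sub (integrableOn_gaussHess x' ht i j) (integrableOn_gaussHess x ht i j),
      stokesKernel_apply, stokesKernel_apply, hessPart_apply, hessPart_apply]
    ring
  have h3 := norm_integral_le_of_norm_le (μ := volume.restrict (Ioi t))
    (f := fun s => gaussHess x' s i j - gaussHess x s i j)
    ((((integrableOn_add_rpow_Ioi_of_lt (a := -5 / 2) (c := t)
    (m := m ^ 2) (by norm_num) (by linarith)).const_mul C₂)).mul_const ‖x' - x‖) ?_
  · rw [integral_mul_const, integral_const_mul, integral_Ioi_add_rpow (by norm_num) hp,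
      Real.norm_eq_abs] at h3
    norm_num at h3
    rw [e]
    refine (abs_add_le _ _).trans ?_
    have h4 : |(heatKernel x' t - heatKernel x t) * (1 : Matrix (Fin 2) (Fin 2) ℝ) i j| ≤
        C₁ * (t + m ^ 2) ^ (-3 / 2 : ℝ) * ‖x' - x‖ := by
      rw [abs_mul]
      exact (mul_le_of_le_one_right (abs_nonneg _) (abs_one_apply_le i j)).trans
        (h₁ x x' t m ht hm hseg)
    have h5 : (-(3 / 2) : ℝ) = -3 / 2 := by norm_num
    rw [h5] at h3
    have h6 : 0 ≤ C₂ * ((t + m ^ 2) ^ (-3 / 2 : ℝ)) * ‖x' - x‖ := by positivity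
    linarith
  · filter_upwards [ae_restrict_mem measurableSet_Ioi] with s hs
    exact h₂ x x' s m i j (ht.trans hs) hm hseg

lemma tendsto_heatKernel_atTop (x : Plane) : Tendsto (fun s => heatKernel x s) atTop (𝓝 0) := by
  refine squeeze_zero' (g := fun s : ℝ => s⁻¹) ?_ ?_ tendsto_inv_atTop_zero
  · filter_upwards [eventually_gt_atTop 0] with s hs using heatKernel_nonneg x hs
  · filter_upwards [eventually_gt_atTop 0] with s hs
    refine (heatKernel_le_exp x hs).trans (mul_le_of_le_one_right (by positivity) ?_)
    rw [Real.exp_le_one_iff, neg_div]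
    have : 0 ≤ ‖x‖ ^ 2 / (4 * s) := by positivity
    linarith

/-- The trace is ∫ₜ^∞ ΔG ds = ∫ₜ^∞ ∂ₛG ds, and G vanishes at infinite time. -/
lemma hessPart_trace (x : Plane) {t : ℝ} (ht : 0 < t) :
    hessPart x t 0 0 + hessPart x t 1 1 = -heatKernel x t := by
  rw [hessPart_apply, hessPart_apply, ← integral_add (integrableOn_gaussHess x ht 0 0)
    (integrableOn_gaussHess x ht 1 1), integral_Ioi_of_hasDerivAt_of_tendsto'
    (fun s hs => hasDerivAt_heatKernel_time x (ht.trans_le hs))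
    ((integrableOn_gaussHess x ht 0 0).add (integrableOn_gaussHess x ht 1 1))
    (tendsto_heatKernel_atTop x), zero_sub]

lemma gaussHess_symm (x : Plane) (s : ℝ) (i j : Fin 2) :
    gaussHess x s i j = gaussHess x s j i := by
  rw [gaussHess, gaussHess, mul_comm (x i), Matrix.one_apply, Matrix.one_apply]
  simp only [eq_comm]

lemma hessPart_symm (x : Plane) (t : ℝ) (i j : Fin 2) : hessPart x t i j = hessPart x t j i := by
  simp only [hessPart_apply, gaussHess_symm x _ i j]

lemma stokesKernel_symm (x : Plane) (t : ℝ) (i j : Fin 2) :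
    stokesKernel x t i j = stokesKernel x t j i := by
  rw [stokesKernel_apply, stokesKernel_apply, hessPart_symm, Matrix.one_apply, Matrix.one_apply]
  simp only [eq_comm]

/-- If `g` is integrable on `(c, ∞)` then the derivative of `t ↦ ∫_t^∞ g` is `-g`. -/
lemma hasDerivAt_integral_Ioi {g : ℝ → ℝ} {c t : ℝ} (hct : c < t) (hg : Measurable g)
    (hi : IntegrableOn g (Ioi c)) (hc : ContinuousAt g t) :
    HasDerivAt (fun u => ∫ s in Ioi u, g s) (-g t) t := by
  have h1 : HasDerivAt (fun u => ∫ s in c..u, g s) (g t) t :=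
    intervalIntegral.integral_hasDerivAt_right
      ((intervalIntegrable_iff_integrableOn_Ioc_of_le hct.le).2
        (hi.mono_set Ioc_subset_Ioi_self))
      (hg.stronglyMeasurable.stronglyMeasurableAtFilter) hc
  refine (h1.const_sub (∫ s in Ioi c, g s)).congr_of_eventuallyEq ?_
  filter_upwards [lt_mem_nhds hct] with u hu
  rw [← intervalIntegral.integral_Ioi_sub_Ioi hi hu.le]
  ring

lemma hasDerivAt_hessPart (x : Plane) {t : ℝ} (ht : 0 < t) (i j : Fin 2) :
    HasDerivAt (fun s => hessPart x s i j) (-gaussHess x t i j) t := by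
  simp only [hessPart_apply]
  -- Any base point in (0, t) would serve; it keeps the half-line of integrability away from the
  -- singular time 0.
  exact hasDerivAt_integral_Ioi (c := t / 2) (by linarith) (measurable_gaussHess_time x i j)
    (integrableOn_gaussHess x (by linarith) i j) (continuousAt_gaussHess_time x ht i j)

/-- The time derivative of the entries of the Stokes kernel. -/
def stokesKernelDt (x : Plane) (t : ℝ) (i j : Fin 2) : ℝ :=
  (gaussHess x t 0 0 + gaussHess x t 1 1) * (1 : Matrix (Fin 2) (Fin 2) ℝ) i j - gaussHess x t i j

lemma hasDerivAt_stokesKernel (x : Plane) {t : ℝ} (ht : 0 < t) (i j : Fin 2) :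
    HasDerivAt (fun s => stokesKernel x s i j) (stokesKernelDt x t i j) t :=
  ((hasDerivAt_heatKernel_time x ht).mul_const _).add (hasDerivAt_hessPart x ht i j)

lemma exists_stokesKernelDt_le : ∃ C : ℝ, 0 < C ∧ ∀ (x : Plane) (s : ℝ) (i j : Fin 2), 0 < s →
    |stokesKernelDt x s i j| ≤ C * (s + ‖x‖ ^ 2) ^ (-2 : ℝ) := by
  obtain ⟨C, hC, h⟩ := exists_gaussHess_le
  refine ⟨3 * C, by positivity, fun x s i j hs => ?_⟩
  have h0 := h x s 0 0 hs
  have h1 := h x s 1 1 hs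
  have h2 := h x s i j hs
  have h3 : |(gaussHess x s 0 0 + gaussHess x s 1 1) * (1 : Matrix (Fin 2) (Fin 2) ℝ) i j| ≤
      |gaussHess x s 0 0| + |gaussHess x s 1 1| := by
    rw [abs_mul]
    exact (mul_le_of_le_one_right (abs_nonneg _) (abs_one_apply_le i j)).trans (abs_add_le _ _)
  have h4 := abs_sub ((gaussHess x s 0 0 + gaussHess x s 1 1) *
    (1 : Matrix (Fin 2) (Fin 2) ℝ) i j) (gaussHess x s i j)
  unfold stokesKernelDt
  linarith

lemma measurable_stokesKernelDt (i j : Fin 2) :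
    Measurable (fun p : Plane × ℝ => stokesKernelDt p.1 p.2 i j) := by
  unfold stokesKernelDt
  exact (((measurable_gaussHess 0 0).add (measurable_gaussHess 1 1)).mul_const _).sub
    (measurable_gaussHess i j)

lemma mulV_rot_zero (θ : ℝ) (x : Plane) :
    mulV (rot θ) x 0 = Real.cos θ * x 0 - Real.sin θ * x 1 := by
  simp [mulV, rot, dotProduct, Fin.sum_univ_two]; ring

lemma mulV_rot_one (θ : ℝ) (x : Plane) :
    mulV (rot θ) x 1 = Real.sin θ * x 0 + Real.cos θ * x 1 := by
  simp [mulV, rot, dotProduct, Fin.sum_univ_two]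

lemma rot_zero_zero (θ : ℝ) : rot θ 0 0 = Real.cos θ := rfl

lemma rot_zero_one (θ : ℝ) : rot θ 0 1 = -Real.sin θ := rfl

lemma rot_one_zero (θ : ℝ) : rot θ 1 0 = Real.sin θ := rfl

lemma rot_one_one (θ : ℝ) : rot θ 1 1 = Real.cos θ := rfl

lemma norm_mulV_rot (θ : ℝ) (x : Plane) : ‖mulV (rot θ) x‖ = ‖x‖ := by
  rw [← sq_eq_sq₀ (norm_nonneg _) (norm_nonneg _), EuclideanSpace.real_norm_sq_eq,
    EuclideanSpace.real_norm_sq_eq, Fin.sum_univ_two, Fin.sum_univ_two, mulV_rot_zero,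
    mulV_rot_one]
  linear_combination (x 0 ^ 2 + x 1 ^ 2) * Real.cos_sq_add_sin_sq θ

/-- The rotation by the angle `θ` as an isometry of the plane. -/
def rotIso (θ : ℝ) : Plane ≃ₗᵢ[ℝ] Plane where
  toFun := mulV (rot θ)
  map_add' x y := by ext i; fin_cases i <;> simp [mulV_rot_zero, mulV_rot_one] <;> ring
  map_smul' c x := by ext i; fin_cases i <;> simp [mulV_rot_zero, mulV_rot_one] <;> ring
  invFun := mulV (rot (-θ))
  left_inv x := by
    ext i; fin_cases i <;> simp [mulV_rot_zero, mulV_rot_one]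
    · linear_combination x 0 * Real.cos_sq_add_sin_sq θ
    · linear_combination x 1 * Real.cos_sq_add_sin_sq θ
  right_inv x := by
    ext i; fin_cases i <;> simp [mulV_rot_zero, mulV_rot_one]
    · linear_combination x 0 * Real.cos_sq_add_sin_sq θ
    · linear_combination x 1 * Real.cos_sq_add_sin_sq θ
  norm_map' x := norm_mulV_rot θ x

lemma rotIso_apply (θ : ℝ) (x : Plane) : rotIso θ x = mulV (rot θ) x := rfl

/-- Covariance of the Stokes kernel, `O(θ)ᵀ K(O(θ)x,t) = K(x,t) O(θ)ᵀ`. -/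
lemma rot_transpose_mul_stokesKernel (θ : ℝ) (x : Plane) {t : ℝ} (ht : 0 < t) :
    (rot θ).transpose * stokesKernel (mulV (rot θ) x) t =
      stokesKernel x t * (rot θ).transpose := by
  have hG : ∀ s, heatKernel (mulV (rot θ) x) s = heatKernel x s := fun s => by
    rw [heatKernel, heatKernel, norm_mulV_rot]
  have hcs := Real.cos_sq_add_sin_sq θ
  -- Covariance already holds for the Hessian of G at each time: the heat kernel is radial and x ⊗ x
  -- is conjugated by the rotation. Each entry reduces to cos² + sin² = 1; integration in s then
  -- transfers it to H.
  have hD : ∀ s i j, ((rot θ) 0 i * gaussHess (mulV (rot θ) x) s 0 j +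
      (rot θ) 1 i * gaussHess (mulV (rot θ) x) s 1 j) =
      gaussHess x s i 0 * (rot θ) j 0 + gaussHess x s i 1 * (rot θ) j 1 := by
    intro s
    simp only [Fin.forall_fin_two, gaussHess, hG, rot_zero_zero, rot_zero_one, rot_one_zero,
      rot_one_one, mulV_rot_zero, mulV_rot_one, Matrix.one_apply_eq, Matrix.one_apply_ne,
      ne_eq, zero_ne_one, one_ne_zero, not_false_eq_true]
    refine ⟨⟨?_, ?_⟩, ?_, ?_⟩
    · linear_combination heatKernel x s * x 0 / (4 * s ^ 2) *
        (Real.cos θ * x 0 - Real.sin θ * x 1) * hcs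
    · linear_combination heatKernel x s * x 0 / (4 * s ^ 2) *
        (Real.sin θ * x 0 + Real.cos θ * x 1) * hcs
    · linear_combination heatKernel x s * x 1 / (4 * s ^ 2) *
        (Real.cos θ * x 0 - Real.sin θ * x 1) * hcs
    · linear_combination heatKernel x s * x 1 / (4 * s ^ 2) *
        (Real.sin θ * x 0 + Real.cos θ * x 1) * hcs
  have hH : ∀ i j, ((rot θ) 0 i * hessPart (mulV (rot θ) x) t 0 j +
      (rot θ) 1 i * hessPart (mulV (rot θ) x) t 1 j) =
      hessPart x t i 0 * (rot θ) j 0 + hessPart x t i 1 * (rot θ) j 1 := by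
    intro i j
    simp only [hessPart_apply]
    rw [← integral_const_mul, ← integral_const_mul, ← integral_mul_const, ← integral_mul_const,
      ← integral_add ((integrableOn_gaussHess _ ht _ _).const_mul _)
      ((integrableOn_gaussHess _ ht _ _).const_mul _),
      ← integral_add ((integrableOn_gaussHess _ ht _ _).mul_const _)
      ((integrableOn_gaussHess _ ht _ _).mul_const _)]
    simp only [hD]
  simp only [Fin.forall_fin_two, rot_zero_zero, rot_zero_one, rot_one_zero, rot_one_one] at hH
  obtain ⟨⟨h₁, h₂⟩, h₃, h₄⟩ := hH
  refine Matrix.ext ?_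
  simp only [Fin.forall_fin_two, Matrix.mul_apply, Fin.sum_univ_two, Matrix.transpose_apply,
    stokesKernel_apply, hG, rot_zero_zero, rot_zero_one, rot_one_zero, rot_one_one,
    Matrix.one_apply_eq, Matrix.one_apply_ne, ne_eq, zero_ne_one, one_ne_zero, not_false_eq_true]
  refine ⟨⟨?_, ?_⟩, ?_, ?_⟩
  · linear_combination h₁
  · linear_combination h₂
  · linear_combination h₃
  · linear_combination h₄

/-! ### The truncated pressure kernel and integration by parts against test functions -/

/-- `(1 - e^{-|x|²/4t}) Q(x) = -∫_t^∞ ∇G(x,s) ds`. -/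
def truncPressure (x : Plane) (t : ℝ) : Plane :=
  (1 - Real.exp (-‖x‖ ^ 2 / (4 * t))) • pressureKernel x

lemma heatKernel_div_eq (x : Plane) (i : Fin 2) {s : ℝ} (hx : x ≠ 0) (hs : 0 < s) :
    HasDerivAt (fun s : ℝ => Real.exp (-‖x‖ ^ 2 / (4 * s)) * pressureKernel x i)
      (x i / (2 * s) * heatKernel x s) s := by
  have h2 : HasDerivAt (fun s : ℝ => (4 * s)⁻¹) (-4 / (4 * s) ^ 2) s := by
    simpa only [id, mul_one] using ((hasDerivAt_id s).const_mul 4).fun_inv (by simp [hs.ne'])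
  have h3 := ((h2.const_mul (-‖x‖ ^ 2)).exp).mul_const (pressureKernel x i)
  simp only [← div_eq_mul_inv] at h3
  convert! h3 using 1
  have hx' : ‖x‖ ≠ 0 := norm_ne_zero_iff.2 hx
  simp only [pressureKernel, PiLp.smul_apply, smul_eq_mul, heatKernel]
  field_simp

lemma abs_coord_mul_heatKernel_le (x : Plane) (i : Fin 2) {s : ℝ} (hs : 0 < s) :
    |x i / (2 * s) * heatKernel x s| ≤ ‖x‖ * s ^ (-2 : ℝ) := by
  rw [abs_mul, abs_div, abs_of_nonneg (heatKernel_nonneg x hs),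
    abs_of_pos (by positivity : (0 : ℝ) < 2 * s)]
  have h1 : heatKernel x s ≤ s⁻¹ := by
    refine (heatKernel_le_exp x hs).trans (mul_le_of_le_one_right (by positivity) ?_)
    rw [Real.exp_le_one_iff, neg_div]
    have : 0 ≤ ‖x‖ ^ 2 / (4 * s) := by positivity
    linarith
  have h2 := abs_coord_le x i
  have hG := heatKernel_nonneg x hs
  rw [show (-2 : ℝ) = -((2 : ℕ) : ℝ) by norm_num, ← rpow_neg_nat hs]
  calc |x i| / (2 * s) * heatKernel x s ≤ ‖x‖ / s * s⁻¹ := by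
        gcongr
        linarith
    _ = ‖x‖ * (s ^ 2)⁻¹ := by field_simp

lemma measurable_coord_mul_heatKernel (x : Plane) (i : Fin 2) :
    Measurable (fun s : ℝ => x i / (2 * s) * heatKernel x s) := by
  have : Measurable (fun s : ℝ => heatKernel x s) :=
    measurable_heatKernel.comp (measurable_const.prodMk measurable_id)
  fun_prop

lemma integrableOn_coord_mul_heatKernel (x : Plane) (i : Fin 2) {t : ℝ} (ht : 0 < t) :
    IntegrableOn (fun s : ℝ => x i / (2 * s) * heatKernel x s) (Ioi t) := by
  refine Integrable.mono' ((integrableOn_Ioi_rpow_of_lt (a := -2) (c := t)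
    (by norm_num) ht).const_mul ‖x‖) (measurable_coord_mul_heatKernel x i).aestronglyMeasurable ?_
  filter_upwards [ae_restrict_mem measurableSet_Ioi] with s hs
  exact abs_coord_mul_heatKernel_le x i (ht.trans hs)

/-- The closed form contains the singular factor Q, while the integral form can be differentiated at
every point, including the origin. -/
lemma truncPressure_eq_integral (x : Plane) {t : ℝ} (ht : 0 < t) (i : Fin 2) :
    truncPressure x t i = ∫ s in Ioi t, x i / (2 * s) * heatKernel x s := by
  -- At the origin both sides vanish, Q(0) being 0 by the convention 0⁻¹ = 0.
  rcases eq_or_ne x 0 with rfl | hx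
  · simp [truncPressure, pressureKernel]
  · have hlim : Tendsto (fun s : ℝ => Real.exp (-‖x‖ ^ 2 / (4 * s)) * pressureKernel x i) atTop
        (𝓝 (Real.exp 0 * pressureKernel x i)) := by
      refine ((Real.continuous_exp.tendsto 0).comp ?_).mul_const _
      exact tendsto_const_nhds.div_atTop (tendsto_id.const_mul_atTop (by norm_num))
    rw [integral_Ioi_of_hasDerivAt_of_tendsto'
      (fun s hs => heatKernel_div_eq x i hx (ht.trans_le hs))
      (integrableOn_coord_mul_heatKernel x i ht) hlim]
    simp [truncPressure]
    ring

lemma hasFDerivAt_coord_mul_heatKernel (x : Plane) {s : ℝ} (hs : 0 < s) (i : Fin 2) :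
    HasFDerivAt (fun z : Plane => z i / (2 * s) * heatKernel z s)
      (-∑ j, gaussHess x s i j • (EuclideanSpace.proj j : Plane →L[ℝ] ℝ)) x := by
  have h1 := ((hasFDerivAt_coord x i).mul_const (2 * s)⁻¹).mul (hasFDerivAt_heatKernel x hs)
  simp only [← div_eq_mul_inv] at h1
  refine h1.congr_fderiv (ContinuousLinearMap.ext fun v => ?_)
  clear h1
  revert i
  simp only [Fin.forall_fin_two]
  constructor <;>
  · simp [Fin.sum_univ_two, gaussHess, PiLp.inner_apply]
    field_simp
    ring

/-- Differentiation under the integral: the Hessian is bounded by C s⁻² uniformly in space, and this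
is integrable on (t, ∞). -/
lemma hasFDerivAt_truncPressure (x : Plane) {t : ℝ} (ht : 0 < t) (i : Fin 2) :
    HasFDerivAt (fun z : Plane => truncPressure z t i)
      (∫ s in Ioi t, -∑ j, gaussHess x s i j • (EuclideanSpace.proj j : Plane →L[ℝ] ℝ)) x := by
  obtain ⟨C, hC, h⟩ := exists_gaussHess_le
  simp only [truncPressure_eq_integral _ ht]
  refine hasFDerivAt_integral_of_dominated_of_fderiv_le
    (bound := fun s => 2 * C * s ^ (-2 : ℝ)) (s := univ)
    (F' := fun x s => -∑ j, gaussHess x s i j • (EuclideanSpace.proj j : Plane →L[ℝ] ℝ))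
    univ_mem (Eventually.of_forall fun z =>
    (measurable_coord_mul_heatKernel z i).aestronglyMeasurable)
    (integrableOn_coord_mul_heatKernel x i ht) ?_ ?_
    ((integrableOn_Ioi_rpow_of_lt (by norm_num) ht).const_mul _) ?_
  · simp only [Fin.sum_univ_two]
    exact (((measurable_gaussHess_time x i 0).aestronglyMeasurable.smul_const _).add
      ((measurable_gaussHess_time x i 1).aestronglyMeasurable.smul_const _)).neg
  · filter_upwards [ae_restrict_mem measurableSet_Ioi] with s hs z _
    have hs0 : 0 < s := ht.trans hs
    have hb : ∀ j, ‖gaussHess z s i j • (EuclideanSpace.proj j : Plane →L[ℝ] ℝ)‖ ≤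
        C * s ^ (-2 : ℝ) := fun j => by
      refine ContinuousLinearMap.opNorm_le_bound _ (by positivity) fun v => ?_
      rw [smul_apply, norm_smul]
      refine mul_le_mul ((h z s i j hs0).trans ?_) (abs_coord_le v j) (norm_nonneg _)
        (by positivity)
      gcongr ?_ * ?_
      exact Real.rpow_le_rpow_of_nonpos hs0 (by nlinarith [sq_nonneg ‖z‖]) (by norm_num)
    rw [norm_neg, Fin.sum_univ_two]
    refine (norm_add_le _ _).trans ?_
    have := hb 0
    have := hb 1
    linarith
  · filter_upwards [ae_restrict_mem measurableSet_Ioi] with s hs z _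
    exact hasFDerivAt_coord_mul_heatKernel z (ht.trans hs) i

/-- The partial derivative of a scalar function of the plane. -/
def partialD (k : Fin 2) (χ : Plane → ℝ) (x : Plane) : ℝ :=
  fderiv ℝ χ x (EuclideanSpace.single k 1)

lemma integrableOn_smul_proj (x : Plane) {t : ℝ} (ht : 0 < t) (i : Fin 2) :
    IntegrableOn (fun s => -∑ j, gaussHess x s i j • (EuclideanSpace.proj j : Plane →L[ℝ] ℝ))
      (Ioi t) := by
  simp only [Fin.sum_univ_two]
  exact (((integrableOn_gaussHess x ht i 0).smul_const _).add
    ((integrableOn_gaussHess x ht i 1).smul_const _)).neg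

/-- This exhibits H as minus the gradient of a vector potential, which is what lets derivatives be
exchanged between indices on the test function. -/
lemma partialD_truncPressure (x : Plane) {t : ℝ} (ht : 0 < t) (i j : Fin 2) :
    partialD j (fun z => truncPressure z t i) x = -hessPart x t i j := by
  rw [partialD, (hasFDerivAt_truncPressure x ht i).fderiv,
    ContinuousLinearMap.integral_apply (integrableOn_smul_proj x ht i), hessPart_apply,
    ← integral_neg]
  congr 1
  ext s
  fin_cases j <;> simp [Fin.sum_univ_two]

lemma differentiable_truncPressure {t : ℝ} (ht : 0 < t) (i : Fin 2) :
    Differentiable ℝ (fun z : Plane => truncPressure z t i) := fun x =>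
  (hasFDerivAt_truncPressure x ht i).differentiableAt

lemma partialD_heatKernel {t : ℝ} (ht : 0 < t) (i : Fin 2) :
    partialD i (fun z => heatKernel z t) = fun x => -(x i / (2 * t) * heatKernel x t) := by
  ext x
  rw [partialD, fderiv_heatKernel x ht, neg_mul]

lemma partialD_partialD_heatKernel {t : ℝ} (ht : 0 < t) (i j : Fin 2) (x : Plane) :
    partialD j (partialD i (fun z => heatKernel z t)) x = gaussHess x t i j := by
  rw [partialD_heatKernel ht, partialD, (hasFDerivAt_coord_mul_heatKernel x ht i).fun_neg.fderiv]
  fin_cases j <;> simp [Fin.sum_univ_two]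

lemma differentiable_heatKernel {t : ℝ} (ht : 0 < t) :
    Differentiable ℝ (fun z : Plane => heatKernel z t) := fun x =>
  (hasFDerivAt_heatKernel x ht).differentiableAt

lemma differentiable_partialD_heatKernel {t : ℝ} (ht : 0 < t) (i : Fin 2) :
    Differentiable ℝ (partialD i (fun z : Plane => heatKernel z t)) := fun x => by
  rw [partialD_heatKernel ht]
  exact (hasFDerivAt_coord_mul_heatKernel x ht i).neg.differentiableAt

lemma contDiff_partialD {χ : Plane → ℝ} (hχ : ContDiff ℝ ∞ χ) (k : Fin 2) :
    ContDiff ℝ ∞ (partialD k χ) :=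
  (hχ.fderiv_right (m := ∞) (by simp)).clm_apply contDiff_const

lemma hasCompactSupport_partialD {χ : Plane → ℝ} (hχ : HasCompactSupport χ) (k : Fin 2) :
    HasCompactSupport (partialD k χ) := hχ.fderiv_apply ℝ _

lemma partialD_comm {χ : Plane → ℝ} (hχ : ContDiff ℝ ∞ χ) (k l : Fin 2) :
    partialD k (partialD l χ) = partialD l (partialD k χ) := by
  ext x
  have hd : DifferentiableAt ℝ (fderiv ℝ χ) x :=
    ((hχ.fderiv_right (m := ∞) (by simp)).differentiable (by simp)).differentiableAt
  have hs : IsSymmSndFDerivAt ℝ χ x := hχ.contDiffAt.isSymmSndFDerivAt (by simp; exact WithTop.coe_le_coe.2 le_top)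
  unfold partialD
  rw [fderiv_clm_apply hd (differentiableAt_const _), fderiv_clm_apply hd (differentiableAt_const _)]
  simpa using hs.eq _ _

lemma integrable_bdd_mul {W χ : Plane → ℝ} {M : ℝ} (hW : Measurable W) (hb : ∀ x, |W x| ≤ M)
    (hχ : Continuous χ) (hc : HasCompactSupport χ) : Integrable (fun x => W x * χ x) :=
  (hχ.integrable_of_hasCompactSupport hc).bdd_mul hW.aestronglyMeasurable
    (Eventually.of_forall hb)

lemma integral_mul_partialD {W χ : Plane → ℝ} {M : ℝ} {k : Fin 2} (hW : Differentiable ℝ W)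
    (hb : ∀ x, |partialD k W x| ≤ M) (hχ : ContDiff ℝ ∞ χ) (hc : HasCompactSupport χ) :
    ∫ x, W x * partialD k χ x = -∫ x, partialD k W x * χ x := by
  refine integral_mul_fderiv_eq_neg_fderiv_mul_of_integrable
    (integrable_bdd_mul (measurable_fderiv_apply_const ℝ W _) hb hχ.continuous hc) ?_ ?_
    (fun x _ => hW x) (fun x _ => (hχ.differentiable (by simp)) x)
  · exact (hW.continuous.mul (contDiff_partialD hχ k).continuous).integrable_of_hasCompactSupport
      ((hasCompactSupport_partialD hc k).mul_left)
  · exact (hW.continuous.mul hχ.continuous).integrable_of_hasCompactSupport hc.mul_left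

/-- At a fixed positive time all kernels are bounded in space, so their products with test functions
are integrable. One constant for all of them keeps later uses short. -/
lemma exists_kernel_bounds {t : ℝ} (ht : 0 < t) : ∃ M : ℝ, 0 ≤ M ∧ ∀ (x : Plane) (i j : Fin 2),
    |heatKernel x t| ≤ M ∧ |gaussHess x t i j| ≤ M ∧ |hessPart x t i j| ≤ M ∧
    |stokesKernel x t i j| ≤ M ∧ |stokesKernelDt x t i j| ≤ M ∧
    |partialD i (fun z => heatKernel z t) x| ≤ M := by
  obtain ⟨C₁, hC₁, h₁⟩ := exists_heatKernel_le
  obtain ⟨C₂, hC₂, h₂⟩ := exists_gaussHess_le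
  obtain ⟨C₃, hC₃, h₃⟩ := exists_hessPart_le
  obtain ⟨C₄, hC₄, h₄⟩ := exists_stokesKernel_le
  obtain ⟨C₅, hC₅, h₅⟩ := exists_stokesKernelDt_le
  obtain ⟨C₆, hC₆, h₆⟩ := exists_norm_fderiv_heatKernel_le
  have hr : ∀ (b : ℝ) (x : Plane), b ≤ 0 → (t + ‖x‖ ^ 2) ^ b ≤ t ^ b := fun b x hb =>
    Real.rpow_le_rpow_of_nonpos ht (by nlinarith [sq_nonneg ‖x‖]) hb
  have hr' : ∀ x : Plane, (t + ‖x‖ ^ 2)⁻¹ ≤ t⁻¹ := fun x => by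
    gcongr; nlinarith [sq_nonneg ‖x‖]
  have p1 : 0 ≤ C₁ * t⁻¹ := by positivity
  have p2 : 0 ≤ C₂ * t ^ (-2 : ℝ) := by positivity
  have p3 : 0 ≤ C₃ * t⁻¹ := by positivity
  have p4 : 0 ≤ C₄ * t⁻¹ := by positivity
  have p5 : 0 ≤ C₅ * t ^ (-2 : ℝ) := by positivity
  have p6 : 0 ≤ C₆ * t ^ (-3 / 2 : ℝ) := by positivity
  refine ⟨C₁ * t⁻¹ + C₂ * t ^ (-2 : ℝ) + C₃ * t⁻¹ + C₄ * t⁻¹ + C₅ * t ^ (-2 : ℝ) +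
    C₆ * t ^ (-3 / 2 : ℝ), by positivity, fun x i j => ?_⟩
  have q1 : |heatKernel x t| ≤ C₁ * t⁻¹ := by
    rw [abs_of_nonneg (heatKernel_nonneg x ht)]
    exact (h₁ x t ht).trans (mul_le_mul_of_nonneg_left (hr' x) hC₁.le)
  have q2 := (h₂ x t i j ht).trans (mul_le_mul_of_nonneg_left (hr (-2) x (by norm_num)) hC₂.le)
  have q3 := (h₃ x t i j ht).trans (mul_le_mul_of_nonneg_left (hr' x) hC₃.le)
  have q4 := (h₄ x t i j ht).trans (mul_le_mul_of_nonneg_left (hr' x) hC₄.le)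
  have q5 := (h₅ x t i j ht).trans (mul_le_mul_of_nonneg_left (hr (-2) x (by norm_num)) hC₅.le)
  have q6 : |partialD i (fun z => heatKernel z t) x| ≤ C₆ * t ^ (-3 / 2 : ℝ) := by
    rw [partialD, (hasFDerivAt_heatKernel x ht).fderiv, ← Real.norm_eq_abs]
    refine (ContinuousLinearMap.le_opNorm _ _).trans ?_
    rw [PiLp.norm_single, norm_one, mul_one]
    exact (h₆ x t ht).trans
      (mul_le_mul_of_nonneg_left (hr (-3 / 2) x (by norm_num)) hC₆.le)
  refine ⟨?_, ?_, ?_, ?_, ?_, ?_⟩ <;> linarith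

lemma integral_truncPressure_mul_partialD {χ : Plane → ℝ} {t : ℝ} (ht : 0 < t)
    (hχ : ContDiff ℝ ∞ χ) (hc : HasCompactSupport χ) (i j : Fin 2) :
    ∫ x, truncPressure x t i * partialD j χ x = ∫ x, hessPart x t i j * χ x := by
  obtain ⟨M, -, hM⟩ := exists_kernel_bounds ht
  rw [integral_mul_partialD (M := M) (differentiable_truncPressure ht i) (fun x => ?_) hχ hc,
    ← integral_neg]
  · simp [partialD_truncPressure _ ht]
  · rw [partialD_truncPressure x ht, abs_neg]
    exact (hM x i j).2.2.1

lemma integral_heatKernel_mul_partialD_partialD {χ : Plane → ℝ} {t : ℝ} (ht : 0 < t)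
    (hχ : ContDiff ℝ ∞ χ) (hc : HasCompactSupport χ) (i j : Fin 2) :
    ∫ x, heatKernel x t * partialD i (partialD j χ) x = ∫ x, gaussHess x t i j * χ x := by
  obtain ⟨M, -, hM⟩ := exists_kernel_bounds ht
  rw [integral_mul_partialD (M := M) (differentiable_heatKernel ht)
    (fun x => (hM x i j).2.2.2.2.2) (contDiff_partialD hχ j) (hasCompactSupport_partialD hc j),
    integral_mul_partialD (M := M) (differentiable_partialD_heatKernel ht i) (fun x => ?_) hχ hc,
    neg_neg]
  · simp only [partialD_partialD_heatKernel ht]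
  · rw [partialD_partialD_heatKernel ht]
    exact (hM x i j).2.1

lemma integrable_hessPart_mul {χ : Plane → ℝ} {t : ℝ} (ht : 0 < t)
    (hχ : Continuous χ) (hc : HasCompactSupport χ) (i j : Fin 2) :
    Integrable (fun x => hessPart x t i j * χ x) := by
  obtain ⟨M, -, hM⟩ := exists_kernel_bounds ht
  exact integrable_bdd_mul ((measurable_hessPart i j).comp (measurable_id.prodMk measurable_const))
    (fun x => (hM x i j).2.2.1) hχ hc

lemma integrable_heatKernel_mul {χ : Plane → ℝ} {t : ℝ} (ht : 0 < t)
    (hχ : Continuous χ) (hc : HasCompactSupport χ) :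
    Integrable (fun x => heatKernel x t * χ x) := by
  obtain ⟨M, -, hM⟩ := exists_kernel_bounds ht
  exact integrable_bdd_mul (measurable_heatKernel.comp (measurable_id.prodMk measurable_const))
    (fun x => (hM x 0 0).1) hχ hc

lemma integrable_gaussHess_mul {χ : Plane → ℝ} {t : ℝ} (ht : 0 < t)
    (hχ : Continuous χ) (hc : HasCompactSupport χ) (i j : Fin 2) :
    Integrable (fun x => gaussHess x t i j * χ x) := by
  obtain ⟨M, -, hM⟩ := exists_kernel_bounds ht
  exact integrable_bdd_mul ((measurable_gaussHess i j).comp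
    (measurable_id.prodMk measurable_const)) (fun x => (hM x i j).2.1) hχ hc

lemma integrable_stokesKernel_mul {χ : Plane → ℝ} {t : ℝ} (ht : 0 < t)
    (hχ : Continuous χ) (hc : HasCompactSupport χ) (i j : Fin 2) :
    Integrable (fun x => stokesKernel x t i j * χ x) := by
  obtain ⟨M, -, hM⟩ := exists_kernel_bounds ht
  exact integrable_bdd_mul ((measurable_stokesKernel i j).comp
    (measurable_id.prodMk measurable_const)) (fun x => (hM x i j).2.2.2.1) hχ hc

lemma integral_stokesKernel_mul {χ : Plane → ℝ} {t : ℝ} (ht : 0 < t)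
    (hχ : Continuous χ) (hc : HasCompactSupport χ) (i j : Fin 2) :
    ∫ x, stokesKernel x t i j * χ x =
      (1 : Matrix (Fin 2) (Fin 2) ℝ) i j * (∫ x, heatKernel x t * χ x) +
        ∫ x, hessPart x t i j * χ x := by
  rw [← integral_const_mul, ← integral_add ((integrable_heatKernel_mul ht hχ hc).const_mul _)
    (integrable_hessPart_mul ht hχ hc i j)]
  congr 1
  ext x
  rw [stokesKernel_apply]
  ring

/-- With T the truncated pressure, ∫ H_jl ∂_lχ = ∫ T_l ∂_j∂_lχ = ∫ T_l ∂_l∂_jχ = ∫ H_ll ∂_jχ.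
Summing over l leaves the trace of H, which is -G. -/
lemma sum_integral_hessPart_mul_partialD {χ : Plane → ℝ} {t : ℝ} (ht : 0 < t)
    (hχ : ContDiff ℝ ∞ χ) (hc : HasCompactSupport χ) (j : Fin 2) :
    ∑ l, ∫ x, hessPart x t j l * partialD l χ x = -∫ x, heatKernel x t * partialD j χ x := by
  have h : ∀ l, ∫ x, hessPart x t j l * partialD l χ x =
      ∫ x, hessPart x t l l * partialD j χ x := fun l => by
    simp only [hessPart_symm _ t j l]
    rw [← integral_truncPressure_mul_partialD ht (contDiff_partialD hχ l)
      (hasCompactSupport_partialD hc l), partialD_comm hχ,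
      integral_truncPressure_mul_partialD ht (contDiff_partialD hχ j)
      (hasCompactSupport_partialD hc j)]
  have hi := fun l => integrable_hessPart_mul ht (contDiff_partialD hχ j).continuous
    (hasCompactSupport_partialD hc j) l l
  rw [Fin.sum_univ_two, h, h, ← integral_add (hi 0) (hi 1), ← integral_neg]
  congr 1
  ext x
  rw [← add_mul, hessPart_trace x ht, neg_mul]

/-- The columns of the Stokes kernel are divergence free. -/
lemma sum_integral_stokesKernel_mul_partialD {χ : Plane → ℝ} {t : ℝ} (ht : 0 < t)
    (hχ : ContDiff ℝ ∞ χ) (hc : HasCompactSupport χ) (j : Fin 2) :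
    ∑ l, ∫ x, stokesKernel x t j l * partialD l χ x = 0 := by
  have h := sum_integral_hessPart_mul_partialD ht hχ hc j
  simp only [integral_stokesKernel_mul ht (contDiff_partialD hχ _).continuous
    (hasCompactSupport_partialD hc _), Finset.sum_add_distrib, h, Matrix.one_apply]
  simp

/-- The Stokes kernel solves the heat equation, tested against a smooth function. -/
lemma sum_integral_stokesKernel_mul_partialD_partialD {χ : Plane → ℝ} {t : ℝ} (ht : 0 < t)
    (hχ : ContDiff ℝ ∞ χ) (hc : HasCompactSupport χ) (j k : Fin 2) :
    ∑ l, ∫ x, stokesKernel x t j k * partialD l (partialD l χ) x =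
      ∫ x, stokesKernelDt x t j k * χ x := by
  have h2 : ∀ l, ContDiff ℝ ∞ (partialD l (partialD l χ)) := fun l =>
    contDiff_partialD (contDiff_partialD hχ l) l
  have c2 : ∀ l, HasCompactSupport (partialD l (partialD l χ)) := fun l =>
    hasCompactSupport_partialD (hasCompactSupport_partialD hc l) l
  -- The same exchange through the potential: ∫ H_jk ∂_l∂_lχ = ∫ H_jl ∂_l∂_kχ. The sum over l is
  -- then -∫ G ∂_j∂_kχ, and two integrations by parts return both derivatives to G.
  have hH : ∑ l, ∫ x, hessPart x t j k * partialD l (partialD l χ) x =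
      -∫ x, gaussHess x t j k * χ x := by
    rw [← integral_heatKernel_mul_partialD_partialD ht hχ hc,
      ← sum_integral_hessPart_mul_partialD ht (contDiff_partialD hχ k)
        (hasCompactSupport_partialD hc k)]
    refine Finset.sum_congr rfl fun l _ => ?_
    rw [← integral_truncPressure_mul_partialD ht (h2 l) (c2 l),
      partialD_comm (contDiff_partialD hχ l), partialD_comm hχ k l,
      integral_truncPressure_mul_partialD ht
        (contDiff_partialD (contDiff_partialD hχ k) l)
        (hasCompactSupport_partialD (hasCompactSupport_partialD hc k) l)]
  simp only [integral_stokesKernel_mul ht (h2 _).continuous (c2 _), Finset.sum_add_distrib, hH,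
    integral_heatKernel_mul_partialD_partialD ht hχ hc]
  have hi := fun a b => integrable_gaussHess_mul ht hχ.continuous hc a b
  have e : (fun x => stokesKernelDt x t j k * χ x) = fun x =>
      (1 : Matrix (Fin 2) (Fin 2) ℝ) j k * (gaussHess x t 0 0 * χ x) +
      (1 : Matrix (Fin 2) (Fin 2) ℝ) j k * (gaussHess x t 1 1 * χ x) - gaussHess x t j k * χ x := by
    ext x
    rw [stokesKernelDt]
    ring
  have hadd : Integrable (fun x =>
      (1 : Matrix (Fin 2) (Fin 2) ℝ) j k * (gaussHess x t 0 0 * χ x) +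
      (1 : Matrix (Fin 2) (Fin 2) ℝ) j k * (gaussHess x t 1 1 * χ x)) :=
    ((hi 0 0).const_mul _).add ((hi 1 1).const_mul _)
  rw [e, integral_sub hadd (hi j k),
    integral_add ((hi 0 0).const_mul _) ((hi 1 1).const_mul _), integral_const_mul,
    integral_const_mul, ← Finset.mul_sum, Fin.sum_univ_two]
  ring

/-- H is singular as t → 0, whereas both terms on the right have limits: an approximate identity,
and a kernel dominated by 1/|x|. -/
lemma sum_integral_stokesKernel_mul {Φ : Fin 2 → Plane → ℝ} {t : ℝ} (ht : 0 < t)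
    (hΦ : ∀ k, ContDiff ℝ ∞ (Φ k)) (hc : ∀ k, HasCompactSupport (Φ k)) (j : Fin 2) :
    ∑ k, ∫ x, stokesKernel x t j k * Φ k x = (∫ x, heatKernel x t * Φ j x) +
      ∑ k, ∫ x, truncPressure x t j * partialD k (Φ k) x := by
  simp only [integral_stokesKernel_mul ht (hΦ _).continuous (hc _), Finset.sum_add_distrib,
    integral_truncPressure_mul_partialD ht (hΦ _) (hc _), Matrix.one_apply]
  simp

/-! ### Absolute convergence of the integrals -/

lemma integrableOn_ball_inv_norm (r : ℝ) :
    IntegrableOn (fun x : Plane => ‖x‖⁻¹) (Metric.ball 0 r) := by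
  rw [integrableOn_fun_norm_addHaar volume (f := fun y => y⁻¹)]
  refine (integrableOn_const (C := (1 : ℝ)) (by simp)).congr_fun (fun y hy => ?_)
    measurableSet_Ioo
  simp [hy.1.ne']

/-- In polar coordinates the Jacobian cancels 1/|x|, so the integral is the length 2|B₁| of the unit
circle times r. -/
lemma lintegral_ball_inv_norm {r : ℝ} (hr : 0 ≤ r) :
    ∫⁻ x in Metric.ball (0 : Plane) r, ENNReal.ofReal ‖x‖⁻¹ =
      ENNReal.ofReal (2 * volume.real (Metric.ball (0 : Plane) 1) * r) := by
  rw [← ofReal_integral_eq_lintegral_ofReal (integrableOn_ball_inv_norm r)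
    (Eventually.of_forall fun x => by positivity), ← integral_indicator measurableSet_ball]
  have h1 : (fun x : Plane => (Metric.ball (0 : Plane) r).indicator (fun x => ‖x‖⁻¹) x) =
      fun x => (Iio r).indicator (fun y : ℝ => y⁻¹) ‖x‖ := by
    ext x; simp [indicator]
  rw [h1, integral_fun_norm_addHaar volume (fun y => (Iio r).indicator (fun y : ℝ => y⁻¹) y)]
  have h2 : ∫ y in Ioi (0 : ℝ), y ^ (Module.finrank ℝ Plane - 1) •
      (Iio r).indicator (fun y : ℝ => y⁻¹) y = r := by
    rw [setIntegral_congr_fun (g := (Iio r).indicator 1) measurableSet_Ioi,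
      setIntegral_indicator measurableSet_Iio, Ioi_inter_Iio]
    · simp [hr]
    · intro y (hy : 0 < y)
      by_cases hyr : y < r <;> simp [hyr, hy.ne']
  rw [h2]
  simp
  ring_nf

lemma ae_ne (z : Plane) : ∀ᵐ y : Plane, y ≠ z := by
  have h : volume ({z} : Set Plane) = 0 := measure_singleton z
  exact compl_mem_ae_iff.2 h

lemma lintegral_ball_inv_enorm {r : ℝ} (hr : 0 ≤ r) :
    ∫⁻ x in Metric.ball (0 : Plane) r, ‖x‖ₑ⁻¹ =
      ENNReal.ofReal (2 * volume.real (Metric.ball (0 : Plane) 1) * r) := by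
  rw [← lintegral_ball_inv_norm hr]
  -- The integrands differ only at the origin, where the extended inverse is ⊤ and the real one is
  -- 0.
  refine lintegral_congr_ae (ae_restrict_of_ae ?_)
  filter_upwards [ae_ne 0] with x hx
  rw [ENNReal.ofReal_inv_of_pos (norm_pos_iff.2 hx), ofReal_norm]

lemma lintegral_inv_enorm_sub_ball {r : ℝ} (hr : 0 ≤ r) (z : Plane) :
    ∫⁻ y in {y : Plane | ‖z - y‖ < r}, ‖z - y‖ₑ⁻¹ =
      ENNReal.ofReal (2 * volume.real (Metric.ball (0 : Plane) 1) * r) := by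
  have hm : MeasurableSet {y : Plane | ‖z - y‖ < r} :=
    measurableSet_lt (by fun_prop) measurable_const
  rw [← lintegral_ball_inv_enorm hr, ← lintegral_indicator measurableSet_ball,
    ← lintegral_sub_left_eq_self (μ := volume) _ z, ← lintegral_indicator hm]
  refine lintegral_congr fun y => ?_
  simp [indicator]

/-- Convolution of `1/|x|` with a function in `L¹ ∩ L^∞` is bounded. -/
lemma exists_lintegral_inv_enorm_mul_le {F : Type*} [NormedAddCommGroup F] {f : Plane → F}
    (h1 : MemLp f 1 volume) (htop : MemLp f ∞ volume) :
    ∃ N : ℝ≥0∞, N ≠ ⊤ ∧ ∀ z, ∫⁻ y, ‖z - y‖ₑ⁻¹ * ‖f y‖ₑ ≤ N := by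
  -- Within distance 1 of z the supremum of f is used against the integral of 1/|·|; farther away
  -- the kernel is at most 1 and the L¹ norm suffices.
  refine ⟨ENNReal.ofReal (2 * volume.real (Metric.ball (0 : Plane) 1) * 1) *
    eLpNormEssSup f volume + ∫⁻ y, ‖f y‖ₑ, ?_, fun z => ?_⟩
  · refine ENNReal.add_ne_top.2 ⟨ENNReal.mul_ne_top ENNReal.ofReal_ne_top ?_, ?_⟩
    · rw [← eLpNorm_exponent_top]; exact htop.2.ne
    · rw [← eLpNorm_one_eq_lintegral_enorm]; exact h1.2.ne
  · have hm : MeasurableSet {y : Plane | ‖z - y‖ < 1} :=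
      measurableSet_lt (by fun_prop) measurable_const
    rw [← lintegral_add_compl _ hm]
    refine add_le_add ?_ ?_
    · rw [← lintegral_inv_enorm_sub_ball zero_le_one z, ← lintegral_mul_const _ (by fun_prop)]
      refine lintegral_mono_ae (ae_restrict_of_ae ?_)
      filter_upwards [ae_le_eLpNormEssSup (f := f) (μ := volume)] with y hy
      gcongr
    · refine (setLIntegral_mono_ae' hm.compl (g := fun y => ‖f y‖ₑ) ?_).trans
        (setLIntegral_le_lintegral _ _)
      refine Eventually.of_forall fun y hy => ?_
      simp only [mem_compl_iff, mem_ofPred_eq, not_lt] at hy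
      refine mul_le_of_le_one_left zero_le ?_
      rw [ENNReal.inv_le_one, ← ofReal_norm]
      exact ENNReal.one_le_ofReal.2 hy

lemma perp_eq_mulV_rot (x : Plane) : perp x = mulV (rot (Real.pi / 2)) x := by
  ext i; fin_cases i
  · rw [show ((fun i => i) ⟨0, by simp⟩ : Fin 2) = 0 from rfl, mulV_rot_zero]; simp [perp]
  · rw [show ((fun i => i) ⟨1, by simp⟩ : Fin 2) = 1 from rfl, mulV_rot_one]; simp [perp]

lemma mulV_rot_eq (θ : ℝ) (x : Plane) :
    mulV (rot θ) x = Real.cos θ • x + Real.sin θ • rotIso (Real.pi / 2) x := by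
  rw [rotIso_apply, ← perp_eq_mulV_rot]
  ext i; fin_cases i
  · rw [show ((fun i => i) ⟨0, by simp⟩ : Fin 2) = 0 from rfl, mulV_rot_zero]; simp [perp]; ring
  · rw [show ((fun i => i) ⟨1, by simp⟩ : Fin 2) = 1 from rfl, mulV_rot_one]; simp [perp]; ring

lemma continuous_mulV_rot : Continuous (fun p : Plane × ℝ => mulV (rot p.2) p.1) := by
  simp only [mulV_rot_eq]
  have := (rotIso (Real.pi / 2)).continuous
  fun_prop

lemma continuous_rot_apply (i j : Fin 2) : Continuous (fun θ : ℝ => rot θ i j) := by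
  revert i j
  simp only [Fin.forall_fin_two, rot_zero_zero, rot_zero_one, rot_one_zero, rot_one_one]
  refine ⟨⟨?_, ?_⟩, ?_, ?_⟩ <;> fun_prop

lemma abs_rot_apply_le (θ : ℝ) (i j : Fin 2) : |rot θ i j| ≤ 1 := by
  revert i j
  simp only [Fin.forall_fin_two, rot_zero_zero, rot_zero_one, rot_one_zero, rot_one_one, abs_neg]
  exact ⟨⟨Real.abs_cos_le_one θ, Real.abs_sin_le_one θ⟩, Real.abs_sin_le_one θ,
    Real.abs_cos_le_one θ⟩

lemma resolventIntegrand_apply (ε a : ℝ) (x y : Plane) (t : ℝ) (i j : Fin 2) :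
    resolventIntegrand ε a x y t i j = Real.exp (-ε * t) *
      ∑ k, rot (a * t) k i * stokesKernel (mulV (rot (a * t)) x - y) t k j := by
  simp [resolventIntegrand, Matrix.mul_apply]

lemma measurable_resolventIntegrand (ε a : ℝ) (i j : Fin 2) :
    Measurable (fun p : (Plane × Plane) × ℝ => resolventIntegrand ε a p.1.1 p.1.2 p.2 i j) := by
  simp only [resolventIntegrand_apply, Fin.sum_univ_two]
  have h1 : Measurable (fun p : (Plane × Plane) × ℝ => (mulV (rot (a * p.2)) p.1.1 - p.1.2, p.2)) :=
    ((continuous_mulV_rot.comp (by fun_prop :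
      Continuous fun p : (Plane × Plane) × ℝ => (p.1.1, a * p.2))).sub
      (by fun_prop)).measurable.prodMk measurable_snd
  have h2 := fun k => (measurable_stokesKernel k j).comp h1
  have h3 : ∀ k, Measurable (fun p : (Plane × Plane) × ℝ => rot (a * p.2) k i) := fun k =>
    ((continuous_rot_apply k i).comp (by fun_prop)).measurable
  exact (by fun_prop : Measurable fun p : (Plane × Plane) × ℝ => Real.exp (-ε * p.2)).mul
    (((h3 0).mul (h2 0)).add ((h3 1).mul (h2 1)))

lemma exists_resolventIntegrand_le : ∃ C : ℝ, 0 < C ∧ ∀ (ε a : ℝ) (x y : Plane) (t : ℝ)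
    (i j : Fin 2), 0 < t → |resolventIntegrand ε a x y t i j| ≤
      C * Real.exp (-ε * t) * (t + ‖mulV (rot (a * t)) x - y‖ ^ 2)⁻¹ := by
  obtain ⟨C, hC, h⟩ := exists_stokesKernel_le
  refine ⟨2 * C, by positivity, fun ε a x y t i j ht => ?_⟩
  rw [resolventIntegrand_apply, abs_mul, abs_of_pos (Real.exp_pos _), Fin.sum_univ_two]
  set z := mulV (rot (a * t)) x - y
  have hk : ∀ k, |rot (a * t) k i * stokesKernel z t k j| ≤ C * (t + ‖z‖ ^ 2)⁻¹ := fun k => by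
    rw [abs_mul]
    exact (mul_le_of_le_one_left (abs_nonneg _) (abs_rot_apply_le _ _ _)).trans (h z t k j ht)
  have h3 := (abs_add_le _ _).trans (add_le_add (hk 0) (hk 1))
  calc _ ≤ Real.exp (-ε * t) * (C * (t + ‖z‖ ^ 2)⁻¹ + C * (t + ‖z‖ ^ 2)⁻¹) := by gcongr
    _ = _ := by ring

/-- From √t |z| ≤ t + |z|². It separates a time factor integrable at 0 from a space factor locally
integrable in the plane. In extended reals it also covers z = 0, where the right side is infinite.
-/
lemma inv_add_sq_le {t : ℝ} (ht : 0 < t) (z : Plane) :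
    ENNReal.ofReal ((t + ‖z‖ ^ 2)⁻¹) ≤ ENNReal.ofReal (t ^ (-1 / 2 : ℝ)) * ‖z‖ₑ⁻¹ := by
  rcases eq_or_ne z 0 with rfl | hz
  · have : ENNReal.ofReal (t ^ (-1 / 2 : ℝ)) ≠ 0 := by
      simpa using Real.rpow_pos_of_pos ht _
    simp [ENNReal.mul_top this]
  · have hz' := norm_pos_iff.2 hz
    rw [← ofReal_norm, ← ENNReal.ofReal_inv_of_pos hz', ← ENNReal.ofReal_mul (by positivity)]
    refine ENNReal.ofReal_le_ofReal ?_
    have h1 : t ^ (-1 / 2 : ℝ) = (√t)⁻¹ := by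
      rw [Real.sqrt_eq_rpow, ← Real.rpow_neg ht.le]; norm_num
    have h2 := Real.sqrt_pos.2 ht
    rw [h1, ← mul_inv]
    gcongr
    nlinarith [Real.sq_sqrt ht.le, sq_nonneg (√t - ‖z‖), mul_pos h2 hz']

lemma lintegral_exp_rpow_lt_top {ε : ℝ} (hε : 0 < ε) (C : ℝ) :
    ∫⁻ t in Ioi (0 : ℝ), ENNReal.ofReal (C * Real.exp (-ε * t) * t ^ (-1 / 2 : ℝ)) < ⊤ := by
  have h := (integrableOn_rpow_mul_exp_neg_mul_rpow (s := -1 / 2) (p := 1) (by norm_num)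
    zero_lt_one hε).const_mul C
  simp only [Real.rpow_one] at h
  refine (lintegral_mono fun t => ?_).trans_lt h.2
  rw [show C * Real.exp (-ε * t) * t ^ (-1 / 2 : ℝ) =
    C * (t ^ (-1 / 2 : ℝ) * Real.exp (-ε * t)) by ring]
  exact Real.ofReal_le_enorm _

lemma exists_enorm_resolventIntegrand_le : ∃ C : ℝ, 0 < C ∧ ∀ (ε a : ℝ) (x y : Plane) (t : ℝ)
    (i j : Fin 2), 0 < t → ‖resolventIntegrand ε a x y t i j‖ₑ ≤
      ENNReal.ofReal (C * Real.exp (-ε * t) * t ^ (-1 / 2 : ℝ)) *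
        ‖mulV (rot (a * t)) x - y‖ₑ⁻¹ := by
  obtain ⟨C, hC, h⟩ := exists_resolventIntegrand_le
  refine ⟨C, hC, fun ε a x y t i j ht => ?_⟩
  rw [← ofReal_norm, ENNReal.ofReal_mul (by positivity), mul_assoc]
  refine (ENNReal.ofReal_le_ofReal (h ε a x y t i j ht)).trans ?_
  rw [ENNReal.ofReal_mul (by positivity)]
  gcongr
  exact inv_add_sq_le ht _

lemma measurable_resolventIntegrand_time (ε a : ℝ) (x y : Plane) (i j : Fin 2) :
    Measurable (fun t => resolventIntegrand ε a x y t i j) :=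
  (measurable_resolventIntegrand ε a i j).comp
    (measurable_prodMk_left (x := (x, y)))

/-- On [0,1] the denominator t + |O(at)x-y|² is continuous and never zero, its value at t = 0 being
|x-y|² > 0. For t > 1 the exponential gives convergence. -/
lemma integrableOn_resolventIntegrand {ε : ℝ} (hε : 0 < ε) (a : ℝ) {x y : Plane} (hxy : x ≠ y)
    (i j : Fin 2) : IntegrableOn (fun t => resolventIntegrand ε a x y t i j) (Ioi 0) := by
  obtain ⟨C, hC, h⟩ := exists_resolventIntegrand_le
  have hz : Continuous (fun t : ℝ => mulV (rot (a * t)) x - y) :=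
    (continuous_mulV_rot.comp (by fun_prop : Continuous fun t : ℝ => (x, a * t))).sub
      continuous_const
  have hr0 : mulV (rot (a * 0)) x - y = x - y := by
    rw [mulV_rot_eq]; simp
  have hpos : ∀ t ∈ Ici (0 : ℝ), t + ‖mulV (rot (a * t)) x - y‖ ^ 2 ≠ 0 := by
    intro t ht
    rcases eq_or_lt_of_le (mem_Ici.1 ht) with rfl | ht
    · rw [hr0]
      have : 0 < ‖x - y‖ := norm_pos_iff.2 (sub_ne_zero.2 hxy)
      positivity
    · positivity
  have hc : ContinuousOn (fun t : ℝ => C * Real.exp (-ε * t) *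
      (t + ‖mulV (rot (a * t)) x - y‖ ^ 2)⁻¹) (Ici 0) :=
    (by fun_prop : Continuous fun t : ℝ => C * Real.exp (-ε * t)).continuousOn.mul
      ((continuous_id.add (hz.norm.pow 2)).continuousOn.inv₀ hpos)
  have hm := measurable_resolventIntegrand_time ε a x y i j
  rw [← Ioc_union_Ioi_eq_Ioi (zero_le_one' ℝ)]
  refine IntegrableOn.union ?_ ?_
  · refine Integrable.mono' ((hc.mono Icc_subset_Ici_self).integrableOn_Icc.mono_set
      (Ioc_subset_Icc_self (b := 1))) hm.aestronglyMeasurable ?_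
    filter_upwards [ae_restrict_mem measurableSet_Ioc] with t ht
    exact h ε a x y t i j ht.1
  · have hi := (integrableOn_exp_mul_Ioi (a := -ε) (by linarith) 1).const_mul C
    refine Integrable.mono' hi hm.aestronglyMeasurable ?_
    filter_upwards [ae_restrict_mem measurableSet_Ioi] with t ht
    have ht1 : 1 < t := ht
    refine (h ε a x y t i j (by linarith)).trans (mul_le_of_le_one_right (by positivity) ?_)
    exact inv_le_one_of_one_le₀ (by nlinarith [sq_nonneg ‖mulV (rot (a * t)) x - y‖])

/-- Uniform bound for the absolute double integral that defines the resolvent potential. -/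
lemma exists_lintegral_resolventIntegrand_mul_le {F : Type*} [NormedAddCommGroup F]
    {ε : ℝ} (hε : 0 < ε) {f : Plane → F}
    (h1 : MemLp f 1 volume) (htop : MemLp f ∞ volume) :
    ∃ N : ℝ≥0∞, N ≠ ⊤ ∧ ∀ (a : ℝ) (x : Plane) (i j : Fin 2),
      ∫⁻ y, ∫⁻ t in Ioi (0 : ℝ), ‖resolventIntegrand ε a x y t i j‖ₑ * ‖f y‖ₑ ≤ N := by
  obtain ⟨N, hN, h⟩ := exists_lintegral_inv_enorm_mul_le h1 htop
  obtain ⟨C, hC, hR⟩ := exists_enorm_resolventIntegrand_le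
  refine ⟨(∫⁻ t in Ioi (0 : ℝ), ENNReal.ofReal (C * Real.exp (-ε * t) * t ^ (-1 / 2 : ℝ))) * N,
    ENNReal.mul_ne_top (lintegral_exp_rpow_lt_top hε C).ne hN, fun a x i j => ?_⟩
  -- With time outside, the rotated point is merely another centre of the convolution, and the bound
  -- N is uniform in the centre.
  rw [lintegral_lintegral_swap]
  · rw [← lintegral_mul_const _ (by fun_prop)]
    refine setLIntegral_mono_ae' measurableSet_Ioi (Eventually.of_forall fun t ht => ?_)
    calc _ ≤ ∫⁻ y, ENNReal.ofReal (C * Real.exp (-ε * t) * t ^ (-1 / 2 : ℝ)) *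
          (‖mulV (rot (a * t)) x - y‖ₑ⁻¹ * ‖f y‖ₑ) := by
          refine lintegral_mono fun y => ?_
          rw [← mul_assoc]
          gcongr
          exact hR ε a x y t i j ht
      _ ≤ _ := by
          rw [lintegral_const_mul' _ _ ENNReal.ofReal_ne_top]
          gcongr
          exact h _
  · refine AEMeasurable.mul ?_ h1.1.enorm.comp_fst
    exact ((measurable_resolventIntegrand ε a i j).comp
      ((measurable_const.prodMk measurable_fst).prodMk measurable_snd)).enorm.aemeasurable

/-! ### The resolvent potential: convergence, measurability, boundedness. -/

lemma measurable_resolventKernel (ε a : ℝ) (i j : Fin 2) :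
    Measurable (fun p : Plane × Plane => resolventKernel ε a p.1 p.2 i j) :=
  ((measurable_resolventIntegrand ε a i j).stronglyMeasurable.integral_prod_right'
    (ν := volume.restrict (Ioi (0 : ℝ)))).measurable

lemma resolventKernel_apply (ε a : ℝ) (x y : Plane) (i j : Fin 2) :
    resolventKernel ε a x y i j = ∫ t in Ioi (0 : ℝ), resolventIntegrand ε a x y t i j := rfl

lemma enorm_coord_le (v : Plane) (i : Fin 2) : ‖v i‖ₑ ≤ ‖v‖ₑ := by
  rw [enorm_le_iff_norm_le]; exact PiLp.norm_apply_le v i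

lemma aestronglyMeasurable_coord {α : Type*} [MeasurableSpace α] {μ : Measure α} {f : α → Plane}
    (hf : AEStronglyMeasurable f μ) (i : Fin 2) : AEStronglyMeasurable (fun x => f x i) μ :=
  (EuclideanSpace.proj i : Plane →L[ℝ] ℝ).continuous.comp_aestronglyMeasurable hf

lemma exists_lintegral_resolventKernel_mul_le {ε : ℝ} (hε : 0 < ε) {f : Plane → Plane}
    (h1 : MemLp f 1 volume) (htop : MemLp f ∞ volume) :
    ∃ N : ℝ≥0∞, N ≠ ⊤ ∧ ∀ (a : ℝ) (x : Plane) (i j : Fin 2),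
      ∫⁻ y, ‖resolventKernel ε a x y i j * f y j‖ₑ ≤ N := by
  obtain ⟨N, hN, h⟩ := exists_lintegral_resolventIntegrand_mul_le hε h1 htop
  refine ⟨N, hN, fun a x i j => (lintegral_mono fun y => ?_).trans (h a x i j)⟩
  rw [enorm_mul, lintegral_mul_const' _ _ enorm_ne_top]
  gcongr
  · exact enorm_integral_le_lintegral_enorm _
  · exact enorm_coord_le _ _

lemma integrable_resolventKernel_mul {ε : ℝ} (hε : 0 < ε) (a : ℝ) {f : Plane → Plane}
    (h1 : MemLp f 1 volume) (htop : MemLp f ∞ volume) (x : Plane) (i j : Fin 2) :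
    Integrable (fun y => resolventKernel ε a x y i j * f y j) := by
  obtain ⟨N, hN, h⟩ := exists_lintegral_resolventKernel_mul_le hε h1 htop
  refine ⟨?_, (h a x i j).trans_lt hN.lt_top⟩
  exact ((measurable_resolventKernel ε a i j).comp
    (measurable_const.prodMk measurable_id)).aestronglyMeasurable.mul
    (aestronglyMeasurable_coord h1.1 j)

lemma mulV_apply (A : Matrix (Fin 2) (Fin 2) ℝ) (v : Plane) (i : Fin 2) :
    mulV A v i = ∑ j, A i j * v j := by
  rw [mulV, Matrix.mulVec_eq_sum]
  simp [mul_comm]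

lemma integrable_mulV_resolventKernel {ε : ℝ} (hε : 0 < ε) (a : ℝ) {f : Plane → Plane}
    (h1 : MemLp f 1 volume) (htop : MemLp f ∞ volume) (x : Plane) :
    Integrable (fun y => mulV (resolventKernel ε a x y) (f y)) := by
  refine Integrable.of_eval_piLp fun i => ?_
  simp only [mulV_apply]
  exact integrable_finsetSum _ fun j _ => integrable_resolventKernel_mul hε a h1 htop x i j

lemma resolventPotential_apply {ε : ℝ} (hε : 0 < ε) (a : ℝ) {f : Plane → Plane}
    (h1 : MemLp f 1 volume) (htop : MemLp f ∞ volume) (x : Plane) (i : Fin 2) :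
    resolventPotential ε a f x i = ∑ j, ∫ y, resolventKernel ε a x y i j * f y j := by
  rw [resolventPotential, eval_integral_piLp]
  · simp only [mulV_apply]
    exact integral_finsetSum _ fun j _ => integrable_resolventKernel_mul hε a h1 htop x i j
  · intro i
    simp only [mulV_apply]
    exact integrable_finsetSum _ fun j _ => integrable_resolventKernel_mul hε a h1 htop x i j

lemma aestronglyMeasurable_resolventKernel_mul (ε a : ℝ) {f : Plane → Plane}
    (h1 : MemLp f 1 volume) (i j : Fin 2) :
    AEStronglyMeasurable (fun p : Plane × Plane => resolventKernel ε a p.1 p.2 i j * f p.2 j)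
      (volume.prod volume) :=
  (measurable_resolventKernel ε a i j).aestronglyMeasurable.mul
    (aestronglyMeasurable_coord h1.1 j).comp_snd

lemma exists_abs_resolventPotential_le {ε : ℝ} (hε : 0 < ε) (a : ℝ) {f : Plane → Plane}
    (h1 : MemLp f 1 volume) (htop : MemLp f ∞ volume) :
    ∃ N : ℝ, ∀ x i, |resolventPotential ε a f x i| ≤ N := by
  obtain ⟨N, hN, h⟩ := exists_lintegral_resolventKernel_mul_le hε h1 htop
  refine ⟨N.toReal + N.toReal, fun x i => ?_⟩
  rw [resolventPotential_apply hε a h1 htop, Fin.sum_univ_two]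
  have hb : ∀ j, |∫ y, resolventKernel ε a x y i j * f y j| ≤ N.toReal := fun j => by
    rw [← Real.norm_eq_abs, ← toReal_enorm]
    exact ENNReal.toReal_mono hN ((enorm_integral_le_lintegral_enorm _).trans (h a x i j))
  exact (abs_add_le _ _).trans (add_le_add (hb 0) (hb 1))

lemma aestronglyMeasurable_resolventPotential {ε : ℝ} (hε : 0 < ε) (a : ℝ) {f : Plane → Plane}
    (h1 : MemLp f 1 volume) (htop : MemLp f ∞ volume) (i : Fin 2) :
    AEStronglyMeasurable (fun x => resolventPotential ε a f x i) volume := by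
  simp only [resolventPotential_apply hε a h1 htop, Fin.sum_univ_two]
  exact (aestronglyMeasurable_resolventKernel_mul ε a h1 i 0).integral_prod_right'.add
    (aestronglyMeasurable_resolventKernel_mul ε a h1 i 1).integral_prod_right'

lemma locallyIntegrable_of_bound {g : Plane → ℝ} {N : ℝ} (hg : AEStronglyMeasurable g volume)
    (hb : ∀ x, |g x| ≤ N) : LocallyIntegrable g volume :=
  (memLp_top_of_bound hg N (Eventually.of_forall hb)).locallyIntegrable le_top

lemma locallyIntegrable_of_coord {g : Plane → Plane}
    (h : ∀ i, LocallyIntegrable (fun x => g x i) volume) : LocallyIntegrable g volume := by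
  rw [locallyIntegrable_iff]
  exact fun K hK => Integrable.of_eval_piLp fun i => (locallyIntegrable_iff.1 (h i)) K hK

lemma locallyIntegrable_resolventPotential {ε : ℝ} (hε : 0 < ε) (a : ℝ) {f : Plane → Plane}
    (h1 : MemLp f 1 volume) (htop : MemLp f ∞ volume) :
    LocallyIntegrable (resolventPotential ε a f) volume := by
  obtain ⟨N, hN⟩ := exists_abs_resolventPotential_le hε a h1 htop
  exact locallyIntegrable_of_coord fun i =>
    locallyIntegrable_of_bound (aestronglyMeasurable_resolventPotential hε a h1 htop i)
      fun x => hN x i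

/-! ### The pressure potential. -/

lemma measurable_pressureKernel : Measurable pressureKernel := by
  unfold pressureKernel; fun_prop

lemma norm_pressureKernel_le (x : Plane) : ‖pressureKernel x‖ ≤ ‖x‖⁻¹ := by
  rcases eq_or_ne x 0 with rfl | hx
  · simp [pressureKernel]
  · have hx' : 0 < ‖x‖ := norm_pos_iff.2 hx
    rw [pressureKernel, norm_smul, Real.norm_eq_abs, abs_of_pos (by positivity)]
    have : (2 * Real.pi * ‖x‖ ^ 2)⁻¹ * ‖x‖ = (2 * Real.pi)⁻¹ * ‖x‖⁻¹ := by field_simp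
    rw [this]
    refine mul_le_of_le_one_left (by positivity) (inv_le_one_of_one_le₀ ?_)
    nlinarith [Real.pi_gt_three]

lemma enorm_pressureKernel_le (x : Plane) : ‖pressureKernel x‖ₑ ≤ ‖x‖ₑ⁻¹ := by
  rcases eq_or_ne x 0 with rfl | hx
  · simp
  · rw [← ofReal_norm, ← ofReal_norm, ← ENNReal.ofReal_inv_of_pos (norm_pos_iff.2 hx)]
    exact ENNReal.ofReal_le_ofReal (norm_pressureKernel_le x)

lemma aestronglyMeasurable_pressureKernel_inner {f : Plane → Plane}
    (h1 : MemLp f 1 volume) :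
    AEStronglyMeasurable (fun p : Plane × Plane => inner ℝ (pressureKernel (p.1 - p.2)) (f p.2))
      (volume.prod volume) :=
  (measurable_pressureKernel.comp (by fun_prop :
    Measurable fun p : Plane × Plane => p.1 - p.2)).aestronglyMeasurable.inner h1.1.comp_snd

lemma exists_lintegral_pressureKernel_le {f : Plane → Plane}
    (h1 : MemLp f 1 volume) (htop : MemLp f ∞ volume) :
    ∃ N : ℝ≥0∞, N ≠ ⊤ ∧ ∀ x,
      ∫⁻ y, ‖inner ℝ (pressureKernel (x - y)) (f y)‖ₑ ≤ N := by
  obtain ⟨N, hN, h⟩ := exists_lintegral_inv_enorm_mul_le h1 htop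
  refine ⟨N, hN, fun x => (lintegral_mono fun y => ?_).trans (h x)⟩
  calc ‖inner ℝ (pressureKernel (x - y)) (f y)‖ₑ
      ≤ ‖pressureKernel (x - y)‖ₑ * ‖f y‖ₑ := by
        rw [← ofReal_norm, ← ofReal_norm, ← ofReal_norm, ← ENNReal.ofReal_mul (norm_nonneg _)]
        exact ENNReal.ofReal_le_ofReal (norm_inner_le_norm _ _)
    _ ≤ _ := by gcongr; exact enorm_pressureKernel_le _

lemma integrable_pressureKernel_inner {f : Plane → Plane}
    (h1 : MemLp f 1 volume) (htop : MemLp f ∞ volume) (x : Plane) :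
    Integrable (fun y => inner ℝ (pressureKernel (x - y)) (f y)) := by
  obtain ⟨N, hN, h⟩ := exists_lintegral_pressureKernel_le h1 htop
  exact ⟨(measurable_pressureKernel.comp (by fun_prop :
    Measurable fun y : Plane => x - y)).aestronglyMeasurable.inner h1.1, (h x).trans_lt hN.lt_top⟩

lemma locallyIntegrable_pressurePotential {f : Plane → Plane}
    (h1 : MemLp f 1 volume) (htop : MemLp f ∞ volume) :
    LocallyIntegrable (pressurePotential f) volume := by
  obtain ⟨N, hN, h⟩ := exists_lintegral_pressureKernel_le h1 htop
  refine locallyIntegrable_of_bound (N := N.toReal)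
    (aestronglyMeasurable_pressureKernel_inner h1).integral_prod_right' fun x => ?_
  rw [← Real.norm_eq_abs, ← toReal_enorm]
  exact ENNReal.toReal_mono hN ((enorm_integral_le_lintegral_enorm _).trans (h x))

/-! ### Far-field bound -/

lemma hasDerivAt_rot (p q : Fin 2) (θ : ℝ) :
    HasDerivAt (fun θ => rot θ p q) (rot (θ + Real.pi / 2) p q) θ := by
  revert p q
  simp only [Fin.forall_fin_two, rot_zero_zero, rot_zero_one, rot_one_zero, rot_one_one,
    Real.cos_add_pi_div_two, Real.sin_add_pi_div_two]
  exact ⟨⟨Real.hasDerivAt_cos θ, (Real.hasDerivAt_sin θ).neg⟩, Real.hasDerivAt_sin θ,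
    Real.hasDerivAt_cos θ⟩

lemma rot_add_pi (θ : ℝ) (p q : Fin 2) :
    rot (θ + Real.pi / 2 + Real.pi / 2) p q = -rot θ p q := by
  have h : θ + Real.pi / 2 + Real.pi / 2 = θ + Real.pi := by ring
  rw [h]
  revert p q
  simp [Fin.forall_fin_two, rot_zero_zero, rot_zero_one, rot_one_zero, rot_one_one]

/-- A bounded antiderivative of `e^{-εt} O(at)`. -/
def oscPrimitive (ε a : ℝ) (p q : Fin 2) (t : ℝ) : ℝ :=
  Real.exp (-ε * t) * (-ε * rot (a * t) p q - a * rot (a * t + Real.pi / 2) p q) / (ε ^ 2 + a ^ 2)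

/-- Analogue of the primitive e^((-ε+ia)t)(-ε-ia)/(ε²+a²) of e^((-ε+ia)t). The quarter turn plays
the role of i: applied twice it is -1. -/
lemma hasDerivAt_oscPrimitive (ε : ℝ) {a : ℝ} (ha : a ≠ 0) (p q : Fin 2) (t : ℝ) :
    HasDerivAt (oscPrimitive ε a p q) (Real.exp (-ε * t) * rot (a * t) p q) t := by
  have h0 : HasDerivAt (fun t => a * t) a t := by simpa using (hasDerivAt_id t).const_mul a
  have h1 : HasDerivAt (fun t => rot (a * t) p q) (rot (a * t + Real.pi / 2) p q * a) t :=
    HasDerivAt.comp t (hasDerivAt_rot p q (a * t)) h0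
  have h2 : HasDerivAt (fun t => rot (a * t + Real.pi / 2) p q)
      (rot (a * t + Real.pi / 2 + Real.pi / 2) p q * a) t :=
    HasDerivAt.comp (h₂ := fun θ => rot θ p q) t (hasDerivAt_rot p q (a * t + Real.pi / 2)) (h0.add_const (Real.pi / 2))
  have h3 : HasDerivAt (fun t => Real.exp (-ε * t)) (Real.exp (-ε * t) * (-ε)) t := by
    simpa using ((hasDerivAt_id t).const_mul (-ε)).exp
  have h4 := (h3.mul ((h1.const_mul (-ε)).sub (h2.const_mul a))).div_const (ε ^ 2 + a ^ 2)
  have hne : ε ^ 2 + a ^ 2 ≠ 0 := by positivity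
  refine h4.congr_deriv ?_
  rw [rot_add_pi, div_eq_iff hne]
  simp only [Pi.sub_apply]
  ring

/-- Since (ε+|a|)|a| ≤ 2(ε²+a²). This is the origin of the factor |a|⁻¹ and of the independence of
ε. -/
lemma abs_oscPrimitive_le {ε a : ℝ} (hε : 0 < ε) (ha : a ≠ 0) (p q : Fin 2) {t : ℝ}
    (ht : 0 ≤ t) : |oscPrimitive ε a p q t| ≤ 2 * |a|⁻¹ := by
  have ha' : 0 < |a| := abs_pos.2 ha
  have hexp : Real.exp (-ε * t) ≤ 1 := by
    rw [Real.exp_le_one_iff]; nlinarith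
  have hn : |-ε * rot (a * t) p q - a * rot (a * t + Real.pi / 2) p q| ≤ ε + |a| := by
    refine (abs_sub _ _).trans (add_le_add ?_ ?_)
    · rw [abs_mul, abs_neg, abs_of_pos hε]
      exact mul_le_of_le_one_right hε.le (abs_rot_apply_le _ _ _)
    · rw [abs_mul]
      exact mul_le_of_le_one_right ha'.le (abs_rot_apply_le _ _ _)
  rw [oscPrimitive, abs_div, abs_mul, abs_of_pos (Real.exp_pos _),
    abs_of_pos (by positivity : 0 < ε ^ 2 + a ^ 2), div_le_iff₀ (by positivity)]
  calc _ ≤ 1 * (ε + |a|) := by gcongr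
    _ ≤ 2 * |a|⁻¹ * (ε ^ 2 + a ^ 2) := by
      rw [mul_assoc, ← div_eq_inv_mul, mul_div_assoc', le_div_iff₀ ha', ← sq_abs a]
      nlinarith [sq_nonneg (ε - |a|)]

lemma exists_stokesKernel_time_bounds : ∃ C : ℝ, 0 < C ∧
    ∀ (z : Plane) (t : ℝ) (r s : Fin 2), 0 < t →
    |stokesKernel z t r s| ≤ C * t⁻¹ ∧ |stokesKernelDt z t r s| ≤ C * t ^ (-2 : ℝ) := by
  obtain ⟨C₁, hC₁, h₁⟩ := exists_stokesKernel_le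
  obtain ⟨C₂, hC₂, h₂⟩ := exists_stokesKernelDt_le
  refine ⟨C₁ + C₂, by positivity, fun z t r s ht => ⟨?_, ?_⟩⟩
  · refine (h₁ z t r s ht).trans ?_
    gcongr
    · linarith
    · nlinarith [sq_nonneg ‖z‖]
  · refine (h₂ z t r s ht).trans ?_
    refine mul_le_mul (by linarith) ?_ (by positivity) (by positivity)
    exact Real.rpow_le_rpow_of_nonpos ht (by nlinarith [sq_nonneg ‖z‖]) (by norm_num)

lemma measurable_stokesKernel_time (z : Plane) (r s : Fin 2) :
    Measurable (fun t => stokesKernel z t r s) :=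
  (measurable_stokesKernel r s).comp (measurable_prodMk_left (x := z))

lemma integrableOn_osc {ε : ℝ} (hε : 0 < ε) (a : ℝ) {t₀ : ℝ} (ht₀ : 0 < t₀)
    (z : Plane) (p q r s : Fin 2) :
    IntegrableOn (fun t => Real.exp (-ε * t) * rot (a * t) p q * stokesKernel z t r s)
      (Ioi t₀) := by
  obtain ⟨C, hC, h⟩ := exists_stokesKernel_time_bounds
  refine Integrable.mono' ((integrableOn_exp_mul_Ioi (a := -ε) (by linarith) t₀).mul_const
    (C * t₀⁻¹)) ?_ ?_
  · refine AEStronglyMeasurable.mul (Continuous.aestronglyMeasurable ?_)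
      (measurable_stokesKernel_time z r s).aestronglyMeasurable
    exact (by fun_prop : Continuous fun t : ℝ => Real.exp (-ε * t)).mul
      ((continuous_rot_apply p q).comp (by fun_prop))
  · filter_upwards [ae_restrict_mem measurableSet_Ioi] with t ht
    have ht' : t₀ < t := ht
    rw [norm_mul, norm_mul, Real.norm_eq_abs, Real.norm_eq_abs, Real.norm_eq_abs,
      abs_of_pos (Real.exp_pos _)]
    refine mul_le_mul (mul_le_of_le_one_right (by positivity) (abs_rot_apply_le _ _ _))
      ((h z t r s (ht₀.trans ht')).1.trans ?_) (abs_nonneg _) (by positivity)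
    gcongr

/-- The rotation produces oscillation: the bound does not depend on `ε`. -/
lemma exists_abs_integral_osc_le : ∃ C : ℝ, 0 < C ∧ ∀ (ε a t₀ : ℝ) (z : Plane)
    (p q r s : Fin 2), 0 < ε → a ≠ 0 → 0 < t₀ →
    |∫ t in Ioi t₀, Real.exp (-ε * t) * rot (a * t) p q * stokesKernel z t r s| ≤
      C * |a|⁻¹ * t₀⁻¹ := by
  obtain ⟨C, hC, h⟩ := exists_stokesKernel_time_bounds
  refine ⟨4 * C, by positivity, fun ε a t₀ z p q r s hε ha ht₀ => ?_⟩
  set A := oscPrimitive ε a p q with hA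
  have hAd := hasDerivAt_oscPrimitive ε ha p q
  have hAc : Continuous A := continuous_iff_continuousAt.2 fun t => (hAd t).continuousAt
  have hAb : ∀ t, t₀ ≤ t → |A t| ≤ 2 * |a|⁻¹ := fun t ht =>
    abs_oscPrimitive_le hε ha p q (ht₀.le.trans ht)
  have hdom : IntegrableOn (fun t => 2 * |a|⁻¹ * (C * t ^ (-2 : ℝ))) (Ioi t₀) :=
    ((integrableOn_Ioi_rpow_of_lt (by norm_num) ht₀).const_mul C).const_mul _
  have hle : ∀ᵐ t ∂(volume.restrict (Ioi t₀)), ‖A t * stokesKernelDt z t r s‖ ≤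
      2 * |a|⁻¹ * (C * t ^ (-2 : ℝ)) := by
    filter_upwards [ae_restrict_mem measurableSet_Ioi] with t ht
    rw [norm_mul]
    exact mul_le_mul (hAb t (le_of_lt ht)) (h z t r s (ht₀.trans ht)).2 (norm_nonneg _)
      (by positivity)
  have hi2 : IntegrableOn (fun t => A t * stokesKernelDt z t r s) (Ioi t₀) := by
    refine Integrable.mono' hdom (hAc.aestronglyMeasurable.mul ?_) hle
    exact ((measurable_stokesKernelDt r s).comp
      (measurable_prodMk_left (x := z))).aestronglyMeasurable
  have hi1 := integrableOn_osc hε a ht₀ z p q r s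
  have hlim : Tendsto (fun t => A t * stokesKernel z t r s) atTop (𝓝 0) := by
    refine squeeze_zero_norm' (a := fun t => 2 * |a|⁻¹ * (C * t⁻¹)) ?_ ?_
    · filter_upwards [eventually_ge_atTop t₀] with t ht
      rw [norm_mul]
      exact mul_le_mul (hAb t ht) (h z t r s (ht₀.trans_le ht)).1 (norm_nonneg _) (by positivity)
    · simpa using (tendsto_inv_atTop_zero.const_mul C).const_mul (2 * |a|⁻¹)
  -- Integration by parts, as the fundamental theorem for A·K. The boundary term at infinity
  -- vanishes; the one at t₀ and the integral of A ∂ₜK are each at most 2C|a|⁻¹/t₀, whence 4C.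
  have hFTC := integral_Ioi_of_hasDerivAt_of_tendsto' (a := t₀)
    (fun t ht => (hAd t).mul (hasDerivAt_stokesKernel z (ht₀.trans_le ht) r s))
    (hi1.add hi2) hlim
  rw [integral_add hi1 hi2] at hFTC
  have hb2 := norm_integral_le_of_norm_le hdom hle
  rw [integral_const_mul, integral_const_mul, integral_Ioi_rpow_of_lt (by norm_num) ht₀] at hb2
  norm_num [Real.rpow_neg_one] at hb2
  have hb1 : |A t₀ * stokesKernel z t₀ r s| ≤ 2 * |a|⁻¹ * (C * t₀⁻¹) := by
    rw [abs_mul]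
    exact mul_le_mul (hAb t₀ le_rfl) (h z t₀ r s ht₀).1 (abs_nonneg _) (by positivity)
  rw [eq_sub_of_add_eq hFTC]
  refine (abs_sub _ _).trans ?_
  rw [zero_sub, abs_neg, Pi.mul_apply]
  linarith

lemma integrableOn_resolventIntegrand_Ioi {ε : ℝ} (hε : 0 < ε) (a : ℝ) {t₀ : ℝ} (ht₀ : 0 < t₀)
    (x y : Plane) (i j : Fin 2) :
    IntegrableOn (fun t => resolventIntegrand ε a x y t i j) (Ioi t₀) := by
  obtain ⟨C, hC, h⟩ := exists_resolventIntegrand_le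
  refine Integrable.mono' (((integrableOn_exp_mul_Ioi (a := -ε) (by linarith) t₀).const_mul
    C).mul_const t₀⁻¹) (measurable_resolventIntegrand_time ε a x y i j).aestronglyMeasurable ?_
  filter_upwards [ae_restrict_mem measurableSet_Ioi] with t ht
  have ht' : t₀ < t := ht
  refine (h ε a x y t i j (ht₀.trans ht')).trans ?_
  gcongr
  nlinarith [sq_nonneg ‖mulV (rot (a * t)) x - y‖]

/-- Comparison of the tail of the resolvent kernel with an oscillatory integral of `K(z,t)`. -/
lemma abs_integral_resolventIntegrand_sub_le {C ε a t₀ m d : ℝ} {x y : Plane} {z : ℝ → Plane}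
    (hC : 0 < C)
    (hK : ∀ (x x' : Plane) (t m : ℝ) (i j : Fin 2), 0 < t → 0 ≤ m →
      (∀ z ∈ segment ℝ x x', m ≤ ‖z‖) → |stokesKernel x' t i j - stokesKernel x t i j| ≤
        C * (t + m ^ 2) ^ (-3 / 2 : ℝ) * ‖x' - x‖)
    (hε : 0 < ε) (ht₀ : 0 < t₀) (hm : 0 ≤ m) (i j : Fin 2)
    (hseg : ∀ t, ∀ w ∈ segment ℝ (z t) (mulV (rot (a * t)) x - y), m ≤ ‖w‖)
    (hd : ∀ t, ‖mulV (rot (a * t)) x - y - z t‖ ≤ d)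
    (hmain : IntegrableOn (fun t => Real.exp (-ε * t) *
      ∑ k, rot (a * t) k i * stokesKernel (z t) t k j) (Ioi t₀)) :
    |(∫ t in Ioi t₀, resolventIntegrand ε a x y t i j) - ∫ t in Ioi t₀, Real.exp (-ε * t) *
      ∑ k, rot (a * t) k i * stokesKernel (z t) t k j| ≤
      4 * C * d * (t₀ + m ^ 2) ^ (-1 / 2 : ℝ) := by
  have hp : 0 < t₀ + m ^ 2 := by positivity
  rw [← integral_sub (integrableOn_resolventIntegrand_Ioi hε a ht₀ x y i j) hmain]
  -- One factor 2 comes from the two summands k, the other from integrating (t+m²)^(-3/2) over t >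
  -- t₀.
  have h1 := norm_integral_le_of_norm_le (μ := volume.restrict (Ioi t₀))
    (f := fun t => resolventIntegrand ε a x y t i j - Real.exp (-ε * t) *
      ∑ k, rot (a * t) k i * stokesKernel (z t) t k j)
    ((integrableOn_add_rpow_Ioi_of_lt (a := -3 / 2) (c := t₀)
      (m := m ^ 2) (by norm_num) (by linarith)).const_mul (2 * C * d)) ?_
  · rw [integral_const_mul, integral_Ioi_add_rpow (by norm_num) hp, Real.norm_eq_abs] at h1
    refine h1.trans_eq ?_
    rw [show (-3 / 2 : ℝ) + 1 = -1 / 2 by norm_num]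
    ring
  · filter_upwards [ae_restrict_mem measurableSet_Ioi] with t ht
    have ht' : 0 < t := ht₀.trans ht
    rw [resolventIntegrand_apply, ← mul_sub, ← Finset.sum_sub_distrib, Fin.sum_univ_two,
      Real.norm_eq_abs, abs_mul, abs_of_pos (Real.exp_pos _)]
    have hexp : Real.exp (-ε * t) ≤ 1 := by
      rw [Real.exp_le_one_iff]; nlinarith
    have hk : ∀ k, |rot (a * t) k i * stokesKernel (mulV (rot (a * t)) x - y) t k j -
        rot (a * t) k i * stokesKernel (z t) t k j| ≤
        C * (t + m ^ 2) ^ (-3 / 2 : ℝ) * d := fun k => by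
      rw [← mul_sub, abs_mul]
      refine (mul_le_of_le_one_left (abs_nonneg _) (abs_rot_apply_le _ _ _)).trans
        ((hK _ _ t m k j ht' hm (hseg t)).trans ?_)
      gcongr
      exact hd t
    calc _ ≤ 1 * (C * (t + m ^ 2) ^ (-3 / 2 : ℝ) * d + C * (t + m ^ 2) ^ (-3 / 2 : ℝ) * d) := by
          refine mul_le_mul hexp ((abs_add_le _ _).trans (add_le_add (hk 0) (hk 1)))
            (abs_nonneg _) zero_le_one
      _ = _ := by ring

lemma sub_le_norm_of_mem_segment {x y w : Plane} (hw : w ∈ segment ℝ x (x - y)) :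
    ‖x‖ - ‖y‖ ≤ ‖w‖ := by
  obtain ⟨θ, ⟨h0, h1⟩, rfl⟩ := (segment_eq_image' ℝ x (x - y)).subset hw
  have e : x + θ • (x - y - x) = x - θ • y := by
    rw [show x - y - x = -y by abel, smul_neg, ← sub_eq_add_neg]
  simp only [e]
  have h2 : ‖θ • y‖ ≤ ‖y‖ := by
    rw [norm_smul, Real.norm_eq_abs, abs_of_nonneg h0]
    exact mul_le_of_le_one_left (norm_nonneg _) h1
  linarith [norm_sub_norm_le x (θ • y)]

/-- Bound for the resolvent kernel when `|y| < |x|/2`. -/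
lemma exists_resolventKernel_near_le : ∃ C : ℝ, 0 < C ∧ ∀ (ε a : ℝ) (x y : Plane) (i j : Fin 2),
    0 < ε → a ≠ 0 → 1 ≤ ‖x‖ → ‖y‖ < ‖x‖ / 2 →
    |resolventKernel ε a x y i j| ≤ C * (1 + |a|⁻¹) * (1 + ‖y‖) * ‖x‖⁻¹ := by
  obtain ⟨C₁, hC₁, h₁⟩ := exists_resolventIntegrand_le
  obtain ⟨C₂, hC₂, h₂⟩ := exists_stokesKernel_sub_le
  obtain ⟨C₃, hC₃, h₃⟩ := exists_abs_integral_osc_le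
  -- The three constants belong to the times t ≤ R, to the replacement of O(at)x - y by O(at)x, and
  -- to the oscillating main term.
  refine ⟨4 * C₁ + 8 * C₂ + 2 * C₃, by positivity, fun ε a x y i j hε ha hx hy => ?_⟩
  set R := ‖x‖ with hR
  have hR0 : 0 < R := by linarith
  have ha' : 0 < |a|⁻¹ := by positivity
  have hne : x ≠ y := by
    rintro rfl; linarith
  have hint := integrableOn_resolventIntegrand hε a hne i j
  -- Splitting at t = R balances the two sides: the short times give R · R⁻², and the oscillating
  -- tail gives |a|⁻¹ R⁻¹.
  rw [resolventKernel_apply, ← Ioc_union_Ioi_eq_Ioi hR0.le, setIntegral_union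
    Ioc_disjoint_Ioi_same measurableSet_Ioi (hint.mono_set Ioc_subset_Ioi_self)
    (hint.mono_set (Ioi_subset_Ioi hR0.le))]
  have hfar : ∀ t, R / 2 ≤ ‖mulV (rot (a * t)) x - y‖ := fun t => by
    have := norm_sub_norm_le (mulV (rot (a * t)) x) y
    rw [norm_mulV_rot] at this
    linarith
  have b1 : |∫ t in Ioc 0 R, resolventIntegrand ε a x y t i j| ≤ 4 * C₁ * R⁻¹ := by
    have := norm_setIntegral_le_of_norm_le_const (μ := volume) (s := Ioc 0 R)
      (f := fun t => resolventIntegrand ε a x y t i j) (C := 4 * C₁ * (R ^ 2)⁻¹) (by simp)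
      fun t ht => by
        refine (h₁ ε a x y t i j ht.1).trans ?_
        have hexp : Real.exp (-ε * t) ≤ 1 := by
          rw [Real.exp_le_one_iff]; nlinarith [ht.1]
        have hden : (t + ‖mulV (rot (a * t)) x - y‖ ^ 2)⁻¹ ≤ 4 * (R ^ 2)⁻¹ := by
          rw [inv_le_iff_one_le_mul₀ (by nlinarith [ht.1, sq_nonneg ‖mulV (rot (a * t)) x - y‖]),
            mul_assoc, ← div_eq_inv_mul, mul_div_assoc', one_le_div (by positivity)]
          nlinarith [ht.1, hfar t]
        have ht0 : 0 < t := ht.1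
        calc _ ≤ C₁ * 1 * (4 * (R ^ 2)⁻¹) := by gcongr
          _ = _ := by ring
    refine this.trans_eq ?_
    simp only [Real.volume_real_Ioc_of_le hR0.le, sub_zero]
    field_simp
  -- Covariance moves the rotation out of the argument, leaving K at the fixed point x multiplied by
  -- entries of O(at), the form to which the oscillation bound applies.
  have hmain_eq : ∀ t ∈ Ioi R, Real.exp (-ε * t) *
      ∑ k, rot (a * t) k i * stokesKernel (mulV (rot (a * t)) x) t k j =
      Real.exp (-ε * t) * rot (a * t) j 0 * stokesKernel x t i 0 +
      Real.exp (-ε * t) * rot (a * t) j 1 * stokesKernel x t i 1 := fun t ht => by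
    have := congrFun (congrFun (rot_transpose_mul_stokesKernel (a * t) x (hR0.trans ht)) i) j
    simp only [Matrix.mul_apply, Matrix.transpose_apply] at this
    rw [this, Fin.sum_univ_two]
    ring
  have hi := fun k => integrableOn_osc hε a hR0 x j k i k
  have hmain : IntegrableOn (fun t => Real.exp (-ε * t) *
      ∑ k, rot (a * t) k i * stokesKernel (mulV (rot (a * t)) x) t k j) (Ioi R) :=
    ((hi 0).add (hi 1)).congr_fun (fun t ht => (hmain_eq t ht).symm) measurableSet_Ioi
  -- As |y| < R/2, the segment from O(at)x to O(at)x - y stays outside the ball of radius R/2.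
  have b2 := abs_integral_resolventIntegrand_sub_le (x := x) (y := y) (a := a)
    (z := fun t => mulV (rot (a * t)) x) (d := ‖y‖) (m := R / 2) hC₂ h₂ hε hR0 (by positivity) i j
    (fun t w hw => by
      have := sub_le_norm_of_mem_segment hw
      rw [norm_mulV_rot] at this
      linarith) (fun t => by simp) hmain
  have b3 : |∫ t in Ioi R, Real.exp (-ε * t) *
      ∑ k, rot (a * t) k i * stokesKernel (mulV (rot (a * t)) x) t k j| ≤
      2 * C₃ * |a|⁻¹ * R⁻¹ := by
    rw [setIntegral_congr_fun measurableSet_Ioi hmain_eq, integral_add (hi 0) (hi 1)]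
    have q0 := h₃ ε a R x j 0 i 0 hε ha hR0
    have q1 := h₃ ε a R x j 1 i 1 hε ha hR0
    refine (abs_add_le _ _).trans ?_
    linarith
  have hpow : (R + (R / 2) ^ 2) ^ (-1 / 2 : ℝ) ≤ 2 * R⁻¹ := by
    have e : ((R / 2) ^ 2) ^ (-1 / 2 : ℝ) = 2 * R⁻¹ := by
      rw [← Real.rpow_natCast, ← Real.rpow_mul (by positivity)]
      norm_num
      rw [Real.rpow_neg_one, inv_div]
      rfl
    rw [← e]
    exact Real.rpow_le_rpow_of_nonpos (by positivity) (by linarith) (by norm_num)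
  have b2' := b2.trans (mul_le_mul_of_nonneg_left hpow (by positivity))
  set I₁ := ∫ t in Ioc 0 R, resolventIntegrand ε a x y t i j
  set I₂ := ∫ t in Ioi R, resolventIntegrand ε a x y t i j
  set I₃ := ∫ t in Ioi R, Real.exp (-ε * t) *
      ∑ k, rot (a * t) k i * stokesKernel (mulV (rot (a * t)) x) t k j
  have hsum : |I₁ + I₂| ≤ |I₁| + |I₂ - I₃| + |I₃| := by
    have : I₁ + I₂ = I₁ + (I₂ - I₃) + I₃ := by ring
    rw [this]
    exact (abs_add_le _ _).trans (add_le_add_left (abs_add_le _ _) _)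
  have hy0 := norm_nonneg y
  have hRi : 0 < R⁻¹ := by positivity
  calc |I₁ + I₂| ≤ 4 * C₁ * R⁻¹ + 4 * C₂ * ‖y‖ * (2 * R⁻¹) + 2 * C₃ * |a|⁻¹ * R⁻¹ := by linarith
    _ = (4 * C₁ + 8 * C₂ * ‖y‖ + 2 * C₃ * |a|⁻¹) * R⁻¹ := by ring
    _ ≤ _ := by
      gcongr
      have := mul_nonneg hC₁.le hy0
      have := mul_nonneg hC₁.le ha'.le
      have := mul_nonneg hC₂.le ha'.le
      have := mul_nonneg hC₂.le hy0
      have := mul_nonneg hC₃.le hy0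
      have := mul_nonneg hC₁.le (mul_nonneg hy0 ha'.le)
      have := mul_nonneg hC₂.le (mul_nonneg hy0 ha'.le)
      have := mul_nonneg hC₃.le (mul_nonneg hy0 ha'.le)
      nlinarith

/-- Bound for the tail of the resolvent kernel when `|y| ≥ |x|/2`. -/
lemma exists_integral_resolventIntegrand_far_le : ∃ C : ℝ, 0 < C ∧
    ∀ (ε a : ℝ) (x y : Plane) (i j : Fin 2),
    0 < ε → a ≠ 0 → 1 ≤ ‖x‖ → ‖x‖ / 2 ≤ ‖y‖ →
    |∫ t in Ioi (‖x‖ ^ 2), resolventIntegrand ε a x y t i j| ≤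
      C * (1 + |a|⁻¹) * (1 + ‖y‖) * ‖x‖⁻¹ := by
  obtain ⟨C₂, hC₂, h₂⟩ := exists_stokesKernel_sub_le
  obtain ⟨C₃, hC₃, h₃⟩ := exists_abs_integral_osc_le
  refine ⟨8 * C₂ + 4 * C₃, by positivity, fun ε a x y i j hε ha hx hy => ?_⟩
  set R := ‖x‖ with hR
  have hR0 : 0 < R := by linarith
  have hR2 : 0 < R ^ 2 := by positivity
  have ha' : 0 < |a|⁻¹ := by positivity
  have hmain_eq : ∀ t, Real.exp (-ε * t) *
      ∑ k, rot (a * t) k i * stokesKernel (-y) t k j =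
      Real.exp (-ε * t) * rot (a * t) 0 i * stokesKernel (-y) t 0 j +
      Real.exp (-ε * t) * rot (a * t) 1 i * stokesKernel (-y) t 1 j := fun t => by
    rw [Fin.sum_univ_two]
    ring
  have hi := fun k => integrableOn_osc hε a hR2 (-y) k i k j
  have hmain : IntegrableOn (fun t => Real.exp (-ε * t) *
      ∑ k, rot (a * t) k i * stokesKernel (-y) t k j) (Ioi (R ^ 2)) := by
    simp only [hmain_eq]
    exact (hi 0).add (hi 1)
  -- Here the segment may meet the origin, so m = 0. Starting at t = R² makes the error R ·
  -- (R²)^(-1/2), of order one.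
  have b2 := abs_integral_resolventIntegrand_sub_le (x := x) (y := y) (a := a)
    (z := fun _ => -y) (d := R) (m := 0) hC₂ h₂ hε hR2 le_rfl i j
    (fun t w hw => norm_nonneg _) (fun t => by simp [norm_mulV_rot, hR]) hmain
  have b3 : |∫ t in Ioi (R ^ 2), Real.exp (-ε * t) *
      ∑ k, rot (a * t) k i * stokesKernel (-y) t k j| ≤ 2 * C₃ * |a|⁻¹ := by
    simp only [hmain_eq]
    rw [integral_add (hi 0) (hi 1)]
    have q0 := h₃ ε a (R ^ 2) (-y) 0 i 0 j hε ha hR2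
    have q1 := h₃ ε a (R ^ 2) (-y) 1 i 1 j hε ha hR2
    refine (abs_add_le _ _).trans ?_
    have : (R ^ 2)⁻¹ ≤ 1 := inv_le_one_of_one_le₀ (by nlinarith)
    have : C₃ * |a|⁻¹ * (R ^ 2)⁻¹ ≤ C₃ * |a|⁻¹ * 1 := by gcongr
    linarith
  have hpow : (R ^ 2 + 0 ^ 2) ^ (-1 / 2 : ℝ) = R⁻¹ := by
    rw [zero_pow two_ne_zero, add_zero, ← Real.rpow_natCast, ← Real.rpow_mul (by positivity)]
    norm_num
    rw [Real.rpow_neg_one]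
  rw [hpow, mul_assoc, mul_inv_cancel₀ hR0.ne', mul_one] at b2
  set I₂ := ∫ t in Ioi (R ^ 2), resolventIntegrand ε a x y t i j
  set I₃ := ∫ t in Ioi (R ^ 2), Real.exp (-ε * t) *
      ∑ k, rot (a * t) k i * stokesKernel (-y) t k j
  have hsum : |I₂| ≤ |I₂ - I₃| + |I₃| := by
    have : I₂ = (I₂ - I₃) + I₃ := by ring
    conv_lhs => rw [this]
    exact abs_add_le _ _
  -- Since |y| ≥ R/2, a quantity of order one is paid for by the weight 1 + |y|, with a gain of R⁻¹.
  have h1 : 1 ≤ 2 * ((1 + ‖y‖) * R⁻¹) := by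
    rw [← div_eq_mul_inv, mul_div_assoc', one_le_div hR0]
    linarith
  calc |I₂| ≤ (4 * C₂ + 2 * C₃ * |a|⁻¹) * 1 := by linarith
    _ ≤ (4 * C₂ + 2 * C₃ * |a|⁻¹) * (2 * ((1 + ‖y‖) * R⁻¹)) := by gcongr
    _ ≤ ((4 * C₂ + 2 * C₃) * (1 + |a|⁻¹)) * (2 * ((1 + ‖y‖) * R⁻¹)) := by
      gcongr
      have := mul_pos hC₂ ha'
      nlinarith
    _ = _ := by ring

lemma lintegral_Ioc_rpow_neg_half {R : ℝ} (hR : 0 < R) :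
    ∫⁻ t in Ioc 0 (R ^ 2), ENNReal.ofReal (t ^ (-1 / 2 : ℝ)) = ENNReal.ofReal (2 * R) := by
  have hi : IntervalIntegrable (fun t : ℝ => t ^ (-1 / 2 : ℝ)) volume 0 (R ^ 2) :=
    intervalIntegral.intervalIntegrable_rpow' (by norm_num)
  rw [← ofReal_integral_eq_lintegral_ofReal
    ((intervalIntegrable_iff_integrableOn_Ioc_of_le (by positivity)).1 hi),
    ← intervalIntegral.integral_of_le (by positivity), integral_rpow (Or.inl (by norm_num))]
  · congr 1
    rw [show (-1 / 2 : ℝ) + 1 = 1 / 2 by norm_num, ← Real.sqrt_eq_rpow, ← Real.sqrt_eq_rpow,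
      Real.sqrt_sq hR.le, Real.sqrt_zero]
    ring
  · filter_upwards [ae_restrict_mem measurableSet_Ioc] with t ht
    exact Real.rpow_nonneg ht.1.le _

/-- The weighted decay condition controls the size of `f` where `|y| ≥ |x|/2`. -/
lemma enorm_le_of_weighted_decay {R : ℝ} (hR : Real.exp 1 ≤ R) {y v : Plane} {M : ℝ≥0∞}
    (hy : R / 2 ≤ ‖y‖) (hM : ENNReal.ofReal (‖y‖ ^ 3 * Real.log ‖y‖ * ‖v‖) ≤ M) :
    ‖v‖ₑ ≤ ENNReal.ofReal (32 / R ^ 3) * M := by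
  have hR0 : 0 < R := (Real.exp_pos 1).trans_le hR
  -- Here |y| ≥ e/2, so log|y| ≥ 1 - log 2 > 1/4. Only this lower bound of the logarithm enters;
  -- with |y|³ ≥ R³/8 it gives the constant 32.
  have hlog : 1 / 4 ≤ Real.log ‖y‖ := by
    have h1 : Real.log (R / 2) ≤ Real.log ‖y‖ := Real.log_le_log (by positivity) hy
    have h2 : 1 ≤ Real.log R := by
      rw [← Real.log_exp 1]; exact Real.log_le_log (Real.exp_pos 1) hR
    rw [Real.log_div hR0.ne' two_ne_zero] at h1
    linarith [Real.log_two_lt_d9]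
  refine le_trans ?_ (mul_le_mul_right hM _)
  rw [← ofReal_norm, ← ENNReal.ofReal_mul (by positivity)]
  refine ENNReal.ofReal_le_ofReal ?_
  have h3 : R ^ 3 / 8 ≤ ‖y‖ ^ 3 := by
    calc R ^ 3 / 8 = (R / 2) ^ 3 := by ring
      _ ≤ ‖y‖ ^ 3 := by gcongr
  have h4 : R ^ 3 / 32 ≤ ‖y‖ ^ 3 * Real.log ‖y‖ := by
    calc R ^ 3 / 32 = R ^ 3 / 8 * (1 / 4) := by ring
      _ ≤ _ := by gcongr
  have h5 : R ^ 3 / 32 * ‖v‖ ≤ ‖y‖ ^ 3 * Real.log ‖y‖ * ‖v‖ := by gcongr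
  calc ‖v‖ = 32 / R ^ 3 * (R ^ 3 / 32 * ‖v‖) := by field_simp
    _ ≤ _ := by gcongr

/-- Chebyshev's inequality: on the region of integration 1 ≤ (2/R)(1+|y|). -/
lemma lintegral_enorm_far_le {f : Plane → Plane} {R : ℝ} (hR : 0 < R)
    (hf : Integrable (fun y => (1 + ‖y‖) * ‖f y‖) volume) :
    ∫⁻ y in {y : Plane | R / 2 ≤ ‖y‖}, ‖f y‖ₑ ≤
      ENNReal.ofReal (2 / R) * ENNReal.ofReal (∫ y, (1 + ‖y‖) * ‖f y‖) := by
  rw [ofReal_integral_eq_lintegral_ofReal hf (Eventually.of_forall fun y => by positivity),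
    ← lintegral_const_mul' _ _ ENNReal.ofReal_ne_top]
  refine (setLIntegral_mono_ae' (measurableSet_le measurable_const measurable_norm)
    (Eventually.of_forall fun y hy => ?_)).trans (setLIntegral_le_lintegral _ _)
  rw [← ofReal_norm, ← ENNReal.ofReal_mul (by positivity)]
  refine ENNReal.ofReal_le_ofReal ?_
  have hy' : R / 2 ≤ ‖y‖ := hy
  have h1 : 1 ≤ 2 / R * (1 + ‖y‖) := by
    rw [div_mul_eq_mul_div, one_le_div hR]; linarith
  nlinarith [norm_nonneg (f y), mul_le_mul_of_nonneg_right h1 (norm_nonneg (f y))]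

/-- Contribution of `|y| ≥ |x|/2`, `t ≤ |x|²` to the resolvent potential. -/
lemma exists_lintegral_far_short_time_le : ∃ C : ℝ, 0 < C ∧ ∀ (ε a : ℝ) (x : Plane)
    (f : Plane → Plane) (M : ℝ≥0∞) (i j : Fin 2), 0 < ε → Real.exp 1 ≤ ‖x‖ →
    AEStronglyMeasurable f volume → Integrable (fun y => (1 + ‖y‖) * ‖f y‖) volume →
    (∀ᵐ y, ‖x‖ / 2 ≤ ‖y‖ → ENNReal.ofReal (‖y‖ ^ 3 * Real.log ‖y‖ * ‖f y‖) ≤ M) →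
    ∫⁻ y in {y : Plane | ‖x‖ / 2 ≤ ‖y‖}, ∫⁻ t in Ioc 0 (‖x‖ ^ 2),
      ‖resolventIntegrand ε a x y t i j‖ₑ * ‖f y‖ₑ ≤
      ENNReal.ofReal (C * ‖x‖⁻¹) * (ENNReal.ofReal (∫ y, (1 + ‖y‖) * ‖f y‖) + M) := by
  obtain ⟨C, hC, h⟩ := exists_resolventIntegrand_le
  set v := 2 * volume.real (Metric.ball (0 : Plane) 1) with hv
  have hv0 : 0 ≤ v := by positivity
  -- The inner ball gives Cv R · 32/R³ times ∫₀^(R²) t^(-1/2) dt = 2R, that is 64Cv/R. The exterior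
  -- gives C R⁻² · (2/R) times the time length R², that is 2C/R.
  refine ⟨C * (64 * v + 2), by positivity, fun ε a x f M i j hε hx hfm hf hM => ?_⟩
  set R := ‖x‖ with hR
  have hR0 : 0 < R := (Real.exp_pos 1).trans_le hx
  set m := ENNReal.ofReal (∫ y, (1 + ‖y‖) * ‖f y‖) with hm
  set S := {y : Plane | R / 2 ≤ ‖y‖} with hS
  have hSm : MeasurableSet S := measurableSet_le measurable_const measurable_norm
  rw [lintegral_lintegral_swap]
  swap
  · refine AEMeasurable.mul ?_ hfm.restrict.enorm.comp_fst
    exact ((measurable_resolventIntegrand ε a i j).comp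
      ((measurable_const.prodMk measurable_fst).prodMk measurable_snd)).enorm.aemeasurable
  have inner : ∀ t ∈ Ioc 0 (R ^ 2), ∫⁻ y in S, ‖resolventIntegrand ε a x y t i j‖ₑ * ‖f y‖ₑ ≤
      ENNReal.ofReal (C * v * R * (32 / R ^ 3)) * M * ENNReal.ofReal (t ^ (-1 / 2 : ℝ)) +
        ENNReal.ofReal (C * (R ^ 2)⁻¹ * (2 / R)) * m := by
    intro t ht
    have ht0 : 0 < t := ht.1
    set z := mulV (rot (a * t)) x with hz
    set B := {y : Plane | ‖z - y‖ < R} with hB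
    have hBm : MeasurableSet B := measurableSet_lt (by fun_prop) measurable_const
    have hexp : Real.exp (-ε * t) ≤ 1 := by
      rw [Real.exp_le_one_iff]; nlinarith
    have hRt : ∀ y, ‖resolventIntegrand ε a x y t i j‖ₑ ≤
        ENNReal.ofReal C * ENNReal.ofReal ((t + ‖z - y‖ ^ 2)⁻¹) := fun y => by
      rw [← ofReal_norm, ← ENNReal.ofReal_mul hC.le]
      refine ENNReal.ofReal_le_ofReal ((h ε a x y t i j ht0).trans ?_)
      gcongr
      exact mul_le_of_le_one_right hC.le hexp
    -- Within distance R of the rotated point the singularity is met by the pointwise decay of f;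
    -- beyond it the kernel is at most C R⁻² and the mass of f on S is used.
    have hpt : ∀ᵐ y, y ∈ S → ‖resolventIntegrand ε a x y t i j‖ₑ * ‖f y‖ₑ ≤
        ENNReal.ofReal C * ENNReal.ofReal (t ^ (-1 / 2 : ℝ)) *
          (ENNReal.ofReal (32 / R ^ 3) * M) * B.indicator (fun y => ‖z - y‖ₑ⁻¹) y +
        ENNReal.ofReal C * ENNReal.ofReal ((R ^ 2)⁻¹) * ‖f y‖ₑ := by
      filter_upwards [hM] with y hMy hyS
      by_cases hyB : y ∈ B
      · refine le_add_right ?_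
        rw [indicator_of_mem hyB]
        calc _ ≤ (ENNReal.ofReal C * (ENNReal.ofReal (t ^ (-1 / 2 : ℝ)) * ‖z - y‖ₑ⁻¹)) *
              (ENNReal.ofReal (32 / R ^ 3) * M) := by
              gcongr
              · exact (hRt y).trans (by gcongr; exact inv_add_sq_le ht0 _)
              · exact enorm_le_of_weighted_decay hx hyS (hMy hyS)
          _ = _ := by ring
      · refine le_add_left ?_
        gcongr
        refine (hRt y).trans ?_
        have hyB' : R ≤ ‖z - y‖ := not_lt.1 hyB
        gcongr
        nlinarith
    refine (setLIntegral_mono_ae' hSm hpt).trans ?_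
    rw [lintegral_add_left' ((AEMeasurable.const_mul (Measurable.aemeasurable
      ((by fun_prop : Measurable fun y : Plane => ‖z - y‖ₑ⁻¹).indicator hBm)) _))]
    refine add_le_add ?_ ?_
    · refine (setLIntegral_le_lintegral _ _).trans ?_
      rw [lintegral_const_mul _ ((by fun_prop : Measurable fun y : Plane =>
        ‖z - y‖ₑ⁻¹).indicator hBm), lintegral_indicator hBm,
        lintegral_inv_enorm_sub_ball hR0.le, ← hv]
      rw [ENNReal.ofReal_mul (by positivity : 0 ≤ C * v * R), mul_assoc C v R,
        ENNReal.ofReal_mul hC.le]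
      refine le_of_eq ?_
      ring
    · rw [lintegral_const_mul' _ _ (ENNReal.mul_ne_top ENNReal.ofReal_ne_top
        ENNReal.ofReal_ne_top), ENNReal.ofReal_mul (by positivity), ENNReal.ofReal_mul hC.le,
        mul_assoc _ (ENNReal.ofReal (2 / R))]
      gcongr
      exact lintegral_enorm_far_le hR0 hf
  refine (setLIntegral_mono' measurableSet_Ioc inner).trans ?_
  rw [lintegral_add_right _ measurable_const, lintegral_const_mul _ (by fun_prop),
    lintegral_Ioc_rpow_neg_half hR0, setLIntegral_const, Real.volume_Ioc, sub_zero]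
  calc _ = ENNReal.ofReal (C * (64 * v) * R⁻¹) * M + ENNReal.ofReal (C * 2 * R⁻¹) * m := by
        congr 1
        · rw [mul_right_comm, ← ENNReal.ofReal_mul (by positivity)]
          congr 2
          field_simp
          ring
        · rw [mul_right_comm, ← ENNReal.ofReal_mul (by positivity)]
          congr 2
          field_simp
    _ ≤ ENNReal.ofReal (C * (64 * v + 2) * R⁻¹) * M +
        ENNReal.ofReal (C * (64 * v + 2) * R⁻¹) * m := by
        gcongr
        · linarith
        · linarith
    _ = _ := by ring

/-- Where |y| ≥ |x|/2, only the late times are estimated pointwise in y. The early times have no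
bound uniform near y = x, so they stay a double integral against f. -/
lemma exists_lintegral_resolventKernel_far_le : ∃ C : ℝ, 0 < C ∧ ∀ (ε a : ℝ) (x : Plane)
    (f : Plane → Plane) (M : ℝ≥0∞) (i j : Fin 2), 0 < ε → a ≠ 0 → Real.exp 1 ≤ ‖x‖ →
    AEStronglyMeasurable f volume → Integrable (fun y => (1 + ‖y‖) * ‖f y‖) volume →
    (∀ᵐ y, ‖x‖ / 2 ≤ ‖y‖ → ENNReal.ofReal (‖y‖ ^ 3 * Real.log ‖y‖ * ‖f y‖) ≤ M) →
    ∫⁻ y, ‖resolventKernel ε a x y i j * f y j‖ₑ ≤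
      ENNReal.ofReal (C * (1 + |a|⁻¹) * ‖x‖⁻¹) *
        (ENNReal.ofReal (∫ y, (1 + ‖y‖) * ‖f y‖) + M) := by
  obtain ⟨C₁, hC₁, h₁⟩ := exists_resolventKernel_near_le
  obtain ⟨C₂, hC₂, h₂⟩ := exists_integral_resolventIntegrand_far_le
  obtain ⟨C₃, hC₃, h₃⟩ := exists_lintegral_far_short_time_le
  refine ⟨C₁ + C₂ + C₃, by positivity, fun ε a x f M i j hε ha hx hfm hf hM => ?_⟩
  have ha' : 0 < |a|⁻¹ := by positivity
  have hx1 : 1 ≤ ‖x‖ := by linarith [Real.add_one_le_exp (1 : ℝ)]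
  have hR0 : 0 < ‖x‖ := by linarith
  set S := {y : Plane | ‖x‖ / 2 ≤ ‖y‖} with hS
  have hSm : MeasurableSet S := measurableSet_le measurable_const measurable_norm
  set c := (C₁ + C₂) * (1 + |a|⁻¹) * ‖x‖⁻¹ with hc
  have hc0 : 0 ≤ c := by positivity
  have hpt : ∀ᵐ y, ‖resolventKernel ε a x y i j * f y j‖ₑ ≤
      ENNReal.ofReal c * ENNReal.ofReal ((1 + ‖y‖) * ‖f y‖) +
        S.indicator (fun y => ∫⁻ t in Ioc 0 (‖x‖ ^ 2),
          ‖resolventIntegrand ε a x y t i j‖ₑ * ‖f y‖ₑ) y := by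
    filter_upwards [ae_ne x] with y hy
    rw [enorm_mul]
    refine (mul_le_mul_right (enorm_coord_le (f y) j) _).trans ?_
    have key : ‖resolventKernel ε a x y i j‖ₑ ≤ ENNReal.ofReal (c * (1 + ‖y‖)) +
        S.indicator (fun y => ∫⁻ t in Ioc 0 (‖x‖ ^ 2), ‖resolventIntegrand ε a x y t i j‖ₑ) y := by
      by_cases hyS : y ∈ S
      · rw [indicator_of_mem hyS, add_comm]
        have hR2 : (0 : ℝ) ≤ ‖x‖ ^ 2 := by positivity
        have hint := integrableOn_resolventIntegrand hε a (Ne.symm hy) i j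
        rw [resolventKernel_apply, ← Ioc_union_Ioi_eq_Ioi hR2, setIntegral_union
          Ioc_disjoint_Ioi_same measurableSet_Ioi (hint.mono_set Ioc_subset_Ioi_self)
          (hint.mono_set (Ioi_subset_Ioi hR2))]
        refine (enorm_add_le _ _).trans (add_le_add (enorm_integral_le_lintegral_enorm _) ?_)
        rw [← ofReal_norm]
        refine ENNReal.ofReal_le_ofReal ((h₂ ε a x y i j hε ha hx1 hyS).trans ?_)
        rw [hc, mul_right_comm]
        gcongr
        linarith
      · rw [indicator_of_notMem hyS, add_zero, ← ofReal_norm]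
        refine ENNReal.ofReal_le_ofReal ((h₁ ε a x y i j hε ha hx1 (not_le.1 hyS)).trans ?_)
        rw [hc, mul_right_comm]
        gcongr
        linarith
    refine (mul_le_mul_left key _).trans ?_
    rw [add_mul]
    refine add_le_add (le_of_eq ?_) (le_of_eq ?_)
    · rw [← ofReal_norm (f y), ← ENNReal.ofReal_mul (by positivity), ← ENNReal.ofReal_mul hc0,
        mul_assoc]
    · by_cases hyS : y ∈ S
      · rw [indicator_of_mem hyS, indicator_of_mem hyS, lintegral_mul_const' _ _ enorm_ne_top]
      · rw [indicator_of_notMem hyS, indicator_of_notMem hyS, zero_mul]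
  refine (lintegral_mono_ae hpt).trans ?_
  rw [lintegral_add_left' (hf.aestronglyMeasurable.aemeasurable.ennreal_ofReal.const_mul _),
    lintegral_indicator hSm, lintegral_const_mul' _ _ ENNReal.ofReal_ne_top,
    ← ofReal_integral_eq_lintegral_ofReal hf (Eventually.of_forall fun y => by positivity)]
  set m := ENNReal.ofReal (∫ y, (1 + ‖y‖) * ‖f y‖) with hm
  calc _ ≤ ENNReal.ofReal c * (m + M) + ENNReal.ofReal (C₃ * ‖x‖⁻¹) * (m + M) := by
        gcongr
        · exact le_self_add
        · exact h₃ ε a x f M i j hε hx hfm hf hM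
    _ = ENNReal.ofReal (c + C₃ * ‖x‖⁻¹) * (m + M) := by
        rw [← add_mul, ← ENNReal.ofReal_add hc0 (by positivity)]
    _ ≤ _ := by
        gcongr
        rw [hc]
        have : 0 ≤ C₃ * |a|⁻¹ * ‖x‖⁻¹ := by positivity
        nlinarith

lemma enorm_le_sum_coord (v : Plane) : ‖v‖ₑ ≤ ‖v 0‖ₑ + ‖v 1‖ₑ := by
  have h : v = EuclideanSpace.single 0 (v 0) + EuclideanSpace.single 1 (v 1) := by
    ext i; fin_cases i <;> simp
  rw [← ofReal_norm, ← ofReal_norm, ← ofReal_norm, ← ENNReal.ofReal_add (norm_nonneg _)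
    (norm_nonneg _)]
  refine ENNReal.ofReal_le_ofReal ?_
  conv_lhs => rw [h]
  refine (norm_add_le _ _).trans (le_of_eq ?_)
  rw [PiLp.norm_single, PiLp.norm_single]

lemma integrable_one_add_norm_mul {f : Plane → Plane} (h1 : MemLp f 1 volume)
    (hm : Integrable (fun x => ‖x‖ * ‖f x‖) volume) :
    Integrable (fun y => (1 + ‖y‖) * ‖f y‖) volume := by
  simp only [add_mul, one_mul]
  exact (memLp_one_iff_integrable.1 h1).norm.add hm

/-- The far-field bound for the resolvent potential. -/
lemma exists_iSup_resolventPotential_le : ∃ C : ℝ, 0 < C ∧ ∀ (ε a ρ : ℝ) (f : Plane → Plane),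
    0 < ε → a ≠ 0 → Real.exp 1 ≤ ρ → MemLp f 1 volume → MemLp f ∞ volume →
    Integrable (fun x => ‖x‖ * ‖f x‖) volume →
    (⨆ (x : Plane) (_ : ρ ≤ ‖x‖), ENNReal.ofReal (‖x‖ * ‖resolventPotential ε a f x‖))
      ≤ ENNReal.ofReal (C * (1 + |a|⁻¹)) *
        (ENNReal.ofReal (∫ x, (1 + ‖x‖) * ‖f x‖) +
          essSup (fun x => ENNReal.ofReal (‖x‖ ^ 3 * Real.log ‖x‖ * ‖f x‖))
            (volume.restrict {x : Plane | ρ / 2 ≤ ‖x‖})) := by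
  obtain ⟨C, hC, h⟩ := exists_lintegral_resolventKernel_far_le
  -- A factor 2 for the two columns in each coordinate of u, and a factor 2 for the two coordinates.
  refine ⟨4 * C, by positivity, fun ε a ρ f hε ha hρ h1 htop hm => iSup₂_le fun x hx => ?_⟩
  set M := essSup (fun x => ENNReal.ofReal (‖x‖ ^ 3 * Real.log ‖x‖ * ‖f x‖))
            (volume.restrict {x : Plane | ρ / 2 ≤ ‖x‖}) with hMdef
  have ha' : 0 < |a|⁻¹ := by positivity
  have hR0 : 0 < ‖x‖ := (Real.exp_pos 1).trans_le (hρ.trans hx)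
  have hM : ∀ᵐ y, ‖x‖ / 2 ≤ ‖y‖ → ENNReal.ofReal (‖y‖ ^ 3 * Real.log ‖y‖ * ‖f y‖) ≤ M := by
    have h2 := (ae_restrict_iff' (measurableSet_le measurable_const measurable_norm)).1
      (ENNReal.ae_le_essSup (μ := volume.restrict {x : Plane | ρ / 2 ≤ ‖x‖})
        (fun x => ENNReal.ofReal (‖x‖ ^ 3 * Real.log ‖x‖ * ‖f x‖)))
    filter_upwards [h2] with y hy hxy
    exact hy (show ρ / 2 ≤ ‖y‖ by linarith)
  have hb := fun i j => h ε a x f M i j hε ha (hρ.trans hx) h1.1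
    (integrable_one_add_norm_mul h1 hm) hM
  set m := ENNReal.ofReal (∫ y, (1 + ‖y‖) * ‖f y‖) with hmdef
  have hu : ∀ i, ‖resolventPotential ε a f x i‖ₑ ≤
      2 * (ENNReal.ofReal (C * (1 + |a|⁻¹) * ‖x‖⁻¹) * (m + M)) := fun i => by
    rw [resolventPotential_apply hε a h1 htop, Fin.sum_univ_two, two_mul]
    refine (enorm_add_le _ _).trans (add_le_add ?_ ?_)
    · exact (enorm_integral_le_lintegral_enorm _).trans (hb i 0)
    · exact (enorm_integral_le_lintegral_enorm _).trans (hb i 1)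
  rw [ENNReal.ofReal_mul hR0.le, ofReal_norm (resolventPotential ε a f x)]
  calc ENNReal.ofReal ‖x‖ * ‖resolventPotential ε a f x‖ₑ ≤
      ENNReal.ofReal ‖x‖ * (2 * (ENNReal.ofReal (C * (1 + |a|⁻¹) * ‖x‖⁻¹) * (m + M)) +
        2 * (ENNReal.ofReal (C * (1 + |a|⁻¹) * ‖x‖⁻¹) * (m + M))) := by
        gcongr
        exact (enorm_le_sum_coord _).trans (add_le_add (hu 0) (hu 1))
    _ = ENNReal.ofReal 4 * (ENNReal.ofReal ‖x‖ * ENNReal.ofReal (C * (1 + |a|⁻¹) * ‖x‖⁻¹)) *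
        (m + M) := by
        rw [show ENNReal.ofReal 4 = 4 by norm_num]; ring
    _ = _ := by
        have e : 4 * (‖x‖ * (C * (1 + |a|⁻¹) * ‖x‖⁻¹)) = 4 * C * (1 + |a|⁻¹) := by field_simp
        rw [← ENNReal.ofReal_mul hR0.le, ← ENNReal.ofReal_mul (by norm_num), e]

/-! ### Duality: moving the resolvent potential onto the test field -/

lemma mulV_rot_mulV_rot_neg (θ : ℝ) (x : Plane) : mulV (rot θ) (mulV (rot (-θ)) x) = x :=
  (rotIso θ).apply_symm_apply x

/-- Rotations are isometries, so the bounds on the integrand may be centred at a rotated y instead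
of a rotated x. This permits integration in x. -/
lemma norm_mulV_rot_sub (θ : ℝ) (x y : Plane) :
    ‖mulV (rot θ) x - y‖ = ‖mulV (rot (-θ)) y - x‖ := by
  have h : mulV (rot θ) x - y = -(rotIso θ (mulV (rot (-θ)) y - x)) := by
    rw [map_sub, rotIso_apply, rotIso_apply, mulV_rot_mulV_rot_neg]
    abel
  rw [h, norm_neg, LinearIsometryEquiv.norm_map]

lemma exists_lintegral_resolventIntegrand_mul_le_dual {F : Type*} [NormedAddCommGroup F]
    {ε : ℝ} (hε : 0 < ε) {g : Plane → F}
    (h1 : MemLp g 1 volume) (htop : MemLp g ∞ volume) :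
    ∃ N : ℝ≥0∞, N ≠ ⊤ ∧ ∀ (a : ℝ) (y : Plane) (i j : Fin 2),
      ∫⁻ x, ∫⁻ t in Ioi (0 : ℝ), ‖resolventIntegrand ε a x y t i j‖ₑ * ‖g x‖ₑ ≤ N := by
  obtain ⟨N, hN, h⟩ := exists_lintegral_inv_enorm_mul_le h1 htop
  obtain ⟨C, hC, hR⟩ := exists_enorm_resolventIntegrand_le
  refine ⟨(∫⁻ t in Ioi (0 : ℝ), ENNReal.ofReal (C * Real.exp (-ε * t) * t ^ (-1 / 2 : ℝ))) * N,
    ENNReal.mul_ne_top (lintegral_exp_rpow_lt_top hε C).ne hN, fun a y i j => ?_⟩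
  rw [lintegral_lintegral_swap]
  · rw [← lintegral_mul_const _ (by fun_prop)]
    refine setLIntegral_mono_ae' measurableSet_Ioi (Eventually.of_forall fun t ht => ?_)
    calc _ ≤ ∫⁻ x, ENNReal.ofReal (C * Real.exp (-ε * t) * t ^ (-1 / 2 : ℝ)) *
          (‖mulV (rot (-(a * t))) y - x‖ₑ⁻¹ * ‖g x‖ₑ) := by
          refine lintegral_mono fun x => ?_
          rw [← mul_assoc]
          gcongr
          refine (hR ε a x y t i j ht).trans_eq ?_
          rw [← ofReal_norm, ← ofReal_norm, norm_mulV_rot_sub]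
      _ ≤ _ := by
          rw [lintegral_const_mul' _ _ ENNReal.ofReal_ne_top]
          gcongr
          exact h _
  · refine AEMeasurable.mul ?_ h1.1.enorm.comp_fst
    exact ((measurable_resolventIntegrand ε a i j).comp
      ((measurable_fst.prodMk measurable_const).prodMk measurable_snd)).enorm.aemeasurable

lemma memLp_of_continuous_of_hasCompactSupport {F : Type*} [NormedAddCommGroup F]
    {g : Plane → F} (hg : Continuous g) (hc : HasCompactSupport g) (p : ℝ≥0∞) :
    MemLp g p volume := hg.memLp_of_hasCompactSupport hc

lemma integrable_resolventIntegrand_mul_prod {ε : ℝ} (hε : 0 < ε) (a : ℝ) {g : Plane → ℝ}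
    (hg : Continuous g) (hc : HasCompactSupport g) (y : Plane) (i j : Fin 2) :
    Integrable (fun p : Plane × ℝ => resolventIntegrand ε a p.1 y p.2 i j * g p.1)
      (volume.prod (volume.restrict (Ioi 0))) := by
  obtain ⟨N, hN, h⟩ := exists_lintegral_resolventIntegrand_mul_le_dual hε
    (memLp_of_continuous_of_hasCompactSupport hg hc 1)
    (memLp_of_continuous_of_hasCompactSupport hg hc ⊤)
  have hm : Measurable (fun p : Plane × ℝ => resolventIntegrand ε a p.1 y p.2 i j * g p.1) :=
    ((measurable_resolventIntegrand ε a i j).comp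
      ((measurable_fst.prodMk measurable_const).prodMk measurable_snd)).mul
      (hg.measurable.comp measurable_fst)
  refine ⟨hm.aestronglyMeasurable, ?_⟩
  rw [HasFiniteIntegral, lintegral_prod _ hm.enorm.aemeasurable]
  simp only [enorm_mul]
  exact (h a y i j).trans_lt hN.lt_top

/-- The adjoint of the resolvent potential, applied to a test field `ψ`. -/
def adjointPotential (ε a : ℝ) (ψ : Plane → Plane) (y : Plane) (j : Fin 2) : ℝ :=
  ∑ i, ∫ x, resolventKernel ε a x y i j * ψ x i

/-- The time slices of the adjoint potential, after rotating the test field. -/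
def adjointSlice (ε a : ℝ) (ψ : Plane → Plane) (y : Plane) (j : Fin 2) (t : ℝ) : ℝ :=
  Real.exp (-ε * t) * ∑ k, ∫ w, stokesKernel w t j k *
    mulV (rot (a * t)) (ψ (mulV (rot (-(a * t))) (w + y))) k

lemma continuous_coord {ψ : Plane → Plane} (h : Continuous ψ) (i : Fin 2) :
    Continuous (fun x => ψ x i) := (EuclideanSpace.proj i : Plane →L[ℝ] ℝ).continuous.comp h

lemma hasCompactSupport_coord {ψ : Plane → Plane} (h : HasCompactSupport ψ) (i : Fin 2) :
    HasCompactSupport (fun x => ψ x i) :=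
  h.comp_left (g := fun v : Plane => v i) rfl

lemma hasCompactSupport_rot_shift {F : Type*} [Zero F] {ψ : Plane → F} (h : HasCompactSupport ψ)
    (θ : ℝ) (y : Plane) : HasCompactSupport (fun w => ψ (mulV (rot θ) (w + y))) :=
  h.comp_homeomorph ((Homeomorph.addRight y).trans (rotIso θ).toHomeomorph)

/-- Change of variables w = O(at)x - y, which preserves measure. The factor O(at)ᵀ passes to the
test field as O(at), and the symmetry of K exchanges its indices. -/
lemma sum_integral_resolventIntegrand_mul {ε a : ℝ} {ψ : Plane → Plane}
    (hψ : Continuous ψ) (hc : HasCompactSupport ψ) (y : Plane) (j : Fin 2) {t : ℝ} (ht : 0 < t) :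
    ∑ i, ∫ x, resolventIntegrand ε a x y t i j * ψ x i = adjointSlice ε a ψ y j t := by
  have hrot : Continuous (mulV (rot (a * t))) := (rotIso (a * t)).continuous
  have hrot' : Continuous (mulV (rot (-(a * t)))) := (rotIso (-(a * t))).continuous
  obtain ⟨M, -, hM⟩ := exists_kernel_bounds ht
  have hi : ∀ i k, Integrable (fun x => stokesKernel (mulV (rot (a * t)) x - y) t k j * ψ x i) :=
    fun i k => integrable_bdd_mul ((measurable_stokesKernel k j).comp
      ((hrot.sub continuous_const).measurable.prodMk measurable_const))
      (fun x => (hM _ k j).2.2.2.1) (continuous_coord hψ i) (hasCompactSupport_coord hc i)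
  have e1 : ∀ k, ∫ w, stokesKernel w t j k *
      mulV (rot (a * t)) (ψ (mulV (rot (-(a * t))) (w + y))) k =
      ∫ x, stokesKernel (mulV (rot (a * t)) x - y) t k j * mulV (rot (a * t)) (ψ x) k := by
    intro k
    rw [← (rotIso (-(a * t))).measurePreserving.integral_comp
      (rotIso (-(a * t))).toHomeomorph.measurableEmbedding
      (fun x => stokesKernel (mulV (rot (a * t)) x - y) t k j * mulV (rot (a * t)) (ψ x) k),
      ← integral_add_right_eq_self (fun w => stokesKernel
        (mulV (rot (a * t)) (rotIso (-(a * t)) w) - y) t k j *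
        mulV (rot (a * t)) (ψ (rotIso (-(a * t)) w)) k) y]
    refine integral_congr_ae (Eventually.of_forall fun w => ?_)
    simp only [rotIso_apply, mulV_rot_mulV_rot_neg, add_sub_cancel_right]
    rw [stokesKernel_symm]
  rw [adjointSlice]
  simp only [e1]
  simp only [resolventIntegrand_apply, mulV_apply (rot (a * t)) (ψ _), Fin.sum_univ_two,
    mul_add, add_mul]
  have e2 : ∀ i, (fun x => Real.exp (-ε * t) *
      (rot (a * t) 0 i * stokesKernel (mulV (rot (a * t)) x - y) t 0 j) * ψ x i +
      Real.exp (-ε * t) *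
      (rot (a * t) 1 i * stokesKernel (mulV (rot (a * t)) x - y) t 1 j) * ψ x i) = fun x =>
      (Real.exp (-ε * t) * rot (a * t) 0 i) *
        (stokesKernel (mulV (rot (a * t)) x - y) t 0 j * ψ x i) +
      (Real.exp (-ε * t) * rot (a * t) 1 i) *
        (stokesKernel (mulV (rot (a * t)) x - y) t 1 j * ψ x i) := fun i => by
    ext x; ring
  have e3 : ∀ k, (fun x => stokesKernel (mulV (rot (a * t)) x - y) t k j *
      (rot (a * t) k 0 * ψ x 0) + stokesKernel (mulV (rot (a * t)) x - y) t k j *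
      (rot (a * t) k 1 * ψ x 1)) = fun x =>
      rot (a * t) k 0 * (stokesKernel (mulV (rot (a * t)) x - y) t k j * ψ x 0) +
      rot (a * t) k 1 * (stokesKernel (mulV (rot (a * t)) x - y) t k j * ψ x 1) := fun k => by
    ext x; ring
  simp only [e2, e3]
  rw [integral_add ((hi 0 0).const_mul _) ((hi 0 1).const_mul _),
    integral_add ((hi 1 0).const_mul _) ((hi 1 1).const_mul _),
    integral_add ((hi 0 0).const_mul _) ((hi 1 0).const_mul _),
    integral_add ((hi 0 1).const_mul _) ((hi 1 1).const_mul _)]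
  simp only [integral_const_mul]
  ring

lemma integrableOn_adjointSlice {ε : ℝ} (hε : 0 < ε) (a : ℝ) {ψ : Plane → Plane}
    (hψ : Continuous ψ) (hc : HasCompactSupport ψ) (y : Plane) (j : Fin 2) :
    IntegrableOn (adjointSlice ε a ψ y j) (Ioi 0) := by
  have hi := fun i => (integrable_resolventIntegrand_mul_prod hε a (continuous_coord hψ i)
    (hasCompactSupport_coord hc i) y i j).integral_prod_right
  refine IntegrableOn.congr_fun (integrable_finsetSum Finset.univ fun i _ => hi i)
    (fun t ht => ?_) measurableSet_Ioi
  exact sum_integral_resolventIntegrand_mul hψ hc y j ht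

lemma adjointPotential_eq_integral {ε : ℝ} (hε : 0 < ε) (a : ℝ) {ψ : Plane → Plane}
    (hψ : Continuous ψ) (hc : HasCompactSupport ψ) (y : Plane) (j : Fin 2) :
    adjointPotential ε a ψ y j = ∫ t in Ioi 0, adjointSlice ε a ψ y j t := by
  have hi := fun i => integrable_resolventIntegrand_mul_prod hε a (continuous_coord hψ i)
    (hasCompactSupport_coord hc i) y i j
  rw [← setIntegral_congr_fun measurableSet_Ioi
    (fun t ht => sum_integral_resolventIntegrand_mul hψ hc y j ht),
    integral_finsetSum _ fun i _ => (hi i).integral_prod_right, adjointPotential]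
  refine Finset.sum_congr rfl fun i _ => ?_
  rw [← integral_integral_swap (f := fun x t => resolventIntegrand ε a x y t i j * ψ x i) (hi i)]
  refine integral_congr_ae (Eventually.of_forall fun x => ?_)
  simp only [resolventKernel_apply]
  rw [integral_mul_const]

lemma integrable_resolventKernel_mul_mul_prod {ε : ℝ} (hε : 0 < ε) (a : ℝ) {f : Plane → Plane}
    (h1 : MemLp f 1 volume) (htop : MemLp f ∞ volume) {g : Plane → ℝ}
    (hg : Continuous g) (hc : HasCompactSupport g) (i j : Fin 2) :
    Integrable (fun p : Plane × Plane => resolventKernel ε a p.1 p.2 i j * f p.2 j * g p.1)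
      (volume.prod volume) := by
  obtain ⟨N, hN, h⟩ := exists_lintegral_resolventKernel_mul_le hε h1 htop
  have hm : AEStronglyMeasurable
      (fun p : Plane × Plane => resolventKernel ε a p.1 p.2 i j * f p.2 j * g p.1)
      (volume.prod volume) :=
    (aestronglyMeasurable_resolventKernel_mul ε a h1 i j).mul
      (hg.comp continuous_fst).aestronglyMeasurable
  refine ⟨hm, ?_⟩
  rw [HasFiniteIntegral, lintegral_prod _ hm.enorm]
  calc _ ≤ ∫⁻ x, N * ‖g x‖ₑ := by
        refine lintegral_mono fun x => ?_
        simp only [enorm_mul (resolventKernel ε a x _ i j * _)]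
        rw [lintegral_mul_const' _ _ enorm_ne_top]
        gcongr
        exact h a x i j
    _ < ⊤ := by
        rw [lintegral_const_mul' _ _ hN]
        exact ENNReal.mul_lt_top hN.lt_top (hg.integrable_of_hasCompactSupport hc).2

lemma integrable_mul_adjointPotential {ε : ℝ} (hε : 0 < ε) (a : ℝ) {f ψ : Plane → Plane}
    (h1 : MemLp f 1 volume) (htop : MemLp f ∞ volume)
    (hψ : Continuous ψ) (hc : HasCompactSupport ψ) (j : Fin 2) :
    Integrable (fun y => f y j * adjointPotential ε a ψ y j) := by
  have hi := fun i => (integrable_resolventKernel_mul_mul_prod hε a h1 htop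
    (continuous_coord hψ i) (hasCompactSupport_coord hc i) i j).integral_prod_right
  refine (integrable_finsetSum Finset.univ fun i _ => hi i).congr
    (Eventually.of_forall fun y => ?_)
  simp only [adjointPotential, Finset.mul_sum]
  refine Finset.sum_congr rfl fun i _ => ?_
  rw [← integral_const_mul]
  congr 1
  ext x
  ring

/-- Fubini, justified by the bound on ∫|Γ||f| dy, uniform in x, and the integrability of ψ. -/
lemma integral_inner_resolventPotential {ε : ℝ} (hε : 0 < ε) (a : ℝ) {f ψ : Plane → Plane}
    (h1 : MemLp f 1 volume) (htop : MemLp f ∞ volume)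
    (hψ : Continuous ψ) (hc : HasCompactSupport ψ) :
    ∫ x, inner ℝ (resolventPotential ε a f x) (ψ x) =
      ∑ j, ∫ y, f y j * adjointPotential ε a ψ y j := by
  have hi := fun i j => integrable_resolventKernel_mul_mul_prod hε a h1 htop
    (continuous_coord hψ i) (hasCompactSupport_coord hc i) i j
  have e1 : ∀ x, inner ℝ (resolventPotential ε a f x) (ψ x) =
      ∑ i, ∑ j, ∫ y, resolventKernel ε a x y i j * f y j * ψ x i := fun x => by
    rw [PiLp.inner_apply]
    refine Finset.sum_congr rfl fun i _ => ?_
    rw [RCLike.inner_apply, conj_trivial, resolventPotential_apply hε a h1 htop, mul_comm,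
      Finset.sum_mul]
    exact Finset.sum_congr rfl fun j _ => (integral_mul_const _ _).symm
  have e2 : ∀ j y, f y j * adjointPotential ε a ψ y j =
      ∑ i, ∫ x, resolventKernel ε a x y i j * f y j * ψ x i := fun j y => by
    simp only [adjointPotential, Finset.mul_sum]
    refine Finset.sum_congr rfl fun i _ => ?_
    rw [← integral_const_mul]
    congr 1
    ext x
    ring
  simp only [e1, e2]
  rw [integral_finsetSum _ fun i _ => integrable_finsetSum _ fun j _ =>
    (hi i j).integral_prod_left, Finset.sum_congr rfl fun i _ => integral_finsetSum _
    fun j _ => (hi i j).integral_prod_left, Finset.sum_comm]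
  refine Finset.sum_congr rfl fun j _ => ?_
  rw [integral_finsetSum _ fun i _ => (hi i j).integral_prod_right]
  refine Finset.sum_congr rfl fun i _ => ?_
  exact integral_integral_swap (hi i j)

/-! ### Rotated test fields -/

/-- `O(θ) φ(O(θ)ᵀ z)`. -/
def rotField (θ : ℝ) (φ : Plane → Plane) (z : Plane) : Plane :=
  mulV (rot θ) (φ (mulV (rot (-θ)) z))

lemma contDiff_rotField {φ : Plane → Plane} (hφ : ContDiff ℝ ∞ φ) (θ : ℝ) :
    ContDiff ℝ ∞ (rotField θ φ) :=
  (rotIso θ).contDiff.comp (hφ.comp (rotIso (-θ)).contDiff)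

lemma continuous_rotField {φ : Plane → Plane} (hφ : Continuous φ) (θ : ℝ) :
    Continuous (rotField θ φ) :=
  (rotIso θ).continuous.comp (hφ.comp (rotIso (-θ)).continuous)

lemma contDiff_coord {φ : Plane → Plane} (hφ : ContDiff ℝ ∞ φ) (k : Fin 2) :
    ContDiff ℝ ∞ (fun x => φ x k) :=
  (EuclideanSpace.proj k : Plane →L[ℝ] ℝ).contDiff.comp hφ

lemma hasCompactSupport_rotField {φ : Plane → Plane} (hc : HasCompactSupport φ) (θ : ℝ) :
    HasCompactSupport (rotField θ φ) :=
  (hc.comp_homeomorph (rotIso (-θ)).toHomeomorph).comp_left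
    (g := mulV (rot θ)) (map_zero (rotIso θ))

lemma hasCompactSupport_shift {F : Type*} [Zero F] {χ : Plane → F} (hc : HasCompactSupport χ)
    (y : Plane) : HasCompactSupport (fun w => χ (w + y)) :=
  hc.comp_homeomorph (Homeomorph.addRight y)

lemma norm_rotField (θ : ℝ) (φ : Plane → Plane) (z : Plane) :
    ‖rotField θ φ z‖ = ‖φ (mulV (rot (-θ)) z)‖ := norm_mulV_rot _ _

lemma partialD_shift (χ : Plane → ℝ) (y : Plane) (k : Fin 2) :
    partialD k (fun w => χ (w + y)) = fun w => partialD k χ (w + y) := by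
  ext w
  rw [partialD, fderiv_comp_add_right]
  rfl

lemma perp_eq_rotIso (x : Plane) : perp x = rotIso (Real.pi / 2) x := perp_eq_mulV_rot x

lemma perp_perp (x : Plane) : perp (perp x) = -x := by
  ext i; fin_cases i <;> simp [perp]

lemma laplacian_coord_eq {φ : Plane → Plane} (hφ : ContDiff ℝ ∞ φ) (z : Plane) (k : Fin 2) :
    Laplacian.laplacian φ z k = ∑ l, partialD l (partialD l (fun x => φ x k)) z := by
  have h2 : ContDiffAt ℝ 2 φ z := (hφ.of_le (by exact WithTop.coe_le_coe.2 le_top)).contDiffAt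
  have h3 := h2.laplacian_CLM_comp_left (l := (EuclideanSpace.proj k : Plane →L[ℝ] ℝ))
  have h4 : (EuclideanSpace.proj k : Plane →L[ℝ] ℝ) ∘ φ = fun x => φ x k := rfl
  rw [h4] at h3
  have h5 : Laplacian.laplacian φ z k =
    ((EuclideanSpace.proj k : Plane →L[ℝ] ℝ) ∘ Laplacian.laplacian φ) z := rfl
  rw [h5, ← h3, InnerProductSpace.laplacian_eq_iteratedFDeriv_orthonormalBasis _
    (EuclideanSpace.basisFun (Fin 2) ℝ)]
  refine Finset.sum_congr rfl fun l _ => ?_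
  have hd : DifferentiableAt ℝ (fderiv ℝ (fun x => φ x k)) z :=
    (((contDiff_coord hφ k).fderiv_right (m := ∞) (by simp)).differentiable (by simp)) z
  rw [iteratedFDeriv_two_apply]
  unfold partialD
  rw [fderiv_clm_apply hd (differentiableAt_const _)]
  simp

lemma laplacian_rotField {φ : Plane → Plane} (hφ : ContDiff ℝ ∞ φ) (θ : ℝ) (z : Plane) :
    Laplacian.laplacian (rotField θ φ) z = rotField θ (Laplacian.laplacian φ) z := by
  have h2 : ContDiff ℝ 2 φ := hφ.of_le (by exact WithTop.coe_le_coe.2 le_top)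
  have e1 : rotField θ φ = (rotIso θ).toContinuousLinearEquiv ∘
      (φ ∘ ((rotIso (-θ)).toContinuousLinearEquiv : Plane →L[ℝ] Plane)) := rfl
  rw [e1, InnerProductSpace.laplacian_CLE_comp_left, rotField]
  have e2 : Laplacian.laplacian
      (φ ∘ ((rotIso (-θ)).toContinuousLinearEquiv : Plane →L[ℝ] Plane)) z =
      Laplacian.laplacian φ (mulV (rot (-θ)) z) := by
    -- The Laplacian may be computed in any orthonormal basis: the standard one on the left, its
    -- rotated image on the right.
    rw [InnerProductSpace.laplacian_eq_iteratedFDeriv_orthonormalBasis _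
      (EuclideanSpace.basisFun (Fin 2) ℝ),
      InnerProductSpace.laplacian_eq_iteratedFDeriv_orthonormalBasis _
      ((EuclideanSpace.basisFun (Fin 2) ℝ).map (rotIso (-θ)))]
    refine Finset.sum_congr rfl fun l _ => ?_
    rw [ContinuousLinearMap.iteratedFDeriv_comp_right _ h2 _ le_rfl,
      ContinuousMultilinearMap.compContinuousLinearMap_apply]
    congr 1
    ext m
    fin_cases m <;> rfl
  rw [Function.comp_apply, e2]
  rfl

/-- The generator of the rotation acting on vector fields, `a (φ^⊥ - x^⊥·∇φ)`. -/
def rotGenerator (a : ℝ) (φ : Plane → Plane) (x : Plane) : Plane :=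
  a • (perp (φ x) - fderiv ℝ φ x (perp x))

lemma continuous_perp : Continuous perp := by
  have : perp = rotIso (Real.pi / 2) := funext perp_eq_rotIso
  rw [this]; exact (rotIso _).continuous

lemma continuous_rotGenerator {φ : Plane → Plane} (hφ : ContDiff ℝ ∞ φ) (a : ℝ) :
    Continuous (rotGenerator a φ) := by
  refine (Continuous.sub (continuous_perp.comp hφ.continuous) ?_).const_smul a
  exact ((hφ.fderiv_right (m := ∞) (by simp)).continuous).clm_apply continuous_perp

lemma hasCompactSupport_rotGenerator {φ : Plane → Plane} (hc : HasCompactSupport φ) (a : ℝ) :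
    HasCompactSupport (rotGenerator a φ) := by
  refine hc.mono' ?_
  intro x hx
  by_contra h
  refine hx ?_
  have h1 : φ x = 0 := image_eq_zero_of_notMem_tsupport h
  have h2 : fderiv ℝ φ x = 0 := by
    by_contra h3
    exact h (support_fderiv_subset ℝ h3)
  simp [rotGenerator, h1, h2, perp_eq_rotIso]

/-- Write O(at) = cos(at) + sin(at) J with J² = -1. The outer rotation contributes aJ and the inner
point moves with velocity -aJζ; as J commutes with rotations, the result is the rotated generator.
-/
lemma hasDerivAt_rotField {φ : Plane → Plane} (hφ : ContDiff ℝ ∞ φ) (a : ℝ) (z : Plane) (t : ℝ) :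
    HasDerivAt (fun t => rotField (a * t) φ z) (rotField (a * t) (rotGenerator a φ) z) t := by
  set J := rotIso (Real.pi / 2) with hJ
  have hJJ : ∀ x, J (J x) = -x := fun x => by
    rw [hJ, ← perp_eq_rotIso, ← perp_eq_rotIso, perp_perp]
  have hlin : HasDerivAt (fun t => a * t) a t := by simpa using (hasDerivAt_id t).const_mul a
  have hcos : HasDerivAt (fun t => Real.cos (a * t)) (-Real.sin (a * t) * a) t := hlin.cos
  have hsin : HasDerivAt (fun t => Real.sin (a * t)) (Real.cos (a * t) * a) t := hlin.sin
  have hζe : ∀ s : ℝ, mulV (rot (-(a * s))) z = Real.cos (a * s) • z - Real.sin (a * s) • J z :=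
    fun s => by rw [mulV_rot_eq, Real.cos_neg, Real.sin_neg, neg_smul, ← sub_eq_add_neg]
  set ζ := mulV (rot (-(a * t))) z with hζ
  have hζd : HasDerivAt (fun t => mulV (rot (-(a * t))) z) (-(a • J ζ)) t := by
    simp only [hζe]
    refine ((hcos.smul_const z).sub (hsin.smul_const (J z))).congr_deriv ?_
    rw [hζ, hζe, map_sub, map_smul, map_smul, hJJ]
    module
  have hv : HasDerivAt (fun t => φ (mulV (rot (-(a * t))) z)) (fderiv ℝ φ ζ (-(a • J ζ))) t :=
    ((hφ.differentiable (by simp)) ζ).hasFDerivAt.comp_hasDerivAt t hζd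
  have hJv : HasDerivAt (fun t => J (φ (mulV (rot (-(a * t))) z)))
      (J (fderiv ℝ φ ζ (-(a • J ζ)))) t :=
    (J.toContinuousLinearEquiv : Plane →L[ℝ] Plane).hasFDerivAt.comp_hasDerivAt t hv
  have h := (hcos.smul hv).add (hsin.smul hJv)
  have e : (fun t => rotField (a * t) φ z) = fun t =>
      Real.cos (a * t) • φ (mulV (rot (-(a * t))) z) +
      Real.sin (a * t) • J (φ (mulV (rot (-(a * t))) z)) := by
    ext1 t; rw [rotField, mulV_rot_eq]
  rw [e]
  refine h.congr_deriv ?_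
  have e2 : rotField (a * t) (rotGenerator a φ) z =
      Real.cos (a * t) • (a • (J (φ ζ) - fderiv ℝ φ ζ (J ζ))) +
      Real.sin (a * t) • J (a • (J (φ ζ) - fderiv ℝ φ ζ (J ζ))) := by
    rw [rotField, ← hζ, mulV_rot_eq (a * t), rotGenerator, perp_eq_rotIso, perp_eq_rotIso, ← hJ]
  rw [e2, ← hζ]
  simp only [map_neg, map_smul, map_sub, hJJ]
  module

lemma continuous_fderiv_apply {φ : Plane → Plane} (hφ : ContDiff ℝ ∞ φ) (v : Plane) :
    Continuous (fun x => fderiv ℝ φ x v) :=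
  (hφ.fderiv_right (m := ∞) (by simp)).continuous.clm_apply continuous_const

lemma fderiv_coord {φ : Plane → Plane} (hφ : ContDiff ℝ ∞ φ) (x v : Plane) (k : Fin 2) :
    fderiv ℝ (fun x => φ x k) x v = fderiv ℝ φ x v k := by
  have h := ((EuclideanSpace.proj k : Plane →L[ℝ] ℝ).hasFDerivAt (x := φ x)).comp x
    ((hφ.differentiable (by simp)) x).hasFDerivAt
  have h2 : fderiv ℝ (fun x => φ x k) x =
    (EuclideanSpace.proj k : Plane →L[ℝ] ℝ).comp (fderiv ℝ φ x) := h.fderiv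
  rw [h2]
  rfl

lemma div_eq_sum_partialD {φ : Plane → Plane} (hφ : ContDiff ℝ ∞ φ) (x : Plane) :
    div φ x = ∑ k, partialD k (fun x => φ x k) x := by
  simp only [partialD, fderiv_coord hφ, div]

lemma fderiv_rotField {φ : Plane → Plane} (hφ : ContDiff ℝ ∞ φ) (θ : ℝ) (z v : Plane) :
    fderiv ℝ (rotField θ φ) z v =
      mulV (rot θ) (fderiv ℝ φ (mulV (rot (-θ)) z) (mulV (rot (-θ)) v)) := by
  have h1 : HasFDerivAt (mulV (rot (-θ))) ((rotIso (-θ)).toContinuousLinearEquiv :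
    Plane →L[ℝ] Plane) z :=
    ((rotIso (-θ)).toContinuousLinearEquiv : Plane →L[ℝ] Plane).hasFDerivAt
  have h2 := ((hφ.differentiable (by simp)) (mulV (rot (-θ)) z)).hasFDerivAt.comp z h1
  have h3 : HasFDerivAt (mulV (rot θ)) ((rotIso θ).toContinuousLinearEquiv :
    Plane →L[ℝ] Plane) ((φ ∘ mulV (rot (-θ))) z) :=
    ((rotIso θ).toContinuousLinearEquiv : Plane →L[ℝ] Plane).hasFDerivAt
  have h4 : HasFDerivAt (rotField θ φ) _ z := h3.comp z h2
  rw [h4.fderiv]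
  rfl

lemma mulV_rot_neg_single_zero (θ : ℝ) : mulV (rot (-θ)) (EuclideanSpace.single 0 1) =
    Real.cos θ • EuclideanSpace.single 0 1 - Real.sin θ • EuclideanSpace.single 1 1 := by
  ext i; revert i
  simp [Fin.forall_fin_two, mulV_rot_zero, mulV_rot_one]

lemma mulV_rot_neg_single_one (θ : ℝ) : mulV (rot (-θ)) (EuclideanSpace.single 1 1) =
    Real.sin θ • EuclideanSpace.single 0 1 + Real.cos θ • EuclideanSpace.single 1 1 := by
  ext i; revert i
  simp [Fin.forall_fin_two, mulV_rot_zero, mulV_rot_one]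

/-- The Jacobian is conjugated by O(θ), which leaves its trace unchanged. -/
lemma div_rotField {φ : Plane → Plane} (hφ : ContDiff ℝ ∞ φ) (θ : ℝ) (z : Plane) :
    div (rotField θ φ) z = div φ (mulV (rot (-θ)) z) := by
  simp only [div, Fin.sum_univ_two, fderiv_rotField hφ, mulV_rot_neg_single_zero,
    mulV_rot_neg_single_one, map_sub, map_add, map_smul, mulV_rot_zero, mulV_rot_one]
  simp only [PiLp.sub_apply, PiLp.add_apply, PiLp.smul_apply, smul_eq_mul]
  linear_combination (fderiv ℝ φ (mulV (rot (-θ)) z) (EuclideanSpace.single 0 1) 0 +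
    fderiv ℝ φ (mulV (rot (-θ)) z) (EuclideanSpace.single 1 1) 1) * Real.cos_sq_add_sin_sq θ

lemma continuous_div {φ : Plane → Plane} (hφ : ContDiff ℝ ∞ φ) : Continuous (div φ) := by
  unfold div
  exact continuous_finsetSum _ fun i _ => continuous_coord (continuous_fderiv_apply hφ _) i

lemma hasCompactSupport_div {φ : Plane → Plane} (hc : HasCompactSupport φ) :
    HasCompactSupport (div φ) := by
  refine hc.mono' ?_
  intro x hx
  by_contra h
  refine hx ?_
  have h2 : fderiv ℝ φ x = 0 := by
    by_contra h3
    exact h (support_fderiv_subset ℝ h3)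
  simp [div, h2]

/-- The adjoint of O(-θ) is O(θ), so rotating a gradient field yields the gradient of the rotated
function. Hence slices of gradients are again integrals of K against gradients. -/
lemma rotField_gradient {χ : Plane → ℝ} (hχ : ContDiff ℝ ∞ χ) (θ : ℝ) (z : Plane) (k : Fin 2) :
    rotField θ (gradient χ) z k = partialD k (fun x => χ (mulV (rot (-θ)) x)) z := by
  have h1 : HasFDerivAt (mulV (rot (-θ))) ((rotIso (-θ)).toContinuousLinearEquiv :
    Plane →L[ℝ] Plane) z :=
    ((rotIso (-θ)).toContinuousLinearEquiv : Plane →L[ℝ] Plane).hasFDerivAt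
  have h2 : HasFDerivAt (fun x => χ (mulV (rot (-θ)) x)) _ z :=
    ((hχ.differentiable (by simp)) (mulV (rot (-θ)) z)).hasFDerivAt.comp z h1
  set ζ := mulV (rot (-θ)) z with hζ
  have h3 : ∀ v, fderiv ℝ χ ζ v = inner ℝ (gradient χ ζ) v := fun v => by
    rw [gradient, InnerProductSpace.toDual_symm_apply]
  have h4 : partialD k (fun x => χ (mulV (rot (-θ)) x)) z =
      inner ℝ (gradient χ ζ) (mulV (rot (-θ)) (EuclideanSpace.single k 1)) := by
    rw [partialD, h2.fderiv, ← h3]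
    rfl
  have h5 : inner ℝ (gradient χ ζ) (mulV (rot (-θ)) (EuclideanSpace.single k 1)) =
      inner ℝ (rotIso θ (gradient χ ζ)) (EuclideanSpace.single k (1 : ℝ)) := by
    rw [← (rotIso θ).inner_map_map, rotIso_apply θ (mulV _ _), mulV_rot_mulV_rot_neg]
  rw [h4, h5, EuclideanSpace.inner_single_right]
  simp [rotField, rotIso_apply, hζ]

lemma continuous_gradient {χ : Plane → ℝ} (hχ : ContDiff ℝ ∞ χ) : Continuous (gradient χ) :=
  (InnerProductSpace.toDual ℝ Plane).symm.continuous.comp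
    (hχ.fderiv_right (m := ∞) (by simp)).continuous

lemma hasCompactSupport_gradient {χ : Plane → ℝ} (hc : HasCompactSupport χ) :
    HasCompactSupport (gradient χ) :=
  (hc.fderiv ℝ).comp_left (g := (InnerProductSpace.toDual ℝ Plane).symm) (map_zero _)

lemma adjointSlice_eq (ε a : ℝ) (ψ : Plane → Plane) (y : Plane) (j : Fin 2) (t : ℝ) :
    adjointSlice ε a ψ y j t = Real.exp (-ε * t) * ∑ k, ∫ w, stokesKernel w t j k *
      rotField (a * t) ψ (w + y) k := rfl

/-- The resolvent kernel is solenoidal. -/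
lemma adjointPotential_gradient {ε : ℝ} (hε : 0 < ε) (a : ℝ) {χ : Plane → ℝ}
    (hχ : ContDiff ℝ ∞ χ) (hc : HasCompactSupport χ) (y : Plane) (j : Fin 2) :
    adjointPotential ε a (gradient χ) y j = 0 := by
  rw [adjointPotential_eq_integral hε a (continuous_gradient hχ) (hasCompactSupport_gradient hc),
    setIntegral_congr_fun (g := fun _ => (0 : ℝ)) measurableSet_Ioi fun t ht => ?_, integral_zero]
  have hχt : ContDiff ℝ ∞ (fun w : Plane => χ (mulV (rot (-(a * t))) (w + y))) :=
    hχ.comp ((rotIso (-(a * t))).contDiff.comp (contDiff_id.add contDiff_const))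
  simp only [adjointSlice_eq, rotField_gradient hχ]
  have h := sum_integral_stokesKernel_mul_partialD (t := t) ht hχt
    (hasCompactSupport_rot_shift hc _ y) j
  simp only [partialD_shift (fun x => χ (mulV (rot (-(a * t))) x)) y] at h
  rw [h, mul_zero]

/-! ### The adjoint slices as primitives -/

/-- Rotation preserves norms, so one ball contains the supports for all angles. This supplies
dominating functions independent of time. -/
lemma exists_norm_rot_shift_le {F : Type*} [NormedAddCommGroup F] {ψ : Plane → F}
    (hψ : Continuous ψ) (hc : HasCompactSupport ψ) (y : Plane) :
    ∃ B R : ℝ, 0 ≤ B ∧ 0 ≤ R ∧ ∀ (θ : ℝ) (w : Plane),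
      ‖ψ (mulV (rot θ) (w + y))‖ ≤ (Metric.closedBall (0 : Plane) R).indicator (fun _ => B) w := by
  obtain ⟨B, hB⟩ := hψ.bounded_above_of_compact_support hc
  obtain ⟨R, hR⟩ := hc.isBounded.subset_closedBall 0
  refine ⟨max B 0, max (R + ‖y‖) 0, le_max_right _ _, le_max_right _ _, fun θ w => ?_⟩
  by_cases hw : w ∈ Metric.closedBall (0 : Plane) (max (R + ‖y‖) 0)
  · rw [indicator_of_mem hw]
    exact (hB _).trans (le_max_left _ _)
  · rw [indicator_of_notMem hw]
    rw [mem_closedBall_zero_iff, not_le] at hw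
    have h0 : ψ (mulV (rot θ) (w + y)) = 0 := by
      refine image_eq_zero_of_notMem_tsupport fun h => ?_
      have h1 := mem_closedBall_zero_iff.1 (hR h)
      rw [norm_mulV_rot] at h1
      have h2 : ‖w‖ ≤ ‖w + y‖ + ‖y‖ := by simpa using norm_sub_le (w + y) y
      linarith [le_max_left (R + ‖y‖) 0]
    rw [h0, norm_zero]

lemma exists_rotField_le {φ : Plane → Plane} (hφ : Continuous φ) (hc : HasCompactSupport φ)
    (y : Plane) : ∃ B R : ℝ, 0 ≤ B ∧ 0 ≤ R ∧ ∀ (θ : ℝ) (w : Plane) (k : Fin 2),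
      |rotField θ φ (w + y) k| ≤ (Metric.closedBall (0 : Plane) R).indicator (fun _ => B) w := by
  obtain ⟨B, R, hB, hR, h⟩ := exists_norm_rot_shift_le hφ hc y
  exact ⟨B, R, hB, hR, fun θ w k => (abs_coord_le _ k).trans
    ((norm_rotField _ _ _).trans_le (h _ _))⟩

lemma integrable_indicator_closedBall (R B : ℝ) :
    Integrable ((Metric.closedBall (0 : Plane) R).indicator (fun _ => B)) volume :=
  (integrable_indicator_iff measurableSet_closedBall).2
    (integrableOn_const measure_closedBall_lt_top.ne)

lemma continuous_rotField_coord {φ : Plane → Plane} (hφ : Continuous φ) (θ : ℝ) (y : Plane)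
    (k : Fin 2) : Continuous (fun w => rotField θ φ (w + y) k) :=
  continuous_coord ((continuous_rotField hφ θ).comp (continuous_id.add continuous_const)) k

lemma hasDerivAt_integral_stokesKernel_mul_rotField {φ : Plane → Plane} (hφ : ContDiff ℝ ∞ φ)
    (hc : HasCompactSupport φ) (a : ℝ) (y : Plane) (j k : Fin 2) {t : ℝ} (ht : 0 < t) :
    HasDerivAt (fun s => ∫ w, stokesKernel w s j k * rotField (a * s) φ (w + y) k)
      (∫ w, (stokesKernelDt w t j k * rotField (a * t) φ (w + y) k +
        stokesKernel w t j k * rotField (a * t) (rotGenerator a φ) (w + y) k)) t := by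
  have hg := continuous_rotGenerator hφ a
  obtain ⟨B, R, hB, -, h⟩ := exists_rotField_le hφ.continuous hc y
  obtain ⟨B', R', hB', -, h'⟩ := exists_rotField_le hg (hasCompactSupport_rotGenerator hc a) y
  obtain ⟨C, hC, hK⟩ := exists_stokesKernel_le
  obtain ⟨D, hD, hKt⟩ := exists_stokesKernelDt_le
  have mK : ∀ s, Measurable (fun w => stokesKernel w s j k) := fun s =>
    (measurable_stokesKernel j k).comp (measurable_id.prodMk measurable_const)
  have mKt : ∀ s, Measurable (fun w => stokesKernelDt w s j k) := fun s =>
    (measurable_stokesKernelDt j k).comp (measurable_id.prodMk measurable_const)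
  -- For s > t/2 the bounds on K and ∂ₜK become constants, so the derivative is dominated by
  -- multiples of indicators of balls.
  refine (hasDerivAt_integral_of_dominated_loc_of_deriv_le (s := Ioi (t / 2))
    (F' := fun s w => stokesKernelDt w s j k * rotField (a * s) φ (w + y) k +
        stokesKernel w s j k * rotField (a * s) (rotGenerator a φ) (w + y) k)
    (bound := fun w => D * (t / 2) ^ (-2 : ℝ) *
        (Metric.closedBall (0 : Plane) R).indicator (fun _ => B) w +
      C * (t / 2)⁻¹ * (Metric.closedBall (0 : Plane) R').indicator (fun _ => B') w)
    (Ioi_mem_nhds (by linarith)) ?_ ?_ ?_ ?_ ?_ ?_).2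
  · exact Eventually.of_forall fun s => ((mK s).mul
      (continuous_rotField_coord hφ.continuous _ y k).measurable).aestronglyMeasurable
  · exact integrable_stokesKernel_mul ht (continuous_rotField_coord hφ.continuous _ y k)
      (hasCompactSupport_coord (hasCompactSupport_shift (hasCompactSupport_rotField hc _) y) k) j k
  · exact (((mKt t).mul (continuous_rotField_coord hφ.continuous _ y k).measurable).add
      ((mK t).mul (continuous_rotField_coord hg _ y k).measurable)).aestronglyMeasurable
  · refine Eventually.of_forall fun w s hs => ?_
    have ht2 : 0 < t / 2 := by linarith
    have hs0 : 0 < s := ht2.trans hs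
    have hle : t / 2 ≤ s + ‖w‖ ^ 2 := (le_of_lt hs).trans (by nlinarith [sq_nonneg ‖w‖])
    rw [Real.norm_eq_abs]
    refine (abs_add_le _ _).trans ?_
    rw [abs_mul, abs_mul]
    gcongr
    · refine (hKt w s j k hs0).trans ?_
      exact mul_le_mul_of_nonneg_left (Real.rpow_le_rpow_of_nonpos ht2 hle (by norm_num)) hD.le
    · exact h _ _ _
    · refine (hK w s j k hs0).trans ?_
      gcongr
    · exact h' _ _ _
  · exact ((integrable_indicator_closedBall R B).const_mul _).add
      ((integrable_indicator_closedBall R' B').const_mul _)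
  · refine Eventually.of_forall fun w s hs => ?_
    have hs0 : 0 < s := lt_trans (by linarith) hs
    exact (hasDerivAt_stokesKernel w hs0 j k).mul
      ((EuclideanSpace.proj k : Plane →L[ℝ] ℝ).hasFDerivAt.comp_hasDerivAt s
        (hasDerivAt_rotField hφ a (w + y) s))

lemma rotOp_neg_eq (a : ℝ) (φ : Plane → Plane) (x : Plane) :
    rotOp (-a) φ x = -Laplacian.laplacian φ x - rotGenerator a φ x := by
  rw [rotOp, rotGenerator]
  module

lemma continuous_laplacian {φ : Plane → Plane} (hφ : ContDiff ℝ ∞ φ) :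
    Continuous (Laplacian.laplacian φ) := by
  refine (PiLp.continuous_toLp 2 _).comp (f := fun x k => Laplacian.laplacian φ x k)
    (continuous_pi fun k => ?_)
  simp only [laplacian_coord_eq hφ]
  exact continuous_finsetSum _ fun l _ =>
    (contDiff_partialD (contDiff_partialD (contDiff_coord hφ k) l) l).continuous

lemma hasCompactSupport_laplacian {φ : Plane → Plane} (hφ : ContDiff ℝ ∞ φ)
    (hc : HasCompactSupport φ) : HasCompactSupport (Laplacian.laplacian φ) := by
  refine hc.mono' fun x hx => ?_
  by_contra h
  refine hx ?_
  ext k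
  rw [laplacian_coord_eq hφ]
  refine Finset.sum_eq_zero fun l _ => ?_
  refine image_eq_zero_of_notMem_tsupport fun h2 => h ?_
  have h3 : ∀ χ : Plane → ℝ, tsupport (partialD l χ) ⊆ tsupport χ := fun χ =>
    closure_minimal (fun z hz => by
      by_contra hz'
      refine hz ?_
      have : fderiv ℝ χ z = 0 := by
        by_contra h4
        exact hz' (support_fderiv_subset ℝ h4)
      simp [partialD, this]) (isClosed_tsupport _)
  have h5 : tsupport (fun x => φ x k) ⊆ tsupport φ :=
    closure_mono fun z hz hz' => hz (by simp [hz'])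
  exact h5 (h3 _ (h3 _ h2))

/-- The adjoint operator `ε + L_{-a}` applied to a test field. -/
def adjointOp (ε a : ℝ) (φ : Plane → Plane) (x : Plane) : Plane := ε • φ x + rotOp (-a) φ x

lemma adjointOp_eq (ε a : ℝ) (φ : Plane → Plane) :
    adjointOp ε a φ = fun x => ε • φ x + (-Laplacian.laplacian φ x - rotGenerator a φ x) := by
  ext1 x; rw [adjointOp, rotOp_neg_eq]

lemma continuous_adjointOp {φ : Plane → Plane} (hφ : ContDiff ℝ ∞ φ) (ε a : ℝ) :
    Continuous (adjointOp ε a φ) := by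
  rw [adjointOp_eq]
  exact (hφ.continuous.const_smul ε).add
    ((continuous_laplacian hφ).neg.sub (continuous_rotGenerator hφ a))

lemma hasCompactSupport_adjointOp {φ : Plane → Plane} (hφ : ContDiff ℝ ∞ φ)
    (hc : HasCompactSupport φ) (ε a : ℝ) : HasCompactSupport (adjointOp ε a φ) := by
  rw [adjointOp_eq]
  exact (hc.smul_left (f := fun _ => ε)).add
    ((hasCompactSupport_laplacian hφ hc).neg.sub (hasCompactSupport_rotGenerator hc a))

lemma rotField_adjointOp (ε a θ : ℝ) (φ : Plane → Plane) (z : Plane) :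
    rotField θ (adjointOp ε a φ) z = ε • rotField θ φ z -
      rotField θ (Laplacian.laplacian φ) z - rotField θ (rotGenerator a φ) z := by
  simp only [rotField, adjointOp_eq]
  simp only [← rotIso_apply, map_add, map_sub, map_neg, map_smul]
  abel

/-- The exponential contributes -ε, the rotation contributes the generator, and ∂ₜK becomes the
Laplacian of the rotated field after two integrations by parts. Together these are minus the adjoint
operator under the integral. -/
lemma hasDerivAt_adjointSlice {φ : Plane → Plane} (hφ : ContDiff ℝ ∞ φ)
    (hc : HasCompactSupport φ) (ε a : ℝ) (y : Plane) (j : Fin 2) {t : ℝ} (ht : 0 < t) :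
    HasDerivAt (adjointSlice ε a φ y j) (-adjointSlice ε a (adjointOp ε a φ) y j t) t := by
  have hexp : HasDerivAt (fun s => Real.exp (-ε * s)) (Real.exp (-ε * t) * -ε) t := by
    simpa using ((hasDerivAt_id t).const_mul (-ε)).exp
  have hs := hexp.mul (HasDerivAt.fun_sum (u := Finset.univ) fun k _ =>
    hasDerivAt_integral_stokesKernel_mul_rotField hφ hc a y j k ht)
  refine hs.congr_deriv ?_
  have hs1 : ∀ k, ContDiff ℝ ∞ (fun w => rotField (a * t) φ (w + y) k) := fun k =>
    contDiff_coord ((contDiff_rotField hφ _).comp (contDiff_id.add contDiff_const)) k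
  have hi : ∀ {ψ : Plane → Plane}, Continuous ψ → HasCompactSupport ψ → ∀ k,
      Integrable (fun w => stokesKernel w t j k * rotField (a * t) ψ (w + y) k) :=
    fun hψ hcψ k => integrable_stokesKernel_mul ht (continuous_rotField_coord hψ _ y k)
      (hasCompactSupport_coord (hasCompactSupport_shift (hasCompactSupport_rotField hcψ _) y) k) j k
  have hcs : ∀ k, HasCompactSupport (fun w => rotField (a * t) φ (w + y) k) := fun k =>
    hasCompactSupport_coord (hasCompactSupport_shift (hasCompactSupport_rotField hc _) y) k
  obtain ⟨M, -, hM⟩ := exists_kernel_bounds ht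
  have hit : ∀ k, Integrable (fun w => stokesKernelDt w t j k * rotField (a * t) φ (w + y) k) :=
    fun k => integrable_bdd_mul ((measurable_stokesKernelDt j k).comp
      (measurable_id.prodMk measurable_const)) (fun x => (hM x j k).2.2.2.2.1)
      (hs1 k).continuous (hcs k)
  -- The weak heat equation for K, followed by the commutation of the Laplacian with rotations and
  -- translations.
  have hL : ∀ k, ∫ w, stokesKernelDt w t j k * rotField (a * t) φ (w + y) k =
      ∫ w, stokesKernel w t j k * rotField (a * t) (Laplacian.laplacian φ) (w + y) k := fun k => by
    rw [← sum_integral_stokesKernel_mul_partialD_partialD ht (hs1 k) (hcs k),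
      ← integral_finsetSum _ fun l _ => integrable_stokesKernel_mul ht
        (contDiff_partialD (contDiff_partialD (hs1 k) l) l).continuous
        (hasCompactSupport_partialD (hasCompactSupport_partialD (hcs k) l) l) j k]
    refine integral_congr_ae (Eventually.of_forall fun w => ?_)
    simp only
    rw [← Finset.mul_sum, ← laplacian_rotField hφ, laplacian_coord_eq (contDiff_rotField hφ _)]
    simp only [partialD_shift (fun x => rotField (a * t) φ x k) y,
      partialD_shift (partialD _ (fun x => rotField (a * t) φ x k)) y]
  have hψ : ∀ k, ∫ w, stokesKernel w t j k * rotField (a * t) (adjointOp ε a φ) (w + y) k =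
      ε * (∫ w, stokesKernel w t j k * rotField (a * t) φ (w + y) k) -
      (∫ w, stokesKernel w t j k * rotField (a * t) (Laplacian.laplacian φ) (w + y) k) -
      ∫ w, stokesKernel w t j k * rotField (a * t) (rotGenerator a φ) (w + y) k := fun k => by
    have i1 := (hi hφ.continuous hc k).const_mul ε
    have i2 := hi (continuous_laplacian hφ) (hasCompactSupport_laplacian hφ hc) k
    have i3 : Integrable (fun w => ε * (stokesKernel w t j k * rotField (a * t) φ (w + y) k) -
      stokesKernel w t j k * rotField (a * t) (Laplacian.laplacian φ) (w + y) k) := i1.sub i2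
    rw [← integral_const_mul, ← integral_sub i1 i2, ← integral_sub i3
      (hi (continuous_rotGenerator hφ a) (hasCompactSupport_rotGenerator hc a) k)]
    refine integral_congr_ae (Eventually.of_forall fun w => ?_)
    simp only [rotField_adjointOp, PiLp.sub_apply, PiLp.smul_apply, smul_eq_mul]
    ring
  have hadd : ∀ k, ∫ w, (stokesKernelDt w t j k * rotField (a * t) φ (w + y) k +
        stokesKernel w t j k * rotField (a * t) (rotGenerator a φ) (w + y) k) = _ := fun k =>
    integral_add (hit k)
      (hi (continuous_rotGenerator hφ a) (hasCompactSupport_rotGenerator hc a) k)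
  simp only [adjointSlice_eq, hadd, hψ, hL, Finset.sum_add_distrib, Finset.sum_sub_distrib,
    ← Finset.mul_sum]
  ring

lemma tendsto_adjointSlice_atTop {ε : ℝ} (hε : 0 < ε) {φ : Plane → Plane} (hφ : Continuous φ)
    (hc : HasCompactSupport φ) (a : ℝ) (y : Plane) (j : Fin 2) :
    Tendsto (adjointSlice ε a φ y j) atTop (𝓝 0) := by
  obtain ⟨B, R, hB, -, h⟩ := exists_rotField_le hφ hc y
  obtain ⟨C, hC, hK⟩ := exists_stokesKernel_le
  set I := ∫ w, (Metric.closedBall (0 : Plane) R).indicator (fun _ => B) w with hI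
  have hI0 : 0 ≤ I := integral_nonneg fun w => indicator_nonneg (fun _ _ => hB) w
  refine squeeze_zero_norm' (a := fun t : ℝ => (2 * C * I) * t⁻¹) ?_ ?_
  · filter_upwards [eventually_gt_atTop 0] with t ht
    have hb : ∀ k, |∫ w, stokesKernel w t j k * rotField (a * t) φ (w + y) k| ≤
        C * t⁻¹ * I := fun k => by
      rw [hI, ← integral_const_mul, ← Real.norm_eq_abs]
      refine norm_integral_le_of_norm_le ((integrable_indicator_closedBall R B).const_mul _)
        (Eventually.of_forall fun w => ?_)
      rw [norm_mul, Real.norm_eq_abs, Real.norm_eq_abs]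
      gcongr
      · refine (hK w t j k ht).trans ?_
        gcongr
        nlinarith [sq_nonneg ‖w‖]
      · exact h _ _ _
    rw [adjointSlice_eq, Fin.sum_univ_two, norm_mul, Real.norm_of_nonneg (Real.exp_pos _).le]
    have he : Real.exp (-ε * t) ≤ 1 := by
      rw [Real.exp_le_one_iff]; nlinarith
    have h2 := (norm_add_le (∫ w, stokesKernel w t j 0 * rotField (a * t) φ (w + y) 0)
      (∫ w, stokesKernel w t j 1 * rotField (a * t) φ (w + y) 1)).trans
      (add_le_add (hb 0) (hb 1))
    calc _ ≤ 1 * (C * t⁻¹ * I + C * t⁻¹ * I) := by gcongr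
      _ = _ := by ring
  · simpa using tendsto_inv_atTop_zero.const_mul (2 * C * I)

/-! ### The initial value of the adjoint slices -/

lemma integral_heatKernel_one : ∫ v : Plane, heatKernel v 1 = 1 := by
  have h := GaussianFourier.integral_rexp_neg_mul_sq_norm (V := Plane)
    (by norm_num : (0 : ℝ) < 4⁻¹)
  have e : (fun v : Plane => heatKernel v 1) = fun v =>
      (4 * Real.pi)⁻¹ * Real.exp (-4⁻¹ * ‖v‖ ^ 2) := by
    ext v
    simp only [heatKernel]
    ring_nf
  rw [e, integral_const_mul, h, finrank_euclideanSpace_fin]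
  norm_num
  have := Real.pi_ne_zero
  field_simp

lemma integrable_heatKernel : Integrable (fun v : Plane => heatKernel v 1) :=
  Integrable.of_integral_ne_zero (by rw [integral_heatKernel_one]; exact one_ne_zero)

/-- Parabolic scaling of the heat kernel. -/
lemma integral_heatKernel_mul (g : Plane → ℝ) {t : ℝ} (ht : 0 < t) :
    ∫ w, heatKernel w t * g w = ∫ v, heatKernel v 1 * g (√t • v) := by
  have hs : 0 < √t := Real.sqrt_pos.2 ht
  have h := Measure.integral_comp_smul volume (fun w => heatKernel w t * g w) (√t)
  rw [finrank_euclideanSpace_fin, Real.sq_sqrt ht.le, abs_of_pos (by positivity), smul_eq_mul] at h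
  have e : ∀ v : Plane, heatKernel v 1 = t * heatKernel (√t • v) t := fun v => by
    simp only [heatKernel, norm_smul, Real.norm_of_nonneg hs.le, mul_pow, Real.sq_sqrt ht.le]
    have : -(t * ‖v‖ ^ 2) / (4 * t) = -‖v‖ ^ 2 / (4 * 1) := by field_simp
    rw [this]
    field_simp
  simp only [e, mul_assoc, integral_const_mul, h]
  field_simp

/-- After the substitution w = √t v the weight is a fixed probability density, so dominated
convergence applies even though g depends on t. -/
lemma tendsto_integral_heatKernel_mul {g : ℝ → Plane → ℝ} {B : ℝ}
    (hg : Continuous (fun p : ℝ × Plane => g p.1 p.2)) (hB : ∀ t w, |g t w| ≤ B) :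
    Tendsto (fun t => ∫ w, heatKernel w t * g t w) (𝓝[>] 0) (𝓝 (g 0 0)) := by
  have h0 : ∀ v : Plane, 0 ≤ heatKernel v 1 := fun v => heatKernel_nonneg v one_pos
  have key : Tendsto (fun t => ∫ v, heatKernel v 1 * g t (√t • v)) (𝓝[>] 0)
      (𝓝 (∫ v, heatKernel v 1 * g 0 0)) := by
    refine tendsto_integral_filter_of_dominated_convergence (fun v => heatKernel v 1 * B) ?_ ?_
      (integrable_heatKernel.mul_const B) ?_
    · refine Eventually.of_forall fun t => integrable_heatKernel.aestronglyMeasurable.mul ?_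
      exact (hg.comp (by fun_prop : Continuous fun v : Plane => (t, √t • v))).aestronglyMeasurable
    · refine Eventually.of_forall fun t => Eventually.of_forall fun v => ?_
      rw [norm_mul, Real.norm_of_nonneg (h0 v)]
      exact mul_le_mul_of_nonneg_left (hB _ _) (h0 v)
    · refine Eventually.of_forall fun v => Tendsto.const_mul _ ?_
      have h : Continuous (fun t : ℝ => g t (√t • v)) :=
        hg.comp (by fun_prop : Continuous fun t : ℝ => (t, √t • v))
      simpa using (h.tendsto 0).mono_left nhdsWithin_le_nhds
  rw [integral_mul_const, integral_heatKernel_one, one_mul] at key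
  refine key.congr' ?_
  filter_upwards [self_mem_nhdsWithin] with t ht
  exact (integral_heatKernel_mul _ ht).symm

lemma integrable_inv_norm_mul_indicator (R B : ℝ) : Integrable (fun w : Plane =>
    ‖w‖⁻¹ * (Metric.closedBall (0 : Plane) R).indicator (fun _ => B) w) := by
  have h : IntegrableOn (fun w : Plane => ‖w‖⁻¹ * B) (Metric.closedBall 0 R) :=
    ((integrableOn_ball_inv_norm (R + 1)).mono_set
      (Metric.closedBall_subset_ball (lt_add_one R))).mul_const B
  refine ((integrable_indicator_iff measurableSet_closedBall).2 h).congr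
    (Eventually.of_forall fun w => ?_)
  by_cases hw : w ∈ Metric.closedBall (0 : Plane) R <;> simp [hw]

lemma norm_truncPressure_le (w : Plane) {t : ℝ} (ht : 0 < t) : ‖truncPressure w t‖ ≤ ‖w‖⁻¹ := by
  have h1 : 0 ≤ 1 - Real.exp (-‖w‖ ^ 2 / (4 * t)) := by
    rw [sub_nonneg, Real.exp_le_one_iff, neg_div, neg_nonpos]
    positivity
  have h2 : 1 - Real.exp (-‖w‖ ^ 2 / (4 * t)) ≤ 1 := by
    linarith [Real.exp_pos (-‖w‖ ^ 2 / (4 * t))]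
  rw [truncPressure, norm_smul, Real.norm_of_nonneg h1]
  exact (mul_le_of_le_one_left (norm_nonneg _) h2).trans (norm_pressureKernel_le w)

lemma tendsto_truncPressure {w : Plane} (hw : w ≠ 0) :
    Tendsto (fun t => truncPressure w t) (𝓝[>] 0) (𝓝 (pressureKernel w)) := by
  have hw' : 0 < ‖w‖ ^ 2 / 4 := by have := norm_pos_iff.2 hw; positivity
  have h1 : Tendsto (fun t : ℝ => -‖w‖ ^ 2 / (4 * t)) (𝓝[>] 0) atBot := by
    have h := tendsto_neg_atTop_atBot.comp (tendsto_inv_nhdsGT_zero.const_mul_atTop hw')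
    refine h.congr fun t => ?_
    simp only [Function.comp]
    ring
  have h2 := ((Real.tendsto_exp_atBot.comp h1).const_sub 1).smul_const (pressureKernel w)
  simpa [truncPressure] using h2

lemma measurable_truncPressure (t : ℝ) (j : Fin 2) :
    Measurable (fun w => truncPressure w t j) := by
  have h1 : Measurable (fun w : Plane => 1 - Real.exp (-‖w‖ ^ 2 / (4 * t))) := by fun_prop
  have h : Measurable (fun w => truncPressure w t) := h1.smul measurable_pressureKernel
  exact (measurable_coord j).comp h

/-- The pressure potential of a test field, transposed. -/
def adjointPressure (φ : Plane → Plane) (y : Plane) (j : Fin 2) : ℝ :=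
  ∫ w, pressureKernel w j * div φ (w + y)

lemma continuous_mulV_rot_comp {X : Type*} [TopologicalSpace X] {v : X → Plane} {θ : X → ℝ}
    (hv : Continuous v) (hθ : Continuous θ) : Continuous (fun x => mulV (rot (θ x)) (v x)) := by
  simp only [mulV_rot_eq]
  exact ((Real.continuous_cos.comp hθ).smul hv).add ((Real.continuous_sin.comp hθ).smul
    ((rotIso (Real.pi / 2)).continuous.comp hv))

lemma mulV_rot_of_angle_zero (x : Plane) : mulV (rot 0) x = x := by
  rw [mulV_rot_eq, Real.cos_zero, Real.sin_zero, one_smul, zero_smul, add_zero]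

lemma continuous_rot_shift (a : ℝ) (y : Plane) :
    Continuous (fun p : ℝ × Plane => mulV (rot (-(a * p.1))) (p.2 + y)) :=
  continuous_mulV_rot_comp (v := fun p : ℝ × Plane => p.2 + y)
    (θ := fun p : ℝ × Plane => -(a * p.1)) (by fun_prop) (by fun_prop)

/-- Dominated convergence: |w|⁻¹ times the indicator of a ball is integrable in the plane and
dominates for all t > 0. -/
lemma tendsto_integral_truncPressure_mul {g : Plane → ℝ} (hg : Continuous g)
    (hc : HasCompactSupport g) (a : ℝ) (y : Plane) (j : Fin 2) :
    Tendsto (fun t => ∫ w, truncPressure w t j * g (mulV (rot (-(a * t))) (w + y))) (𝓝[>] 0)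
      (𝓝 (∫ w, pressureKernel w j * g (w + y))) := by
  obtain ⟨B, R, hB, -, h⟩ := exists_norm_rot_shift_le hg hc y
  have hcont : Continuous (fun p : ℝ × Plane => g (mulV (rot (-(a * p.1))) (p.2 + y))) :=
    hg.comp (continuous_rot_shift a y)
  have hm : ∀ t, AEStronglyMeasurable (fun w : Plane =>
      truncPressure w t j * g (mulV (rot (-(a * t))) (w + y))) volume := fun t =>
    ((measurable_truncPressure t j).mul (hcont.comp
      (f := fun w : Plane => ((t, w) : ℝ × Plane)) (by fun_prop)).measurable).aestronglyMeasurable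
  have hb : ∀ t, 0 < t → ∀ w : Plane, ‖truncPressure w t j * g (mulV (rot (-(a * t))) (w + y))‖ ≤
      ‖w‖⁻¹ * (Metric.closedBall (0 : Plane) R).indicator (fun _ => B) w := fun t ht w => by
    rw [norm_mul]
    exact mul_le_mul ((abs_coord_le _ j).trans (norm_truncPressure_le w ht)) (h _ _)
      (norm_nonneg _) (by positivity)
  have hl : ∀ w : Plane, w ≠ 0 → Tendsto (fun t =>
      truncPressure w t j * g (mulV (rot (-(a * t))) (w + y))) (𝓝[>] 0)
      (𝓝 (pressureKernel w j * g (w + y))) := fun w hw => by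
    have h1 : Tendsto (fun t => truncPressure w t j) (𝓝[>] 0) (𝓝 (pressureKernel w j)) :=
      ((EuclideanSpace.proj j : Plane →L[ℝ] ℝ).continuous.tendsto _).comp
        (tendsto_truncPressure hw)
    have h2 : Continuous (fun t : ℝ => g (mulV (rot (-(a * t))) (w + y))) :=
      hcont.comp (f := fun t : ℝ => ((t, w) : ℝ × Plane)) (by fun_prop)
    have h3 : mulV (rot (-(a * 0))) (w + y) = w + y := by
      rw [mul_zero, neg_zero, mulV_rot_of_angle_zero]
    have h4 := (h2.tendsto 0).mono_left (nhdsWithin_le_nhds (s := Ioi 0))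
    rw [h3] at h4
    exact h1.mul h4
  refine tendsto_integral_filter_of_dominated_convergence _ (Eventually.of_forall hm) ?_
    (integrable_inv_norm_mul_indicator R B) ?_
  · filter_upwards [self_mem_nhdsWithin] with t ht
    exact Eventually.of_forall (hb t ht)
  · filter_upwards [ae_ne 0] with w hw using hl w hw

/-- At t = 0 the Stokes kernel acts formally as the Helmholtz projection φ - ∇Δ⁻¹ div φ. The sign
here is plus because Q is odd and the integral is over w = x - y. -/
lemma tendsto_adjointSlice_zero {φ : Plane → Plane} (hφ : ContDiff ℝ ∞ φ)
    (hc : HasCompactSupport φ) (ε a : ℝ) (y : Plane) (j : Fin 2) :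
    Tendsto (adjointSlice ε a φ y j) (𝓝[>] 0) (𝓝 (φ y j + adjointPressure φ y j)) := by
  obtain ⟨B, hB⟩ := hφ.continuous.bounded_above_of_compact_support hc
  have hc2 : Continuous (fun p : ℝ × Plane => rotField (a * p.1) φ (p.2 + y)) :=
    continuous_mulV_rot_comp (v := fun p : ℝ × Plane => φ (mulV (rot (-(a * p.1))) (p.2 + y)))
      (θ := fun p => a * p.1) (hφ.continuous.comp (continuous_rot_shift a y)) (by fun_prop)
  have hcont : Continuous (fun p : ℝ × Plane => rotField (a * p.1) φ (p.2 + y) j) :=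
    (EuclideanSpace.proj j : Plane →L[ℝ] ℝ).continuous.comp hc2
  have h1 := tendsto_integral_heatKernel_mul (B := B)
    (g := fun t w => rotField (a * t) φ (w + y) j) hcont fun t w =>
    (abs_coord_le _ j).trans ((norm_rotField _ _ _).trans_le (hB _))
  have h2 := tendsto_integral_truncPressure_mul (continuous_div hφ) (hasCompactSupport_div hc) a y j
  have h3 : Tendsto (fun t => Real.exp (-ε * t)) (𝓝[>] 0) (𝓝 1) := by
    have : Continuous (fun t => Real.exp (-ε * t)) := by fun_prop
    simpa using (this.tendsto 0).mono_left nhdsWithin_le_nhds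
  have h4 := h3.mul (h1.add h2)
  have e0 : rotField (a * 0) φ (0 + y) j = φ y j := by
    rw [rotField, mul_zero, neg_zero, mulV_rot_of_angle_zero, mulV_rot_of_angle_zero, zero_add]
  simp only [e0, one_mul] at h4
  refine h4.congr' ?_
  filter_upwards [self_mem_nhdsWithin] with t ht
  have hs : ContDiff ℝ ∞ (fun w => rotField (a * t) φ (w + y)) :=
    (contDiff_rotField hφ _).comp (contDiff_id.add contDiff_const)
  have hcs := hasCompactSupport_shift (hasCompactSupport_rotField hc (a * t)) y
  have hcoord : ∀ k, ContDiff ℝ ∞ (fun w => rotField (a * t) φ (w + y) k) := contDiff_coord hs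
  rw [adjointSlice_eq, sum_integral_stokesKernel_mul
    (Φ := fun k w => rotField (a * t) φ (w + y) k) ht (contDiff_coord hs)
    (hasCompactSupport_coord hcs) j]
  congr 2
  have hi : ∀ k, Integrable (fun w => truncPressure w t j *
      partialD k (fun w => rotField (a * t) φ (w + y) k) w) := fun k =>
    ((differentiable_truncPressure ht j).continuous.mul
      (contDiff_partialD (hcoord k) k).continuous).integrable_of_hasCompactSupport
      ((hasCompactSupport_partialD (hasCompactSupport_coord hcs k) k).mul_left)
  rw [← integral_finsetSum _ fun k _ => hi k]
  refine integral_congr_ae (Eventually.of_forall fun w => ?_)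
  simp only
  rw [← Finset.mul_sum, ← div_rotField hφ, div_eq_sum_partialD (contDiff_rotField hφ _)]
  exact congrArg _ (Finset.sum_congr rfl fun k _ =>
    (congrFun (partialD_shift (fun x => rotField (a * t) φ x k) y k) w).symm)

/-- The adjoint potential inverts the adjoint operator up to a pressure term. -/
lemma adjointPotential_adjointOp {ε : ℝ} (hε : 0 < ε) (a : ℝ) {φ : Plane → Plane}
    (hφ : ContDiff ℝ ∞ φ) (hc : HasCompactSupport φ) (y : Plane) (j : Fin 2) :
    adjointPotential ε a (adjointOp ε a φ) y j = φ y j + adjointPressure φ y j := by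
  have hψ := continuous_adjointOp hφ ε a
  have hcψ := hasCompactSupport_adjointOp hφ hc ε a
  set L := φ y j + adjointPressure φ y j
  -- The slice at t = 0 itself is not known to equal its right limit, so that value is replaced by
  -- the limit to gain continuity at the endpoint.
  set F := Function.update (adjointSlice ε a φ y j) 0 L with hF
  have h0 : F 0 = L := Function.update_self _ _ _
  have heq : ∀ t, 0 < t → F =ᶠ[𝓝 t] adjointSlice ε a φ y j := fun t ht => by
    filter_upwards [Ioi_mem_nhds ht] with s hs
    exact Function.update_of_ne (ne_of_gt hs) _ _
  have h := integral_Ioi_of_hasDerivAt_of_tendsto (a := (0 : ℝ)) (f := F)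
    (f' := fun t => -adjointSlice ε a (adjointOp ε a φ) y j t) (m := 0) ?_
    (fun t ht => (hasDerivAt_adjointSlice hφ hc ε a y j ht).congr_of_eventuallyEq (heq t ht))
    (integrableOn_adjointSlice hε a hψ hcψ y j).neg ?_
  · rw [adjointPotential_eq_integral hε a hψ hcψ]
    rw [integral_neg, h0] at h
    linarith
  · rw [hF, continuousWithinAt_update_same, Ici_sdiff_left]
    exact tendsto_adjointSlice_zero hφ hc ε a y j
  · refine (tendsto_adjointSlice_atTop hε hφ.continuous hc a y j).congr' ?_
    filter_upwards [eventually_gt_atTop 0] with t ht using (heq t ht).self_of_nhds.symm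

/-! ### The equation in the sense of distributions -/

lemma integrable_pressureKernel_mul_mul_prod {f : Plane → Plane} (h1 : MemLp f 1 volume)
    (htop : MemLp f ∞ volume) {g : Plane → ℝ} (hg : Continuous g) (hc : HasCompactSupport g)
    (j : Fin 2) :
    Integrable (fun p : Plane × Plane => pressureKernel (p.1 - p.2) j * f p.2 j * g p.1)
      (volume.prod volume) := by
  obtain ⟨N, hN, h⟩ := exists_lintegral_inv_enorm_mul_le h1 htop
  have hm : AEStronglyMeasurable
      (fun p : Plane × Plane => pressureKernel (p.1 - p.2) j * f p.2 j * g p.1)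
      (volume.prod volume) :=
    ((((measurable_coord j).comp measurable_pressureKernel).comp
      (measurable_fst.sub measurable_snd)).aestronglyMeasurable.mul
      (aestronglyMeasurable_coord h1.1 j).comp_snd).mul
      (hg.comp continuous_fst).aestronglyMeasurable
  refine ⟨hm, ?_⟩
  rw [HasFiniteIntegral, lintegral_prod _ hm.enorm]
  calc _ ≤ ∫⁻ x, N * ‖g x‖ₑ := by
        refine lintegral_mono fun x => ?_
        simp only [enorm_mul (pressureKernel _ j * _)]
        rw [lintegral_mul_const' _ _ enorm_ne_top]
        gcongr
        refine (lintegral_mono fun y => ?_).trans (h x)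
        rw [enorm_mul]
        gcongr
        · exact (enorm_coord_le _ j).trans (enorm_pressureKernel_le _)
        · exact enorm_coord_le _ j
    _ < ⊤ := by
        rw [lintegral_const_mul' _ _ hN]
        exact ENNReal.mul_lt_top hN.lt_top (hg.integrable_of_hasCompactSupport hc).2

lemma integral_pressurePotential_mul_div {f φ : Plane → Plane} (h1 : MemLp f 1 volume)
    (htop : MemLp f ∞ volume) (hφ : ContDiff ℝ ∞ φ) (hc : HasCompactSupport φ) :
    ∫ x, pressurePotential f x * div φ x = ∑ j, ∫ y, f y j * adjointPressure φ y j := by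
  have hi := fun j => integrable_pressureKernel_mul_mul_prod h1 htop (continuous_div hφ)
    (hasCompactSupport_div hc) j
  have hQ : ∀ x j, Integrable (fun y => pressureKernel (x - y) j * f y j) := fun x j => by
    obtain ⟨N, hN, h⟩ := exists_lintegral_inv_enorm_mul_le h1 htop
    refine ⟨(((measurable_coord j).comp measurable_pressureKernel).comp
      (measurable_const.sub measurable_id)).aestronglyMeasurable.mul
      (aestronglyMeasurable_coord h1.1 j), ?_⟩
    refine lt_of_le_of_lt ((lintegral_mono fun y => ?_).trans (h x)) hN.lt_top
    rw [enorm_mul]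
    gcongr
    · exact (enorm_coord_le _ j).trans (enorm_pressureKernel_le _)
    · exact enorm_coord_le _ j
  have e1 : ∀ x, pressurePotential f x * div φ x =
      ∑ j, ∫ y, pressureKernel (x - y) j * f y j * div φ x := fun x => by
    have e : pressurePotential f x = ∑ j, ∫ y, pressureKernel (x - y) j * f y j := by
      rw [pressurePotential, ← integral_finsetSum _ fun j _ => hQ x j]
      refine integral_congr_ae (Eventually.of_forall fun y => ?_)
      simp only
      rw [PiLp.inner_apply]
      exact Finset.sum_congr rfl fun j _ => by
        rw [RCLike.inner_apply, conj_trivial, mul_comm]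
    rw [e, Finset.sum_mul]
    exact Finset.sum_congr rfl fun j _ => (integral_mul_const _ _).symm
  have e2 : ∀ y j, f y j * adjointPressure φ y j =
      ∫ x, pressureKernel (x - y) j * f y j * div φ x := fun y j => by
    rw [adjointPressure, ← integral_const_mul, ← integral_add_right_eq_self
      (fun x => pressureKernel (x - y) j * f y j * div φ x) y]
    refine integral_congr_ae (Eventually.of_forall fun w => ?_)
    simp only [add_sub_cancel_right]
    ring
  simp only [e1, e2]
  rw [integral_finsetSum _ fun j _ => (hi j).integral_prod_left]
  exact Finset.sum_congr rfl fun j _ => integral_integral_swap (hi j)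

lemma integrable_coord_mul {f φ : Plane → Plane} (h1 : MemLp f 1 volume)
    (hφ : Continuous φ) (hc : HasCompactSupport φ) (j : Fin 2) :
    Integrable (fun y => f y j * φ y j) := by
  obtain ⟨B, hB⟩ := hφ.bounded_above_of_compact_support hc
  refine (memLp_one_iff_integrable.1 h1).eval_piLp j |>.mul_bdd (c := B)
    (continuous_coord hφ j).aestronglyMeasurable (Eventually.of_forall fun x => ?_)
  exact (abs_coord_le _ j).trans (hB x)

/-- By duality all three pairings in the momentum equation become integrals of the components of f,
and the identity for the adjoint potential matches their integrands pointwise. -/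
theorem isDistribSolution_resolventPotential {ε : ℝ} (hε : 0 < ε) (a : ℝ) {f : Plane → Plane}
    (h1 : MemLp f 1 volume) (htop : MemLp f ∞ volume) :
    IsDistribSolution ε a f (resolventPotential ε a f) (pressurePotential f) where
  locallyIntegrable_force := (memLp_one_iff_integrable.1 h1).locallyIntegrable
  locallyIntegrable_velocity := locallyIntegrable_resolventPotential hε a h1 htop
  locallyIntegrable_pressure := locallyIntegrable_pressurePotential h1 htop
  momentum φ hφ hc := by
    have hψ := continuous_adjointOp hφ ε a
    have hcψ := hasCompactSupport_adjointOp hφ hc ε a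
    have hu : ∫ x, inner ℝ (resolventPotential ε a f x) (ε • φ x + rotOp (-a) φ x) =
        ∑ j, ∫ y, f y j * adjointPotential ε a (adjointOp ε a φ) y j :=
      integral_inner_resolventPotential hε a h1 htop hψ hcψ
    have hiφ := fun j => integrable_coord_mul h1 hφ.continuous hc j
    have hiA := fun j => integrable_mul_adjointPotential hε a h1 htop hψ hcψ j
    -- Expressing the pressure term as a difference of two integrands already known to be integrable
    -- lets the integral be split.
    have hsub : ∀ y j, f y j * adjointPressure φ y j =
        f y j * adjointPotential ε a (adjointOp ε a φ) y j - f y j * φ y j := fun y j => by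
      rw [adjointPotential_adjointOp hε a hφ hc]
      ring
    have hf : ∫ x, inner ℝ (f x) (φ x) = ∑ j, ∫ y, f y j * φ y j := by
      rw [← integral_finsetSum _ fun j _ => hiφ j]
      refine integral_congr_ae (Eventually.of_forall fun y => ?_)
      simp only
      rw [PiLp.inner_apply]
      exact Finset.sum_congr rfl fun j _ => by
        rw [RCLike.inner_apply, conj_trivial, mul_comm]
    rw [hu, integral_pressurePotential_mul_div h1 htop hφ hc, hf, ← Finset.sum_sub_distrib]
    refine Finset.sum_congr rfl fun j _ => ?_
    simp only [hsub]
    rw [integral_sub (hiA j) (hiφ j), sub_sub_cancel]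
  incompressible χ hχ hc := by
    rw [integral_inner_resolventPotential hε a h1 htop (continuous_gradient hχ)
      (hasCompactSupport_gradient hc)]
    simp [adjointPotential_gradient hε a hχ hc]

end RotStokes

end

theorem proposition3p8 :
    ∃ C : ℝ, 0 < C ∧
      ∀ (a : ℝ) (_ha : a ≠ 0) (f : RotStokes.Plane → RotStokes.Plane)
        (_hf_one : MemLp f 1 volume) (_hf_top : MemLp f ∞ volume)
        (_hf_moment : Integrable (fun x => ‖x‖ * ‖f x‖) volume)
        (_hf_decay : f =O[Bornology.cobounded RotStokes.Plane ⊓ ae volume]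
          fun x => (‖x‖ ^ 3)⁻¹ * (Real.log ‖x‖)⁻¹)
        (ε : ℝ) (_hε : 0 < ε),
        -- all the integrals that define the kernel and the two potentials converge absolutely
        (∀ x y : RotStokes.Plane, x ≠ y → ∀ i j : Fin 2,
          IntegrableOn (fun t => RotStokes.resolventIntegrand ε a x y t i j) (Ioi 0) volume) ∧
        (∀ x : RotStokes.Plane,
          Integrable (fun y => RotStokes.mulV (RotStokes.resolventKernel ε a x y) (f y)) volume) ∧
        (∀ x : RotStokes.Plane,
          Integrable (fun y => inner ℝ (RotStokes.pressureKernel (x - y)) (f y)) volume) ∧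
        -- the far-field bound
        (∀ ρ : ℝ, Real.exp 1 ≤ ρ →
          (⨆ (x : RotStokes.Plane) (_ : ρ ≤ ‖x‖),
              ENNReal.ofReal (‖x‖ * ‖RotStokes.resolventPotential ε a f x‖))
            ≤ ENNReal.ofReal (C * (1 + |a|⁻¹)) *
              (ENNReal.ofReal (∫ x, (1 + ‖x‖) * ‖f x‖) +
                essSup (fun x => ENNReal.ofReal (‖x‖ ^ 3 * Real.log ‖x‖ * ‖f x‖))
                  (volume.restrict {x : RotStokes.Plane | ρ / 2 ≤ ‖x‖}))) ∧
        -- the system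
        RotStokes.IsDistribSolution ε a f (RotStokes.resolventPotential ε a f)
          (RotStokes.pressurePotential f) := by
  obtain ⟨C, hC, h⟩ := RotStokes.exists_iSup_resolventPotential_le
  refine ⟨C, hC, fun a ha f h1 htop hm _ ε hε => ⟨fun x y hxy i j => ?_, fun x => ?_, fun x => ?_,
    fun ρ hρ => h ε a ρ f hε ha hρ h1 htop hm, ?_⟩⟩
  · exact RotStokes.integrableOn_resolventIntegrand hε a hxy i j
  · exact RotStokes.integrable_mulV_resolventKernel hε a h1 htop x
  · exact RotStokes.integrable_pressureKernel_inner h1 htop x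
  · exact RotStokes.isDistribSolution_resolventPotential hε a h1 htop
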